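/- Let $W=S_3=\langle s,t\rangle$ act on $\mathbb{C}[x,y,z]$ by permuting variables, with $s$ swapping $x,y$ and $t$ swapping $y,z$. Let $\mathtt{C}=\mathbb{C}[x,y,z]/(x+y+z,\;xy+xz+yz,\;xyz)$ be the coinvariant algebra, with invariant subalgebras $\mathtt{C}^s$ and $\mathtt{C}^t$, and let $\mathcal{C}$ be the category of finitely generated $\mathtt{C}$-modules. Let $\theta_e=\mathrm{Id}$, $\theta_s=\mathtt{C}\otimes_{\mathtt{C}^s}-$, $\theta_t=\mathtt{C}\otimes_{\mathtt{C}^t}-$, $\theta_{st}=\theta_s\theta_t$, $\theta_{ts}=\theta_t\theta_s$, $\theta_{sts}=\mathtt{C}\otimes_{\mathbb{C}}-$ as endofunctors of $\mathcal{C}$. Let $\mathscr{S}$ be the 2-category of Soergel bimodules: it has one object (identified with $\mathcal{C}$), its 1-morphisms are the endofunctors of $\mathcal{C}$ isomorphic to direct sums of functors given by tensoring with Soergel bimodules (direct summands of direct sums of tensor products of $\mathtt{C}\otimes_{\mathtt{C}^s}\mathtt{C}$ and $\mathtt{C}\otimes_{\mathtt{C}^t}\mathtt{C}$), and its 2-morphisms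 are all natural transformations. A 2-representation is a strict 2-functor from $\mathscr{S}$ to $\mathbb{C}$-linear categories and linear functors; it is finitary if the category is additive, idempotent split and Krull–Schmidt with finitely many indecomposables up to isomorphism and finite dimensional morphism spaces. Two 2-representations are equivalent if there is a 2-natural transformation between them (a linear functor commuting with the action up to coherent natural isomorphisms) which is an equivalence of categories. For 1-morphisms write $\mathrm{F}\leq_L\mathrm{G}$ if $\mathrm{G}$ is a direct summand of $\mathrm{H}\circ\mathrm{F}$ for some 1-morphism $\mathrm{H}$; left cells are the classes of indecomposable 1-morphisms for the associated equivalence relation. For the left cell $\mathcal{L}$ of $\mathrm{F}$, the cell 2-representation $\mathbf{C}_{\mathcal{L}}$ is the quotient of the additive closure of all indecomposable $\mathrm{G}$ with $\mathrm{F}\leq_L\mathrm{G}$ (on which $\mathscr{S}$ acts by left composition) by its largest $\mathscr{S}$-stable ideal containing no identity morphism of an element of $\mathcal{L}$. Let $\mathcal{L}_e$ and $\mathcal{L}_{sts}$ be the left cells of $\theta_e$ and $\theta_{sts}$. For indecomposable objects $X,Y$ of a 2-representation write $X\to Y$ if $Y$ is a direct summand of $\mathrm{F}X$ for some 1-morphism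 $\mathrm{F}$. The diagram of the 2-representation is the Hasse diagram of the poset of equivalence classes of this preorder; an edge $\rho\to\tau$ is decorated by the set of isomorphism classes of indecomposable 1-morphisms $\mathrm{F}$ such that, for some $X\in\rho$, $\mathrm{F}X$ has a direct summand in $\tau$. A 2-representation is transitive if its diagram has exactly one vertex. A short exact sequence $0\to\mathbf{K}\to\mathbf{M}\to\mathbf{N}\to0$ consists of a 2-representation $\mathbf{M}$ whose diagram has exactly two vertices, a transitive 2-subrepresentation $\mathbf{K}$ on a full subcategory, and the quotient $\mathbf{N}$ of $\mathbf{M}$ by the ideal generated by the identity morphisms of the objects of $\mathbf{K}$. For $(a,b)\in\mathbb{C}^2$ with $$a^2-ab+b^2=0,\qquad a\neq0,\qquad b\neq0,\tag{$*$}$$ put $M_{a,b}=\mathtt{C}/(ax+by)$, and let $\mathcal{C}_{a,b}$ be the additive closure in $\mathcal{C}$ of the full subcategory $\mathcal{C}_{\mathrm{proj}}$ of projective objects together with $M_{a,b}$. The functor $\theta_{sts}$ is a 1-morphism of $\mathscr{S}$, the action of $\mathscr{S}$ on $\mathcal{C}$ restricts to a finitary 2-representation $\mathbf{K}$ on $\mathcal{C}_{\mathrm{proj}}$,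 and the following hold for all $(a,b)$ satisfying $(*)$. (i) The action of $\mathscr{S}$ restricts to $\mathcal{C}_{a,b}$ and gives a finitary 2-representation $\mathbf{M}_{a,b}$. (ii) There is a short exact sequence $0\to\mathbf{K}\to\mathbf{M}_{a,b}\to\mathbf{N}_{a,b}\to0$ given by the natural inclusion and the natural projection, where $\mathbf{N}_{a,b}$ is finitary, $\mathbf{K}$ is equivalent to $\mathbf{C}_{\mathcal{L}_{sts}}$ and $\mathbf{N}_{a,b}$ is equivalent to $\mathbf{C}_{\mathcal{L}_e}$. (iii) The diagram of $\mathbf{M}_{a,b}$ has exactly two vertices: $\rho$, consisting of the indecomposable objects which are nonzero in $\mathbf{N}_{a,b}$, and $\tau$, consisting of those isomorphic to an object of $\mathbf{K}$. They are joined by an edge $\rho\to\tau$ decorated by exactly $\{\theta_s,\theta_t,\theta_{st},\theta_{ts},\theta_{sts}\}$ (up to isomorphism of 1-morphisms). (iv) For $(a,b)$ and $(a',b')$ satisfying $(*)$ the following are equivalent: (a) $\mathbf{M}_{a,b}$ and $\mathbf{M}_{a',b'}$ are equivalent 2-representations; (b) the $\mathtt{C}$-modules $M_{a,b}$ and $M_{a',b'}$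 are isomorphic; (c) $(a,b)=\lambda(a',b')$ for some nonzero $\lambda\in\mathbb{C}$. -/

import Mathlib

open CategoryTheory CategoryTheory.Limits
open scoped TensorProduct

noncomputable section

namespace SoergelA2

/-- The polynomial algebra `ℂ[x, y, z]`, with `x, y, z` the variables `0, 1, 2`. -/
abbrev Poly : Type := MvPolynomial (Fin 3) ℂ

/-- The ideal generated by `x + y + z`, `xy + xz + yz` and `xyz`. -/
def coinvIdeal : Ideal Poly :=
  Ideal.span {MvPolynomial.X 0 + MvPolynomial.X 1 + MvPolynomial.X 2,
    MvPolynomial.X 0 * MvPolynomial.X 1 + MvPolynomial.X 0 * MvPolynomial.X 2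
      + MvPolynomial.X 1 * MvPolynomial.X 2,
    MvPolynomial.X 0 * MvPolynomial.X 1 * MvPolynomial.X 2}

/-- The coinvariant algebra `C` of type `A₂`. -/
abbrev Coinv : Type := Poly ⧸ coinvIdeal

/-- The images in `C` of the variables. -/
def coord (i : Fin 3) : Coinv := Ideal.Quotient.mk coinvIdeal (MvPolynomial.X i)

theorem coord_cube (i : Fin 3) : coord i ^ 3 = 0 := by
  rw [coord, ← map_pow, Ideal.Quotient.eq_zero_iff_mem]
  have h1 := Ideal.subset_span (α := Poly) (s := {MvPolynomial.X 0 + MvPolynomial.X 1 + MvPolynomial.X 2,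
    MvPolynomial.X 0 * MvPolynomial.X 1 + MvPolynomial.X 0 * MvPolynomial.X 2
      + MvPolynomial.X 1 * MvPolynomial.X 2,
    MvPolynomial.X 0 * MvPolynomial.X 1 * MvPolynomial.X 2})
  have e1 := h1 (Or.inl rfl)
  have e2 := h1 (Or.inr (Or.inl rfl))
  have e3 := h1 (Or.inr (Or.inr rfl))
  have key := Ideal.add_mem _ (Ideal.sub_mem _
    (Ideal.mul_mem_left _ (MvPolynomial.X i ^ 2) e1)
    (Ideal.mul_mem_left _ (MvPolynomial.X i) e2)) e3
  rw [coinvIdeal]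
  convert key using 1
  fin_cases i <;> simp <;> ring

instance finite_coinv : Module.Finite ℂ Coinv := by
  have hft : Algebra.FiniteType ℂ Coinv :=
    Algebra.FiniteType.of_surjective (Ideal.Quotient.mkₐ ℂ coinvIdeal)
      (Ideal.Quotient.mkₐ_surjective ℂ coinvIdeal)
  have hint : Algebra.IsIntegral ℂ Coinv := by
    constructor
    intro c
    obtain ⟨p, rfl⟩ := Ideal.Quotient.mk_surjective c
    induction p using MvPolynomial.induction_on with
    | C a => exact isIntegral_algebraMap (R := ℂ) (A := Coinv) (x := a)
    | add p q hp hq => rw [map_add]; exact hp.add hq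
    | mul_X p i hp =>
      rw [map_mul]
      refine hp.mul (IsIntegral.of_pow (n := 3) (by norm_num) ?_)
      have := coord_cube i
      rw [coord] at this
      rw [this]
      exact isIntegral_zero
  exact Algebra.IsIntegral.finite

theorem rename_mem_coinvIdeal (σ : Equiv.Perm (Fin 3)) :
    coinvIdeal ≤ coinvIdeal.comap (MvPolynomial.rename (R := ℂ) σ) := by
  have s1 : ∑ i, (MvPolynomial.X i : Poly) ∈ coinvIdeal :=
    Ideal.subset_span (Or.inl (Fin.sum_univ_three _))
  have s3 : ∏ i, (MvPolynomial.X i : Poly) ∈ coinvIdeal :=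
    Ideal.subset_span (Or.inr (Or.inr (Fin.prod_univ_three _)))
  have s2 : ∑ i, (MvPolynomial.X i : Poly) ^ 2 ∈ coinvIdeal := by
    have e1 : (MvPolynomial.X 0 + MvPolynomial.X 1 + MvPolynomial.X 2 : Poly) ∈ coinvIdeal :=
      Ideal.subset_span (Or.inl rfl)
    have e2 : (MvPolynomial.X 0 * MvPolynomial.X 1 + MvPolynomial.X 0 * MvPolynomial.X 2
      + MvPolynomial.X 1 * MvPolynomial.X 2 : Poly) ∈ coinvIdeal :=
      Ideal.subset_span (Or.inr (Or.inl rfl))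
    have key := Ideal.sub_mem _ (Ideal.mul_mem_left _
      (MvPolynomial.X 0 + MvPolynomial.X 1 + MvPolynomial.X 2 : Poly) e1)
      (Ideal.mul_mem_left _ 2 e2)
    convert key using 1
    rw [Fin.sum_univ_three]
    ring
  have t1 : ∑ i, (MvPolynomial.X (σ i) : Poly) ∈ coinvIdeal := by
    rw [Equiv.sum_comp σ (fun i => (MvPolynomial.X i : Poly))]; exact s1
  have t2 : ∑ i, (MvPolynomial.X (σ i) : Poly) ^ 2 ∈ coinvIdeal := by
    rw [Equiv.sum_comp σ (fun i => (MvPolynomial.X i : Poly) ^ 2)]; exact s2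
  have t3 : ∏ i, (MvPolynomial.X (σ i) : Poly) ∈ coinvIdeal := by
    rw [Equiv.prod_comp σ (fun i => (MvPolynomial.X i : Poly))]; exact s3
  rw [Fin.sum_univ_three] at t1 t2
  rw [Fin.prod_univ_three] at t3
  refine Ideal.span_le.mpr ?_
  rintro p (rfl | rfl | rfl)
  · simpa using t1
  · have key := Ideal.mul_mem_left _ (MvPolynomial.C (1 / 2 : ℂ)) (Ideal.sub_mem _
      (Ideal.mul_mem_left _ (MvPolynomial.X (σ 0) + MvPolynomial.X (σ 1)
        + MvPolynomial.X (σ 2) : Poly) t1) t2)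
    have hC : (MvPolynomial.C (1 / 2 : ℂ) : Poly) * 2 = 1 := by
      have : (2 : Poly) = MvPolynomial.C (2 : ℂ) := (map_ofNat MvPolynomial.C 2).symm
      rw [this, ← MvPolynomial.C_mul]
      norm_num
    simp only [SetLike.mem_coe, Ideal.mem_comap, map_add, map_mul, MvPolynomial.rename_X]
    convert key using 1
    linear_combination (-(MvPolynomial.X (σ 0) * MvPolynomial.X (σ 1)
      + MvPolynomial.X (σ 0) * MvPolynomial.X (σ 2)
      + MvPolynomial.X (σ 1) * MvPolynomial.X (σ 2) : Poly)) * hC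
  · simpa using t3

/-- The action of a permutation of the variables on `C`. -/
def permAct (σ : Equiv.Perm (Fin 3)) : Coinv →ₐ[ℂ] Coinv :=
  Ideal.quotientMapₐ coinvIdeal (MvPolynomial.rename σ) (rename_mem_coinvIdeal σ)

/-- The subalgebra of `C` of elements invariant under a permutation of the variables. -/
def invariants (σ : Equiv.Perm (Fin 3)) : Subalgebra ℂ Coinv :=
  AlgHom.equalizer (permAct σ) (AlgHom.id ℂ Coinv)

section Induction

variable {R : Type} [CommRing R] [Algebra ℂ R]

instance finite_tensor [Module.Finite ℂ R] (A : Subalgebra ℂ R) (M : FGModuleCat.{0} R) :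
    Module.Finite R (R ⊗[A] M) := by
  have : Module.Finite A R := Module.Finite.of_restrictScalars_finite ℂ A R
  have : Module.Finite A M := Module.Finite.trans R M
  infer_instance

section Unbundled

variable {L M N : Type} [AddCommGroup L] [AddCommGroup M] [AddCommGroup N]
  [Module R L] [Module R M] [Module R N]

/-- The map `id ⊗ f : R ⊗_A M → R ⊗_A N` for an `R`-linear map `f : M → N`. -/
def thetaMap (A : Subalgebra ℂ R) (f : M →ₗ[R] N) : R ⊗[A] M →ₗ[R] R ⊗[A] N :=
  LinearMap.baseChange R (f.restrictScalars A)

theorem thetaMap_tmul (A : Subalgebra ℂ R) (f : M →ₗ[R] N) (r : R) (m : M) :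
    thetaMap A f (r ⊗ₜ[A] m) = r ⊗ₜ[A] f m := rfl

theorem thetaMap_id (A : Subalgebra ℂ R) :
    thetaMap A (LinearMap.id : M →ₗ[R] M) = LinearMap.id := by
  apply TensorProduct.AlgebraTensorModule.ext
  intro r m
  rfl

theorem thetaMap_comp (A : Subalgebra ℂ R) (f : L →ₗ[R] M) (g : M →ₗ[R] N) :
    thetaMap A (g ∘ₗ f) = thetaMap A g ∘ₗ thetaMap A f := by
  apply TensorProduct.AlgebraTensorModule.ext
  intro r m
  rfl

theorem thetaMap_add (A : Subalgebra ℂ R) (f g : M →ₗ[R] N) :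
    thetaMap A (f + g) = thetaMap A f + thetaMap A g := by
  apply TensorProduct.AlgebraTensorModule.ext
  intro r m
  simp only [thetaMap_tmul, LinearMap.add_apply, TensorProduct.tmul_add]

theorem thetaMap_smul (A : Subalgebra ℂ R) (c : ℂ) (f : M →ₗ[R] N) :
    thetaMap A (algebraMap ℂ R c • f) = algebraMap ℂ R c • thetaMap A f := by
  apply TensorProduct.AlgebraTensorModule.ext
  intro r m
  simp only [thetaMap_tmul, LinearMap.smul_apply]
  have h : algebraMap ℂ R c • f m = (algebraMap ℂ A c) • f m := rfl
  rw [h, TensorProduct.tmul_smul]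
  rfl

end Unbundled

variable [Module.Finite ℂ R]

/-- The functor `R ⊗_A -`, that is, tensoring over `R` with the bimodule `R ⊗_A R`. -/
def theta (A : Subalgebra ℂ R) : FGModuleCat.{0} R ⥤ FGModuleCat.{0} R where
  obj M := FGModuleCat.of R (R ⊗[A] M)
  map f := FGModuleCat.ofHom (thetaMap A f.hom.hom)
  map_id _ := FGModuleCat.hom_ext (thetaMap_id A)
  map_comp f g := FGModuleCat.hom_ext (thetaMap_comp A f.hom.hom g.hom.hom)

instance theta_additive (A : Subalgebra ℂ R) : (theta A).Additive where
  map_add {_ _ f g} := FGModuleCat.hom_ext (thetaMap_add A f.hom.hom g.hom.hom)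

instance theta_linear (A : Subalgebra ℂ R) : (theta A).Linear ℂ where
  map_smul f c := FGModuleCat.hom_ext (thetaMap_smul A c f.hom.hom)

end Induction

/-- The category of finitely generated `C`-modules. -/
abbrev ModC : Type 1 := FGModuleCat.{0} Coinv

/-- The endofunctor `θ_s` of `C`-mod, tensoring with `C ⊗_{C^s} C`, where `s` swaps `x` and `y`. -/
def thetaS : ModC ⥤ ModC := theta (invariants (Equiv.swap 0 1))

/-- The endofunctor `θ_t` of `C`-mod, tensoring with `C ⊗_{C^t} C`, where `t` swaps `y` and `z`. -/
def thetaT : ModC ⥤ ModC := theta (invariants (Equiv.swap 1 2))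

/-- The endofunctor `θ_{sts}` of `C`-mod: tensoring with `C ⊗_ℂ C`. -/
def thetaSTS : ModC ⥤ ModC := theta ⊥

/-- The `1`-morphisms of the `2`-category `S`: endofunctors isomorphic to direct sums of functors
given by tensoring with Soergel bimodules. Soergel bimodules are the direct summands of direct sums
of tensor products of the bimodules `C ⊗_{C^s} C` and `C ⊗_{C^t} C`, so these endofunctors form the
smallest class which contains the identity, `θ_s` and `θ_t` and is closed under composition, finite
direct sums and direct summands (hence also under isomorphisms). -/
inductive IsSoergel : (ModC ⥤ ModC) → Prop
  | id : IsSoergel (𝟭 ModC)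
  | theta_s : IsSoergel thetaS
  | theta_t : IsSoergel thetaT
  | comp {F G : ModC ⥤ ModC} : IsSoergel F → IsSoergel G → IsSoergel (G ⋙ F)
  | biprod {F G : ModC ⥤ ModC} (b : BinaryBicone F G) (hb : b.IsBilimit) :
      IsSoergel F → IsSoergel G → IsSoergel b.pt
  | retract {F G : ModC ⥤ ModC} (r : Retract F G) : IsSoergel G → IsSoergel F

theorem linear_of_retract {F G : ModC ⥤ ModC} (r : Retract F G)
    (h : G.Additive ∧ G.Linear ℂ) : F.Additive ∧ F.Linear ℂ := by
  obtain ⟨h1, h2⟩ := h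
  have key : ∀ {X Y : ModC} (f : X ⟶ Y), F.map f = r.i.app X ≫ G.map f ≫ r.r.app Y := by
    intro X Y f
    rw [← NatTrans.naturality_assoc, ← NatTrans.comp_app, r.retract, NatTrans.id_app,
      Category.comp_id]
  constructor
  · constructor
    intro X Y f g
    rw [key, key f, key g, G.map_add, Preadditive.add_comp, Preadditive.comp_add]
  · constructor
    intro X Y f c
    rw [key, key f, G.map_smul, Linear.smul_comp, Linear.comp_smul]

theorem linear_of_biprod {F G : ModC ⥤ ModC} (b : BinaryBicone F G) (hb : b.IsBilimit)
    (hF : F.Additive ∧ F.Linear ℂ) (hG : G.Additive ∧ G.Linear ℂ) :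
    b.pt.Additive ∧ b.pt.Linear ℂ := by
  obtain ⟨h1, h2⟩ := hF
  obtain ⟨h3, h4⟩ := hG
  have tot : b.fst ≫ b.inl + b.snd ≫ b.inr = 𝟙 b.pt := IsBilimit.binary_total hb
  have key : ∀ {X Y : ModC} (f : X ⟶ Y), b.pt.map f =
      b.fst.app X ≫ F.map f ≫ b.inl.app Y + b.snd.app X ≫ G.map f ≫ b.inr.app Y := by
    intro X Y f
    have := congrArg (fun α => α.app Y) tot
    simp only [NatTrans.app_add, NatTrans.comp_app, NatTrans.id_app] at this
    rw [← NatTrans.naturality_assoc, ← NatTrans.naturality_assoc, ← Preadditive.comp_add, this,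
      Category.comp_id]
  constructor
  · constructor
    intro X Y f g
    rw [key, key f, key g, F.map_add, G.map_add]
    simp only [Preadditive.add_comp, Preadditive.comp_add]
    abel
  · constructor
    intro X Y f c
    rw [key, key f, F.map_smul, G.map_smul]
    simp only [Linear.smul_comp, Linear.comp_smul, smul_add]

theorem IsSoergel.additive_linear {F : ModC ⥤ ModC} (h : IsSoergel F) :
    F.Additive ∧ F.Linear ℂ := by
  induction h with
  | id => exact ⟨inferInstance, inferInstance⟩
  | theta_s => exact ⟨theta_additive _, theta_linear _⟩
  | theta_t => exact ⟨theta_additive _, theta_linear _⟩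
  | comp _ _ hF hG =>
    obtain ⟨h1, h2⟩ := hF
    obtain ⟨h3, h4⟩ := hG
    exact ⟨inferInstance, inferInstance⟩
  | biprod b hb _ _ hF hG => exact linear_of_biprod b hb hF hG
  | retract r _ hG => exact linear_of_retract r hG

/-- The category of `1`-morphisms and `2`-morphisms of the one-object `2`-category `S`. -/
abbrev S : Type 1 := ObjectProperty.FullSubcategory (C := ModC ⥤ ModC) IsSoergel


instance (F : S) : F.obj.Additive := F.property.additive_linear.1
instance (F : S) : F.obj.Linear ℂ := F.property.additive_linear.2

namespace S

/-- The identity `1`-morphism `θ_e`. -/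
abbrev one : S := ⟨𝟭 ModC, IsSoergel.id⟩

/-- Composition `F ∘ G` of `1`-morphisms. -/
abbrev comp (F G : S) : S := ⟨G.obj ⋙ F.obj, IsSoergel.comp F.property G.property⟩

/-- Horizontal composition of `2`-morphisms. -/
def hcomp {F F' G G' : S} (α : F ⟶ F') (β : G ⟶ G') : comp F G ⟶ comp F' G' :=
  ObjectProperty.homMk (β.hom ◫ α.hom)

theorem hom_ext_app {F G : S} {α β : F ⟶ G} (h : ∀ X : ModC, α.hom.app X = β.hom.app X) :
    α = β := by
  apply ObjectProperty.hom_ext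
  ext X : 2
  exact h X

theorem hcomp_app {F F' G G' : S} (α : F ⟶ F') (β : G ⟶ G') (X : ModC) :
    (hcomp α β).hom.app X = α.hom.app (G.obj.obj X) ≫ F'.obj.map (β.hom.app X) := rfl

theorem hcomp_left (F : S) {G G' : S} (β : G ⟶ G') (X : ModC) :
    (hcomp (𝟙 F) β).hom.app X = F.obj.map (β.hom.app X) :=
  Category.id_comp (F.obj.map (β.hom.app X))

theorem hcomp_right {F F' : S} (α : F ⟶ F') (G : S) (X : ModC) :
    (hcomp α (𝟙 G)).hom.app X = α.hom.app (G.obj.obj X) :=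
  (congrArg (α.hom.app (G.obj.obj X) ≫ ·) (F'.obj.map_id _)).trans (Category.comp_id _)

theorem add_app {F G : S} (α β : F ⟶ G) (X : ModC) :
    (α + β).hom.app X = α.hom.app X + β.hom.app X := rfl

theorem smul_app {F G : S} (c : ℂ) (α : F ⟶ G) (X : ModC) :
    (c • α).hom.app X = c • α.hom.app X := rfl

theorem id_app (F : S) (X : ModC) :
    NatTrans.app (InducedCategory.Hom.hom (𝟙 F)) X = 𝟙 (F.obj.obj X) := rfl

theorem comp_app {F G H : S} (α : F ⟶ G) (β : G ⟶ H) (X : ModC) :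
    (α ≫ β).hom.app X = α.hom.app X ≫ β.hom.app X := rfl

end S

/-! ### 2-representations -/

universe v u v' u' v'' u''

/-- A `2`-representation of the one-object `2`-category `S`: a strict `2`-functor which sends the
object to a `ℂ`-linear category, `1`-morphisms to linear functors and `2`-morphisms to natural
transformations, linearly in the `2`-morphism. Both sides of the last law have propositionally equal
types, by `act_comp`, whence the heterogeneous equality. -/
structure TwoRep where
  carrier : Type u
  [category : Category.{v} carrier]
  [preadditive : Preadditive carrier]
  [linear : Linear ℂ carrier]
  act : S → (carrier ⥤ carrier)
  act₂ : ∀ {F G : S}, (F ⟶ G) → (act F ⟶ act G)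
  act_additive : ∀ F : S, (act F).Additive
  act_linear : ∀ F : S, (act F).Linear ℂ
  act₂_id : ∀ F : S, act₂ (𝟙 F) = 𝟙 (act F)
  act₂_comp : ∀ {F G H : S} (α : F ⟶ G) (β : G ⟶ H), act₂ (α ≫ β) = act₂ α ≫ act₂ β
  act₂_add : ∀ {F G : S} (α β : F ⟶ G), act₂ (α + β) = act₂ α + act₂ β
  act₂_smul : ∀ {F G : S} (c : ℂ) (α : F ⟶ G), act₂ (c • α) = c • act₂ α
  act_one : act S.one = 𝟭 carrier
  act_comp : ∀ F G : S, act (S.comp F G) = act G ⋙ act F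
  act₂_hcomp : ∀ {F F' G G' : S} (α : F ⟶ F') (β : G ⟶ G') (X : carrier),
    HEq ((act₂ (S.hcomp α β)).app X) ((act₂ β ◫ act₂ α).app X)

namespace TwoRep

attribute [instance] TwoRep.category TwoRep.preadditive TwoRep.linear
  TwoRep.act_additive TwoRep.act_linear

/-- The defining action of `S` on `C`-mod. -/
def natural : TwoRep.{0, 1} where
  carrier := ModC
  act F := F.obj
  act₂ α := α.hom
  act_additive _ := inferInstance
  act_linear _ := inferInstance
  act₂_id _ := rfl
  act₂_comp _ _ := rfl
  act₂_add _ _ := rfl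
  act₂_smul _ _ := rfl
  act_one := rfl
  act_comp _ _ := rfl
  act₂_hcomp _ _ _ := HEq.rfl

/-- Left composition with `F`. -/
abbrev leftComp (F : S) : S ⥤ S where
  obj G := S.comp F G
  map β := S.hcomp (𝟙 F) β
  map_id G := S.hom_ext_app fun X => (S.hcomp_left F (𝟙 G) X).trans (F.obj.map_id _)
  map_comp β γ := S.hom_ext_app fun X => by
    rw [S.comp_app, S.hcomp_left, S.hcomp_left, S.hcomp_left]
    exact F.obj.map_comp _ _

theorem leftComp_map_add (F : S) {G H : S} (f g : G ⟶ H) :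
    (leftComp F).map (f + g) = (leftComp F).map f + (leftComp F).map g :=
  S.hom_ext_app fun X => by
    rw [S.add_app, S.hcomp_left, S.hcomp_left, S.hcomp_left, S.add_app, Functor.map_add]

theorem leftComp_map_smul (F : S) {G H : S} (f : G ⟶ H) (c : ℂ) :
    (leftComp F).map (c • f) = c • (leftComp F).map f :=
  S.hom_ext_app fun X => by
    rw [S.smul_app, S.hcomp_left, S.hcomp_left, S.smul_app, Functor.map_smul]

theorem leftComp_comp_map (F G : S) {H K : S} (β : H ⟶ K) :
    (leftComp (S.comp F G)).map β = (leftComp F).map ((leftComp G).map β) :=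
  S.hom_ext_app fun X => by
    rw [S.hcomp_left, S.hcomp_left, S.hcomp_left, Functor.comp_map]

/-- The principal `2`-representation: `S` acts on itself by left composition. -/
def principal : TwoRep.{1, 1} where
  carrier := S
  act := leftComp
  act₂ {F F'} α :=
    { app G := S.hcomp α (𝟙 G)
      naturality G H β := S.hom_ext_app fun X => by
        rw [S.comp_app, S.comp_app, S.hcomp_left, S.hcomp_left, S.hcomp_right, S.hcomp_right]
        exact α.hom.naturality _ }
  act_additive F := ⟨@fun _ _ f g => leftComp_map_add F f g⟩
  act_linear F := ⟨fun f c => leftComp_map_smul F f c⟩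
  act₂_id F := by
    ext G : 2
    exact S.hom_ext_app fun X => S.hcomp_right (𝟙 F) G X
  act₂_comp α β := by
    ext K : 2
    refine S.hom_ext_app fun X => (S.hcomp_right (α ≫ β) K X).trans ?_
    exact (congrArg₂ (· ≫ ·) (S.hcomp_right α K X) (S.hcomp_right β K X)).symm
  act₂_add α β := by
    ext K : 2
    refine S.hom_ext_app fun X => (S.hcomp_right (α + β) K X).trans ?_
    exact (congrArg₂ (· + ·) (S.hcomp_right α K X) (S.hcomp_right β K X)).symm
  act₂_smul c α := by
    ext K : 2
    refine S.hom_ext_app fun X => (S.hcomp_right (c • α) K X).trans ?_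
    exact (congrArg (c • ·) (S.hcomp_right α K X)).symm
  act_one :=
    Functor.hext (fun _ => rfl) fun _ _ β =>
      heq_of_eq (S.hom_ext_app fun X => S.hcomp_left S.one β X)
  act_comp F G := Functor.hext (fun _ => rfl) fun _ _ β => heq_of_eq (leftComp_comp_map F G β)
  act₂_hcomp {F F' G G'} α β K := heq_of_eq (S.hom_ext_app fun X => by
    refine (S.hcomp_right (S.hcomp α β) K X).trans ?_
    refine (S.hcomp_app α β (K.obj.obj X)).trans ?_
    exact (congrArg₂ (· ≫ ·) (S.hcomp_right α (S.comp G K) X)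
      ((S.hcomp_left F' (S.hcomp β (𝟙 K)) X).trans
        (congrArg F'.obj.map (S.hcomp_right β K X)))).symm)

section Sub

variable (M : TwoRep.{v, u})

/-- A property of objects is stable if it is preserved by the action of all `1`-morphisms. -/
def Stable (P : ObjectProperty M.carrier) : Prop :=
  ∀ (F : S) (X : M.carrier), P X → P ((M.act F).obj X)

theorem heq_homMk {A : Type u} [Category.{v} A] {P : ObjectProperty A}
    {X Y X' Y' : P.FullSubcategory} (hX : X = X') (hY : Y = Y')
    {f : X.obj ⟶ Y.obj} {g : X'.obj ⟶ Y'.obj} (h : HEq f g) :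
    HEq (ObjectProperty.homMk f : X ⟶ Y) (ObjectProperty.homMk g : X' ⟶ Y') := by
  subst hX hY
  rw [eq_of_heq h]

/-- The restriction of a `2`-representation to a stable full subcategory. -/
def sub (P : ObjectProperty M.carrier) (hP : M.Stable P) : TwoRep.{v, u} where
  carrier := P.FullSubcategory
  act F := P.lift (P.ι ⋙ M.act F) fun X => hP F X.obj X.property
  act₂ α :=
    { app X := ObjectProperty.homMk ((M.act₂ α).app X.obj)
      naturality X Y f := by
        apply ObjectProperty.hom_ext
        exact (M.act₂ α).naturality f.hom }
  act_additive F := ⟨by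
    intro X Y f g
    apply ObjectProperty.hom_ext
    exact (M.act F).map_add⟩
  act_linear F := ⟨by
    intro X Y f c
    apply ObjectProperty.hom_ext
    exact (M.act F).map_smul _ _⟩
  act₂_id F := by
    ext X : 2
    apply ObjectProperty.hom_ext
    exact congrArg (fun τ => τ.app X.obj) (M.act₂_id F)
  act₂_comp α β := by
    ext X : 2
    apply ObjectProperty.hom_ext
    exact congrArg (fun τ => τ.app X.obj) (M.act₂_comp α β)
  act₂_add α β := by
    ext X : 2
    apply ObjectProperty.hom_ext
    exact congrArg (fun τ => τ.app X.obj) (M.act₂_add α β)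
  act₂_smul c α := by
    ext X : 2
    apply ObjectProperty.hom_ext
    exact congrArg (fun τ => τ.app X.obj) (M.act₂_smul c α)
  act_one := by
    have hobj : ∀ X : P.FullSubcategory, (P.lift (P.ι ⋙ M.act S.one)
        fun X => hP S.one X.obj X.property).obj X = X := fun X =>
      ObjectProperty.FullSubcategory.ext (Functor.congr_obj M.act_one X.obj)
    exact Functor.hext hobj fun X Y f =>
      heq_homMk (hobj X) (hobj Y) (Functor.hcongr_hom M.act_one f.hom)
  act_comp F G := by
    have hobj : ∀ X : P.FullSubcategory, (P.lift (P.ι ⋙ M.act (S.comp F G))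
        fun X => hP (S.comp F G) X.obj X.property).obj X =
        ⟨(M.act F).obj ((M.act G).obj X.obj), hP F _ (hP G _ X.property)⟩ := fun X =>
      ObjectProperty.FullSubcategory.ext (Functor.congr_obj (M.act_comp F G) X.obj)
    exact Functor.hext hobj fun X Y f =>
      heq_homMk (hobj X) (hobj Y) (Functor.hcongr_hom (M.act_comp F G) f.hom)
  act₂_hcomp {F F' G G'} α β X := by
    have hobj : ∀ (F G : S) (X : P.FullSubcategory), (P.lift (P.ι ⋙ M.act (S.comp F G))
        fun X => hP (S.comp F G) X.obj X.property).obj X =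
        ⟨(M.act F).obj ((M.act G).obj X.obj), hP F _ (hP G _ X.property)⟩ := fun F G X =>
      ObjectProperty.FullSubcategory.ext (Functor.congr_obj (M.act_comp F G) X.obj)
    exact heq_homMk (hobj F G X) (hobj F' G' X) (M.act₂_hcomp α β X.obj)

end Sub

section Ideals

/-- Ideals of the underlying category which are invariant under the action of `S`. -/
structure StableIdeal (M : TwoRep.{v, u}) where
  mem : ∀ X Y : M.carrier, Submodule ℂ (X ⟶ Y)
  comp_left : ∀ {X Y Z : M.carrier} (f : X ⟶ Y) (g : Y ⟶ Z), g ∈ mem Y Z → f ≫ g ∈ mem X Z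
  comp_right : ∀ {X Y Z : M.carrier} (f : X ⟶ Y) (g : Y ⟶ Z), f ∈ mem X Y → f ≫ g ∈ mem X Z
  act_mem : ∀ (F : S) {X Y : M.carrier} (f : X ⟶ Y), f ∈ mem X Y →
    (M.act F).map f ∈ mem ((M.act F).obj X) ((M.act F).obj Y)

/-- The stable ideal generated by a class of morphisms: the intersection of all stable ideals
containing it. -/
def StableIdeal.generatedBy (M : TwoRep.{v, u}) (T : MorphismProperty M.carrier) :
    StableIdeal M where
  mem X Y := ⨅ I : {I : StableIdeal M // ∀ (X Y : M.carrier) (f : X ⟶ Y), T f → f ∈ I.mem X Y},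
    I.1.mem X Y
  comp_left f g hg := by
    rw [Submodule.mem_iInf] at hg ⊢
    exact fun I => I.1.comp_left f g (hg I)
  comp_right f g hf := by
    rw [Submodule.mem_iInf] at hf ⊢
    exact fun I => I.1.comp_right f g (hf I)
  act_mem F _ _ f hf := by
    rw [Submodule.mem_iInf] at hf ⊢
    exact fun I => I.1.act_mem F f (hf I)

variable {M : TwoRep.{v, u}} (I : StableIdeal M)

/-- The congruence `f - g ∈ I`. -/
def StableIdeal.rel : HomRel M.carrier := fun X Y f g => f - g ∈ I.mem X Y

instance StableIdeal.congruence : Congruence I.rel where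
  equivalence {X Y} :=
    { refl f := by
        change f - f ∈ I.mem X Y
        rw [sub_self]
        exact Submodule.zero_mem _
      symm {f g} h := by
        change g - f ∈ I.mem X Y
        rw [← neg_sub]
        exact Submodule.neg_mem _ h
      trans {f g k} h h' := by
        change f - k ∈ I.mem X Y
        rw [← sub_add_sub_cancel f g k]
        exact Submodule.add_mem _ h h' }
  comp_left {X Y Z} f g g' h := by
    change f ≫ g - f ≫ g' ∈ I.mem X Z
    rw [← Preadditive.comp_sub]
    exact I.comp_left _ _ h
  comp_right {X Y Z f f'} g h := by
    change f ≫ g - f' ≫ g ∈ I.mem X Z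
    rw [← Preadditive.sub_comp]
    exact I.comp_right _ _ h

theorem StableIdeal.rel_add ⦃X Y : M.carrier⦄ (f₁ f₂ g₁ g₂ : X ⟶ Y) (h : I.rel f₁ f₂)
    (h' : I.rel g₁ g₂) : I.rel (f₁ + g₁) (f₂ + g₂) := by
  change f₁ + g₁ - (f₂ + g₂) ∈ I.mem X Y
  rw [add_sub_add_comm]
  exact Submodule.add_mem _ h h'

theorem StableIdeal.rel_smul (c : ℂ) ⦃X Y : M.carrier⦄ (f₁ f₂ : X ⟶ Y) (h : I.rel f₁ f₂) :
    I.rel (c • f₁) (c • f₂) := by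
  change c • f₁ - c • f₂ ∈ I.mem X Y
  rw [← smul_sub]
  exact Submodule.smul_mem _ _ h

theorem StableIdeal.rel_act (F : S) ⦃X Y : M.carrier⦄ (f₁ f₂ : X ⟶ Y) (h : I.rel f₁ f₂) :
    I.rel ((M.act F).map f₁) ((M.act F).map f₂) := by
  change (M.act F).map f₁ - (M.act F).map f₂ ∈ I.mem _ _
  rw [← Functor.map_sub]
  exact I.act_mem F _ h

instance StableIdeal.preadditiveQuotient : Preadditive (CategoryTheory.Quotient I.rel) :=
  CategoryTheory.Quotient.preadditive I.rel I.rel_add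

instance StableIdeal.functor_additive : (CategoryTheory.Quotient.functor I.rel).Additive :=
  CategoryTheory.Quotient.functor_additive I.rel I.rel_add

instance StableIdeal.linearQuotient : Linear ℂ (CategoryTheory.Quotient I.rel) :=
  CategoryTheory.Quotient.linear ℂ I.rel I.rel_smul

instance StableIdeal.functor_linear : (CategoryTheory.Quotient.functor I.rel).Linear ℂ :=
  CategoryTheory.Quotient.linear_functor ℂ I.rel I.rel_smul

/-- The functor induced by a `1`-morphism on the quotient by a stable ideal. -/
abbrev StableIdeal.actQuotient (F : S) : CategoryTheory.Quotient I.rel ⥤ CategoryTheory.Quotient I.rel :=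
  CategoryTheory.Quotient.lift I.rel (M.act F ⋙ CategoryTheory.Quotient.functor I.rel) fun _ _ f₁ f₂ h =>
    CategoryTheory.Quotient.sound I.rel (I.rel_act F f₁ f₂ h)

theorem heq_functor_map {A : Type u} [Category.{v} A] (r : HomRel A) {X Y X' Y' : A}
    (hX : X = X') (hY : Y = Y') {f : X ⟶ Y} {g : X' ⟶ Y'} (h : HEq f g) :
    HEq ((CategoryTheory.Quotient.functor r).map f) ((CategoryTheory.Quotient.functor r).map g) := by
  subst hX hY
  rw [eq_of_heq h]

/-- The quotient of a `2`-representation by a stable ideal. -/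
def quotient (M : TwoRep.{v, u}) (I : StableIdeal M) : TwoRep.{v, u} where
  carrier := CategoryTheory.Quotient I.rel
  act F := I.actQuotient F
  act₂ α :=
    { app X := (CategoryTheory.Quotient.functor I.rel).map ((M.act₂ α).app X.as)
      naturality := by
        rintro ⟨X⟩ ⟨Y⟩ ⟨f⟩
        exact congrArg (CategoryTheory.Quotient.functor I.rel).map ((M.act₂ α).naturality f) }
  act_additive F := ⟨by
    rintro ⟨X⟩ ⟨Y⟩ ⟨f⟩ ⟨g⟩
    exact congrArg (CategoryTheory.Quotient.functor I.rel).map ((M.act F).map_add (f := f) (g := g))⟩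
  act_linear F := ⟨by
    rintro ⟨X⟩ ⟨Y⟩ ⟨f⟩ c
    exact congrArg (CategoryTheory.Quotient.functor I.rel).map ((M.act F).map_smul c f)⟩
  act₂_id F := by
    ext ⟨X⟩ : 2
    exact congrArg (fun τ => (CategoryTheory.Quotient.functor I.rel).map (NatTrans.app τ X)) (M.act₂_id F)
  act₂_comp α β := by
    ext ⟨X⟩ : 2
    exact congrArg (fun τ => (CategoryTheory.Quotient.functor I.rel).map (NatTrans.app τ X)) (M.act₂_comp α β)
  act₂_add α β := by
    ext ⟨X⟩ : 2
    exact congrArg (fun τ => (CategoryTheory.Quotient.functor I.rel).map (NatTrans.app τ X)) (M.act₂_add α β)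
  act₂_smul c α := by
    ext ⟨X⟩ : 2
    exact congrArg (fun τ => (CategoryTheory.Quotient.functor I.rel).map (NatTrans.app τ X)) (M.act₂_smul c α)
  act_one := by
    have hobj : ∀ X : CategoryTheory.Quotient I.rel, (I.actQuotient S.one).obj X = X := fun X =>
      CategoryTheory.Quotient.ext (Functor.congr_obj M.act_one X.as)
    refine Functor.hext hobj ?_
    rintro ⟨X⟩ ⟨Y⟩ ⟨f⟩
    exact heq_functor_map I.rel (Functor.congr_obj M.act_one X) (Functor.congr_obj M.act_one Y)
      (Functor.hcongr_hom M.act_one f)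
  act_comp F G := by
    have hobj : ∀ X : CategoryTheory.Quotient I.rel, (I.actQuotient (S.comp F G)).obj X =
        (I.actQuotient F).obj ((I.actQuotient G).obj X) := fun X =>
      CategoryTheory.Quotient.ext (Functor.congr_obj (M.act_comp F G) X.as)
    refine Functor.hext hobj ?_
    rintro ⟨X⟩ ⟨Y⟩ ⟨f⟩
    exact heq_functor_map I.rel (Functor.congr_obj (M.act_comp F G) X)
      (Functor.congr_obj (M.act_comp F G) Y) (Functor.hcongr_hom (M.act_comp F G) f)
  act₂_hcomp {F F' G G'} α β X :=
    heq_functor_map I.rel (Functor.congr_obj (M.act_comp F G) X.as)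
      (Functor.congr_obj (M.act_comp F' G') X.as) (M.act₂_hcomp α β X.as)

end Ideals

section Morphisms

/-- `1`-morphisms of `2`-representations: (not necessarily strict) `2`-natural transformations,
that is, a linear functor `Φ` with natural isomorphisms `Φ ∘ M(F) ≅ N(F) ∘ Φ` for all `1`-morphisms
`F`, compatible with the `2`-morphisms, the identity and the composition of `S`. -/
structure Hom (M : TwoRep.{v, u}) (N : TwoRep.{v', u'}) where
  functor : M.carrier ⥤ N.carrier
  additive : functor.Additive
  linear : functor.Linear ℂ
  comm : ∀ F : S, M.act F ⋙ functor ≅ functor ⋙ N.act F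
  comm_naturality : ∀ {F G : S} (α : F ⟶ G) (X : M.carrier),
    functor.map ((M.act₂ α).app X) ≫ (comm G).hom.app X =
      (comm F).hom.app X ≫ (N.act₂ α).app (functor.obj X)
  comm_one : ∀ X : M.carrier, HEq ((comm S.one).hom.app X) (𝟙 (functor.obj X))
  comm_comp : ∀ (F G : S) (X : M.carrier), HEq ((comm (S.comp F G)).hom.app X)
    ((comm F).hom.app ((M.act G).obj X) ≫ (N.act F).map ((comm G).hom.app X))

/-- Two `2`-representations are equivalent if there is a `2`-natural transformation between them
whose underlying functor is an equivalence of categories. -/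
def Equivalent (M : TwoRep.{v, u}) (N : TwoRep.{v', u'}) : Prop :=
  ∃ Φ : Hom M N, Φ.functor.IsEquivalence

theorem heq_id {A : Type u} [Category.{v} A] {X Y : A} (h : X = Y) : HEq (𝟙 X) (𝟙 Y) := by
  subst h
  rfl

/-- The natural inclusion between restrictions of a `2`-representation. -/
def inclusion (M : TwoRep.{v, u}) {P Q : ObjectProperty M.carrier} (h : P ≤ Q)
    (hP : M.Stable P) (hQ : M.Stable Q) : Hom (M.sub P hP) (M.sub Q hQ) where
  functor := ObjectProperty.ιOfLE h
  additive := ⟨rfl⟩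
  linear := ⟨fun _ _ => rfl⟩
  comm F := Iso.refl _
  comm_naturality α X := (Category.comp_id _).trans (Category.id_comp _).symm
  comm_one X := heq_id (Functor.congr_obj (M.sub Q hQ).act_one ((ObjectProperty.ιOfLE h).obj X))
  comm_comp F G X := by
    refine HEq.trans (heq_id (Functor.congr_obj ((M.sub Q hQ).act_comp F G)
      ((ObjectProperty.ιOfLE h).obj X))) (heq_of_eq ?_)
    exact ((Category.id_comp _).trans (((M.sub Q hQ).act F).map_id _)).symm

/-- The natural projection onto the quotient by a stable ideal. -/
def projection (M : TwoRep.{v, u}) (I : StableIdeal M) : Hom M (M.quotient I) where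
  functor := CategoryTheory.Quotient.functor I.rel
  additive := StableIdeal.functor_additive I
  linear := StableIdeal.functor_linear I
  comm F := Iso.refl _
  comm_naturality α X := (Category.comp_id _).trans (Category.id_comp _).symm
  comm_one X := heq_id (Functor.congr_obj (M.quotient I).act_one
    ((CategoryTheory.Quotient.functor I.rel).obj X))
  comm_comp F G X := by
    refine HEq.trans (heq_id (Functor.congr_obj ((M.quotient I).act_comp F G)
      ((CategoryTheory.Quotient.functor I.rel).obj X))) (heq_of_eq ?_)
    exact ((Category.id_comp _).trans (((M.quotient I).act F).map_id _)).symm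

end Morphisms

section Diagrams

/-- An object is indecomposable if it is nonzero and not a direct sum of two nonzero objects. -/
def Indec {A : Type u} [Category.{v} A] [Preadditive A] (X : A) : Prop :=
  ¬ IsZero X ∧ ∀ (Y Z : A) (b : BinaryBicone Y Z), b.IsBilimit → Nonempty (b.pt ≅ X) →
    IsZero Y ∨ IsZero Z

/-- A `2`-representation is finitary if its underlying `ℂ`-linear category is additive, idempotent
split and Krull-Schmidt, with finitely many indecomposable objects up to isomorphism and
finite dimensional spaces of morphisms. -/
structure Finitary (M : TwoRep.{v, u}) : Prop where
  finiteBiproducts : HasFiniteBiproducts M.carrier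
  idempotentSplit : IsIdempotentComplete M.carrier
  krullSchmidt : ∀ X : M.carrier, ∃ (n : ℕ) (f : Fin n → M.carrier) (b : Bicone f),
    Nonempty b.IsBilimit ∧ Nonempty (b.pt ≅ X) ∧ ∀ i, IsLocalRing (End (f i))
  finiteIndec : ∃ (n : ℕ) (f : Fin n → M.carrier), ∀ X : M.carrier, Indec X →
    ∃ i, Nonempty (X ≅ f i)
  finiteHom : ∀ X Y : M.carrier, FiniteDimensional ℂ (X ⟶ Y)

variable (M : TwoRep.{v, u})

/-- The indecomposable objects of a `2`-representation. -/
def Ind : Type u := {X : M.carrier // Indec X}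

/-- The action preorder: `X ≤ Y` (in the literature `X → Y`) if `Y` is a direct summand of
`F X` for some `1`-morphism `F`. -/
instance : Preorder M.Ind where
  le X Y := ∃ F : S, Nonempty (Retract Y.1 ((M.act F).obj X.1))
  le_refl X := ⟨S.one, by rw [M.act_one]; exact ⟨Retract.refl X.1⟩⟩
  le_trans X Y Z := by
    rintro ⟨F, ⟨r⟩⟩ ⟨G, ⟨r'⟩⟩
    refine ⟨S.comp G F, ?_⟩
    rw [M.act_comp]
    exact ⟨r'.trans (r.map (M.act G))⟩

/-- The vertices of the diagram of `M`: classes of indecomposable objects modulo the equivalence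
relation of the action preorder (in particular modulo isomorphism). The diagram is the Hasse
diagram of this poset, so its edges `ρ → τ` are given by the covering relation `ρ ⋖ τ`. -/
abbrev Vertex : Type u := Antisymmetrization M.Ind (· ≤ ·)

/-- The vertex of an indecomposable object. -/
def vertex (X : M.Ind) : M.Vertex := toAntisymmetrization (· ≤ ·) X

/-- The decoration `Θ_{τ,ρ}` of an edge from `ρ` to `τ`, as an isomorphism-closed class of
`1`-morphisms: all indecomposable `F` such that `F X` has an element of `τ` as a direct summand for
some `X` in `ρ`. -/
def decoration (ρ τ : M.Vertex) : Set S :=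
  {F | Indec F ∧ ∃ X Y : M.Ind, M.vertex X = ρ ∧ M.vertex Y = τ ∧
    Nonempty (Retract Y.1 ((M.act F).obj X.1))}

/-- A `2`-representation is transitive if the action preorder is the full relation on a nonempty
set, that is, if its diagram has exactly one vertex. -/
def Transitive : Prop := Nonempty M.Ind ∧ ∀ X Y : M.Ind, X ≤ Y

variable {M}

/-- The class of identity morphisms of the objects in the image of a `1`-morphism of
`2`-representations. -/
inductive ImageId {K : TwoRep.{v', u'}} (i : Hom K M) : MorphismProperty M.carrier
  | of (X : K.carrier) : ImageId i (𝟙 (i.functor.obj X))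

/-- The sequence `0 → K → M → N → 0` given by `i : K → M` and `p : M → N` is short exact: the
diagram of `M` has exactly two vertices, `i` identifies the transitive `2`-representation `K` with
a `2`-subrepresentation (on a full subcategory) of `M`, and `p` identifies `N` with the quotient of
`M` by the ideal generated by the identity morphisms of the objects of `K`. -/
structure IsShortExact {K : TwoRep.{v', u'}} {N : TwoRep.{v'', u''}} (i : Hom K M) (p : Hom M N) :
    Prop where
  two_vertices : Nat.card M.Vertex = 2
  transitive : K.Transitive
  i_full : i.functor.Full
  i_faithful : i.functor.Faithful
  p_full : p.functor.Full
  p_essSurj : p.functor.EssSurj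
  kernel : ∀ {X Y : M.carrier} (f : X ⟶ Y),
    p.functor.map f = 0 ↔ f ∈ (StableIdeal.generatedBy M (ImageId i)).mem X Y

end Diagrams

section Cells

/-- The left preorder on `1`-morphisms: `F ≤ G` if `G` is a direct summand of `H ∘ F` for some
`1`-morphism `H`. -/
def leftLE (F G : S) : Prop := ∃ H : S, Nonempty (Retract G (S.comp H F))

/-- The left cell of `F`. -/
def leftCell (F : S) : Set S := {G | Indec G ∧ leftLE F G ∧ leftLE G F}

theorem stable_leftLE (F : S) : principal.Stable (leftLE F) := by
  rintro K G ⟨H, ⟨r⟩⟩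
  exact ⟨S.comp K H, ⟨r.map (leftComp K)⟩⟩

/-- The `2`-subrepresentation of the principal `2`-representation on the additive closure of all
indecomposable `1`-morphisms `G` with `F ≤ G` in the left preorder; this additive closure consists
of all direct summands of `1`-morphisms of the form `H ∘ F`. -/
def leftIdeal (F : S) : TwoRep.{1, 1} := principal.sub (leftLE F) (stable_leftLE F)

/-- A stable ideal containing no identity morphism of an element of the left cell of `F`. -/
def IsProperIdeal (F : S) (J : StableIdeal (leftIdeal F)) : Prop :=
  ∀ G : (leftIdeal F).carrier, G.obj ∈ leftCell F → 𝟙 G ∉ J.mem G G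

/-- The maximal stable ideal containing no identity morphism of an element of the left cell of `F`,
as the sum of all such ideals. -/
def maximalIdeal (F : S) : StableIdeal (leftIdeal F) :=
  StableIdeal.generatedBy (leftIdeal F) fun X Y f => ∃ J, IsProperIdeal F J ∧ f ∈ J.mem X Y

/-- The cell `2`-representation of the left cell of an indecomposable `1`-morphism `F`. -/
def cellRep (F : S) : TwoRep.{1, 1} := (leftIdeal F).quotient (maximalIdeal F)

end Cells

end TwoRep

/-! ### The 2-representations `K`, `M_{a,b}` and `N_{a,b}` -/

/-- The condition on the parameters. -/
def Admissible (a b : ℂ) : Prop := a ^ 2 - a * b + b ^ 2 = 0 ∧ a ≠ 0 ∧ b ≠ 0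

/-- The submodule `K_{a,b}` of `C` generated by `a x + b y`. -/
def genIdeal (a b : ℂ) : Ideal Coinv := Ideal.span {a • coord 0 + b • coord 1}

/-- The `C`-module `M_{a,b} = C / (a x + b y)`. -/
abbrev quotMod (a b : ℂ) : Type := Coinv ⧸ genIdeal a b

/-- `M_{a,b}` as an object of `C`-mod. -/
def quotObj (a b : ℂ) : ModC := FGModuleCat.of Coinv (quotMod a b)

/-- The additive closure of a class of objects in an additive category: the smallest class
containing it and closed under finite direct sums and direct summands. -/
inductive AddClosure {A : Type 1} [Category.{0} A] [Preadditive A] (P : ObjectProperty A) :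
    ObjectProperty A
  | of {X : A} (hX : P X) : AddClosure P X
  | zero {X : A} (hX : IsZero X) : AddClosure P X
  | biprod {X Y : A} (b : BinaryBicone X Y) (hb : b.IsBilimit) (hX : AddClosure P X)
      (hY : AddClosure P Y) : AddClosure P b.pt
  | retract {X Y : A} (r : Retract X Y) (hY : AddClosure P Y) : AddClosure P X

/-- The projective objects of `C`-mod. -/
def projC : ObjectProperty ModC := fun X => Module.Projective Coinv X

/-- The additive closure `𝒞_{a,b}` of the projective objects together with `M_{a,b}`. -/
def projAnd (a b : ℂ) : ObjectProperty ModC := AddClosure fun X => projC X ∨ X = quotObj a b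

theorem projC_le (a b : ℂ) : projC ≤ projAnd a b := fun _ hX => AddClosure.of (Or.inl hX)

open TwoRep

/-- The `2`-representation `K` on the projective objects. -/
def repK (hK : natural.Stable projC) : TwoRep.{0, 1} := natural.sub projC hK

/-- The `2`-representation `M_{a,b}` on `𝒞_{a,b}`. -/
def repM (a b : ℂ) (hM : natural.Stable (projAnd a b)) : TwoRep.{0, 1} :=
  natural.sub (projAnd a b) hM

/-- The inclusion `K → M_{a,b}`. -/
def inclKM (a b : ℂ) (hK : natural.Stable projC) (hM : natural.Stable (projAnd a b)) :
    Hom (repK hK) (repM a b hM) := natural.inclusion (projC_le a b) hK hM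

/-- The quotient `N_{a,b}` of `M_{a,b}` by the ideal generated by the identity morphisms of the
objects of `K`. -/
def repN (a b : ℂ) (hK : natural.Stable projC) (hM : natural.Stable (projAnd a b)) :
    TwoRep.{0, 1} :=
  (repM a b hM).quotient (StableIdeal.generatedBy _ (ImageId (inclKM a b hK hM)))

/-- The projection `M_{a,b} → N_{a,b}`. -/
def projMN (a b : ℂ) (hK : natural.Stable projC) (hM : natural.Stable (projAnd a b)) :
    Hom (repM a b hM) (repN a b hK hM) := (repM a b hM).projection _

namespace S

/-- `θ_s`. -/
def thS : S := ⟨thetaS, IsSoergel.theta_s⟩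

/-- `θ_t`. -/
def thT : S := ⟨thetaT, IsSoergel.theta_t⟩

/-- `θ_{st} = θ_s ∘ θ_t`. -/
def thST : S := comp thS thT

/-- `θ_{ts} = θ_t ∘ θ_s`. -/
def thTS : S := comp thT thS

/-- `θ_{sts}`, given a proof that it is a `1`-morphism. -/
def thSTS (h : IsSoergel thetaSTS) : S := ⟨thetaSTS, h⟩

end S

end SoergelA2

end

open SoergelA2

/-! Write ℓ = ax + by and ℓ' = bx + ay. By the relation x² + xy + y² = 0 in `Coinv`, the product ℓℓ'
equals (a² − ab + b²)xy, so (∗) gives ℓℓ' = 0 (`ell_mul_ellDual`). With a ≠ 0 it also forces a² ≠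
b², so ℓ and ℓ' span the linear forms. Two consequences carry the proof.

First, C is free over C^s with basis 1, x and over C^t with basis 1, z, and these invariant algebras
are generated by z and by x (`exists_coords_aux`, `invariants_eq`). Modulo ℓ the second basis vector
becomes a multiple of the generator of the invariants, consistently because of (∗), so M_{a,b} is
free of rank one over both subalgebras (`Coords.exists_retraction`). Hence θ_w M_{a,b} is projective
with C as a direct summand for every w ≠ e. Second, multiplication by ℓ' factors as M_{a,b} → C, so
every non-unit of C acts on M_{a,b} through a projective module (`exists_factorization`), and only
scalars survive in N_{a,b}.

The 1-morphisms are controlled by θ_sθ_tθ_s = θ_{sts} ⊕ θ_s, which is given by explicit maps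
(`Coords.total`). Together with freeness of C over each subalgebra it shows that every 1-morphism is
a summand of a finite sum of the six θ_w (`IsSoergel.dominated`). Each θ_w comes from a cyclic
bimodule, so its endomorphism ring is a quotient of C ⊗ C and is local (`IsBasic.isLocalRing`).
Being a summand of a finite sum is expressed by `Dominated`, and `exists_decomposition` turns this
into Krull–Schmidt decompositions. Finitarity, the diagram and its decoration follow.

Cell 2-representations are recognised by `equivalent_cellRep`: a morphism out of the left ideal of F
that is full, reaches every object up to isomorphism, does not kill F and kills every proper ideal
has the maximal ideal as its kernel. For θ_e one evaluates at M_{a,b} and projects to N_{a,b}. For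
θ_{sts} one evaluates at the residue field, where a nonzero value can be normalised to the generator
without leaving the ideal (`exists_evalGen_eq`).

For (iv), C acts by endomorphisms of the identity 1-morphism, so an equivalence preserves
annihilators (`forall_smul_eq_zero_iff`). The image of M_{a,b} is indecomposable with annihilator
(ℓ) ≠ 0, so it can only be M_{a',b'}. The two ideals are then compared in degree one
(`exists_smul_of_genIdeal_eq`). -/

namespace SoergelA2

/-! ### Domination by a class of objects, and Krull–Schmidt decompositions -/

section Domination

universe w₁ w₂ w₃ w₄

variable {A : Type w₁} [Category.{w₂} A] [Preadditive A]
  {B : Type w₃} [Category.{w₄} B] [Preadditive B]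

/-- The identity of `X` is a finite sum of morphisms factoring through objects of `P`; in the
presence of biproducts, `X` is a direct summand of a finite direct sum of objects of `P`. -/
def Dominated (P : ObjectProperty A) (X : A) : Prop :=
  ∃ (ι : Type) (_ : Fintype ι) (G : ι → A) (p : ∀ i, X ⟶ G i) (q : ∀ i, G i ⟶ X),
    (∀ i, P (G i)) ∧ ∑ i, p i ≫ q i = 𝟙 X

namespace Dominated

variable {P Q : ObjectProperty A} {X Y : A}

theorem of (h : P X) : Dominated P X :=
  ⟨Unit, inferInstance, fun _ => X, fun _ => 𝟙 X, fun _ => 𝟙 X, fun _ => h, by simp⟩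

theorem of_isZero (h : IsZero X) : Dominated P X :=
  ⟨Empty, inferInstance, Empty.elim, fun i => i.elim, fun i => i.elim, fun i => i.elim,
    h.eq_of_src _ _⟩

theorem retract (r : Retract X Y) (h : Dominated P Y) : Dominated P X := by
  obtain ⟨ι, _, G, p, q, hG, e⟩ := h
  refine ⟨ι, inferInstance, G, fun i => r.i ≫ p i, fun i => q i ≫ r.r, hG, ?_⟩
  have := congrArg (fun f => r.i ≫ f ≫ r.r) e
  simpa [Preadditive.sum_comp, Preadditive.comp_sum] using this

theorem biprod {Z : A} (p₁ : Z ⟶ X) (q₁ : X ⟶ Z) (p₂ : Z ⟶ Y) (q₂ : Y ⟶ Z)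
    (h : p₁ ≫ q₁ + p₂ ≫ q₂ = 𝟙 Z) (hX : Dominated P X) (hY : Dominated P Y) :
    Dominated P Z := by
  obtain ⟨ι, _, G, p, q, hG, e⟩ := hX
  obtain ⟨κ, _, H, p', q', hH, e'⟩ := hY
  refine ⟨ι ⊕ κ, inferInstance, Sum.elim G H, fun i => match i with
    | .inl i => p₁ ≫ p i
    | .inr i => p₂ ≫ p' i, fun i => match i with
    | .inl i => q i ≫ q₁
    | .inr i => q' i ≫ q₂, ?_, ?_⟩
  · rintro (i | i)
    exacts [hG i, hH i]
  · have h1 := congrArg (fun f => p₁ ≫ f ≫ q₁) e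
    have h2 := congrArg (fun f => p₂ ≫ f ≫ q₂) e'
    simp only [Preadditive.sum_comp, Preadditive.comp_sum, Category.id_comp] at h1 h2
    rw [Fintype.sum_sum_type, ← h, ← h1, ← h2]
    refine congrArg₂ (· + ·) (Finset.sum_congr rfl fun i _ => ?_)
      (Finset.sum_congr rfl fun i _ => ?_)
    · exact (Category.assoc _ _ _).trans (congrArg (p₁ ≫ ·) (Category.assoc _ _ _).symm)
    · exact (Category.assoc _ _ _).trans (congrArg (p₂ ≫ ·) (Category.assoc _ _ _).symm)

theorem bicone {b : BinaryBicone X Y} (hb : b.IsBilimit) (hX : Dominated P X)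
    (hY : Dominated P Y) : Dominated P b.pt :=
  biprod b.fst b.inl b.snd b.inr (IsBilimit.binary_total hb) hX hY

theorem trans (h : Dominated P X) (hPQ : ∀ G, P G → Dominated Q G) : Dominated Q X := by
  obtain ⟨ι, _, G, p, q, hG, e⟩ := h
  choose κ hκ H p' q' hH e' using fun i => hPQ (G i) (hG i)
  refine ⟨Σ i, κ i, inferInstance, fun j => H j.1 j.2, fun j => p j.1 ≫ p' j.1 j.2,
    fun j => q' j.1 j.2 ≫ q j.1, fun j => hH _ _, ?_⟩
  rw [Fintype.sum_sigma, ← e]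
  refine Finset.sum_congr rfl fun i _ => ?_
  have := congrArg (fun f => p i ≫ f ≫ q i) (e' i)
  simpa [Preadditive.sum_comp, Preadditive.comp_sum] using this

theorem mono (h : Dominated P X) (hPQ : P ≤ Q) : Dominated Q X :=
  h.trans fun G hG => of (hPQ G hG)

/-- Domination is an identity between sums of composites, so any additive functor transports it.
Statements about all modules or all 1-morphisms thereby reduce to a few generating ones. -/
theorem map (h : Dominated P X) (F : A ⥤ B) [F.Additive] {Q : ObjectProperty B}
    (hPQ : ∀ G, P G → Dominated Q (F.obj G)) : Dominated Q (F.obj X) := by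
  obtain ⟨ι, _, G, p, q, hG, e⟩ := h
  refine Dominated.trans (P := fun Y => ∃ G, P G ∧ Y = F.obj G)
    ⟨ι, inferInstance, fun i => F.obj (G i), fun i => F.map (p i), fun i => F.map (q i),
      fun i => ⟨G i, hG i, rfl⟩, ?_⟩ ?_
  · have := congrArg F.map e
    simpa using this
  · rintro _ ⟨G, hG, rfl⟩
    exact hPQ G hG

theorem addClosure {A : Type 1} [Category.{0} A] [Preadditive A] {P Q : ObjectProperty A}
    (hPQ : ∀ X, P X → Dominated Q X) {X : A} (h : AddClosure P X) : Dominated Q X := by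
  induction h with
  | of hX => exact hPQ _ hX
  | zero hX => exact of_isZero hX
  | biprod b hb _ _ h1 h2 => exact bicone hb h1 h2
  | retract r _ h => exact h.retract r

/-- An additive functor is full on objects dominated by objects between which it is full. -/
theorem exists_map_eq (F : A ⥤ B) [F.Additive] (hX : Dominated P X) (hY : Dominated Q Y)
    (h : ∀ G H, P G → Q H → ∀ f : F.obj G ⟶ F.obj H, ∃ g, F.map g = f)
    (f : F.obj X ⟶ F.obj Y) : ∃ g, F.map g = f := by
  obtain ⟨ι, _, G, p, q, hG, e⟩ := hX
  obtain ⟨κ, _, H, p', q', hH, e'⟩ := hY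
  choose g hg using fun i j => h (G i) (H j) (hG i) (hH j) (F.map (q i) ≫ f ≫ F.map (p' j))
  refine ⟨∑ i, ∑ j, p i ≫ g i j ≫ q' j, ?_⟩
  have e1 : ∑ i, F.map (p i) ≫ F.map (q i) = 𝟙 (F.obj X) := by
    simpa using congrArg F.map e
  have e2 : ∑ i, F.map (p' i) ≫ F.map (q' i) = 𝟙 (F.obj Y) := by
    simpa using congrArg F.map e'
  have key : f = (∑ i, F.map (p i) ≫ F.map (q i)) ≫ f ≫
      ∑ j, F.map (p' j) ≫ F.map (q' j) := by
    rw [e1, e2, Category.id_comp, Category.comp_id]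
  rw [key]
  simp only [Functor.map_sum, Functor.map_comp, hg, Preadditive.sum_comp, Preadditive.comp_sum,
    Category.assoc]
  exact Finset.sum_comm

end Dominated

theorem not_isZero_of_isLocalRing {X : A} [h : IsLocalRing (End X)] : ¬ IsZero X := by
  intro hX
  exact one_ne_zero (α := End X) (hX.eq_of_src _ _)

/-- A decomposition of `X` gives a + a' = 1 with aa' = a'a = 0. In a local ring one of the two is a
unit, so the other vanishes, and its summand with it. -/
theorem indec_of_isLocalRing {X : A} [h : IsLocalRing (End X)] : TwoRep.Indec X := by
  refine ⟨not_isZero_of_isLocalRing, ?_⟩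
  rintro Y Z b hb ⟨e⟩
  have tot : b.fst ≫ b.inl + b.snd ≫ b.inr = 𝟙 b.pt := IsBilimit.binary_total hb
  let a : End X := e.inv ≫ b.fst ≫ b.inl ≫ e.hom
  let a' : End X := e.inv ≫ b.snd ≫ b.inr ≫ e.hom
  have h1 : a + a' = 1 := by
    have := congrArg (fun f => e.inv ≫ f ≫ e.hom) tot
    simpa [a, a', Preadditive.add_comp, Preadditive.comp_add] using this
  have haa : a * a' = 0 := by
    change a' ≫ a = 0
    simp [a, a']
  have haa' : a' * a = 0 := by
    change a ≫ a' = 0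
    simp [a, a']
  rcases IsLocalRing.isUnit_or_isUnit_of_add_one h1 with h2 | h2
  · right
    have h3 : a' = 0 := (h2.mul_right_eq_zero).1 haa
    rw [IsZero.iff_id_eq_zero]
    have : b.inr ≫ e.hom ≫ a' ≫ e.inv ≫ b.snd = 𝟙 Z := by simp [a']
    rw [← this, h3]
    simp
  · left
    have h3 : a = 0 := (h2.mul_right_eq_zero).1 haa'
    rw [IsZero.iff_id_eq_zero]
    have : b.inl ≫ e.hom ≫ a ≫ e.inv ≫ b.fst = 𝟙 Y := by simp [a]
    rw [← this, h3]
    simp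

theorem Indec.of_iso {X Y : A} (e : X ≅ Y) (h : TwoRep.Indec X) : TwoRep.Indec Y :=
  ⟨fun hY => h.1 (hY.of_iso e), fun U V b hb ⟨e'⟩ => h.2 U V b hb ⟨e' ≪≫ e.symm⟩⟩

/-- A nonzero retract of an object with local endomorphism ring is isomorphic to it. -/
theorem iso_of_retract {X Y : A} (r : Retract X Y) (hX : ¬ IsZero X) (hY : IsLocalRing (End Y)) :
    Nonempty (X ≅ Y) := by
  let e : End Y := r.r ≫ r.i
  have hee : e * (1 - e) = 0 := by
    have : e * e = e := by change e ≫ e = e; simp [e]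
    rw [mul_sub, mul_one, this, sub_self]
  have hee' : (1 - e) * e = 0 := by
    have : e * e = e := by change e ≫ e = e; simp [e]
    rw [sub_mul, one_mul, this, sub_self]
  rcases IsLocalRing.isUnit_or_isUnit_of_add_one (add_sub_cancel e 1) with h | h
  · have h3 := (h.mul_right_eq_zero).1 hee
    exact ⟨⟨r.i, r.r, r.retract, (sub_eq_zero.1 h3).symm⟩⟩
  · have h3 : e = 0 := (h.mul_right_eq_zero).1 hee'
    exact (hX (by
      rw [IsZero.iff_id_eq_zero]
      have : r.i ≫ e ≫ r.r = 𝟙 X := by simp [e]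
      rw [← this, h3]
      simp)).elim

/-- `X` is a finite direct sum of the objects `f i`. -/
theorem exists_bicone_cons {X Y G : A} {m : ℕ} {f : Fin m → A} (b : Bicone f) (hb : b.IsBilimit)
    (eY : b.pt ≅ Y) (i : G ⟶ X) (r : X ⟶ G) (j : Y ⟶ X) (k : X ⟶ Y) (hir : i ≫ r = 𝟙 G)
    (hjk : j ≫ k = 𝟙 Y) (hik : i ≫ k = 0) (hjr : j ≫ r = 0) (htot : r ≫ i + k ≫ j = 𝟙 X) :
    ∃ b' : Bicone (Fin.cons G f : Fin (m + 1) → A), Nonempty b'.IsBilimit ∧ b'.pt = X := by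
  let b' : Bicone (Fin.cons G f : Fin (m + 1) → A) :=
    { pt := X
      π := Fin.cases r fun a => k ≫ eY.inv ≫ b.π a
      ι := Fin.cases i fun a => b.ι a ≫ eY.hom ≫ j
      ι_π := by
        intro a c
        induction a using Fin.cases with
        | zero =>
          induction c using Fin.cases with
          | zero =>
            refine Eq.trans ?_ (dif_pos rfl).symm
            exact hir
          | succ c =>
            refine Eq.trans ?_ (dif_neg (Fin.succ_ne_zero c).symm).symm
            change i ≫ k ≫ eY.inv ≫ b.π c = 0
            rw [← Category.assoc, hik, zero_comp]
        | succ a =>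
          induction c using Fin.cases with
          | zero =>
            refine Eq.trans ?_ (dif_neg (Fin.succ_ne_zero a)).symm
            change (b.ι a ≫ eY.hom ≫ j) ≫ r = 0
            simp [hjr]
          | succ c =>
            have e1 : (b.ι a ≫ eY.hom ≫ j) ≫ k ≫ eY.inv ≫ b.π c = b.ι a ≫ b.π c := by
              simp only [Category.assoc]
              rw [← Category.assoc j k, hjk]
              simp
            by_cases hac : a = c
            · subst hac
              refine Eq.trans ?_ (dif_pos rfl).symm
              exact e1.trans (bicone_ι_π_self b a)
            · refine Eq.trans ?_ (dif_neg fun h => hac (Fin.succ_injective _ h)).symm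
              exact e1.trans (bicone_ι_π_ne b hac) }
  refine ⟨b', ⟨isBilimitOfTotal b' ?_⟩, rfl⟩
  rw [Fin.sum_univ_succ]
  have tot : ∑ a, b.π a ≫ b.ι a = 𝟙 b.pt := IsBilimit.total hb
  have e1 : ∑ a : Fin m, b'.π a.succ ≫ b'.ι a.succ = k ≫ j := by
    have := congrArg (fun f => k ≫ eY.inv ≫ f ≫ eY.hom ≫ j) tot
    simp only [Preadditive.sum_comp, Preadditive.comp_sum, Category.id_comp, Iso.inv_hom_id_assoc,
      Category.assoc] at this
    rw [← this]
    refine Finset.sum_congr rfl fun a _ => ?_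
    change (k ≫ eY.inv ≫ b.π a) ≫ b.ι a ≫ eY.hom ≫ j = _
    simp
  rw [e1]
  exact htot

/-- Krull-Schmidt decompositions in idempotent complete categories. -/
theorem exists_decomposition [IsIdempotentComplete A] {P : ObjectProperty A}
    (hP : ∀ G, P G → IsLocalRing (End G)) {X : A} (hX : Dominated P X) :
    ∃ (n : ℕ) (f : Fin n → A) (b : Bicone f), Nonempty b.IsBilimit ∧ Nonempty (b.pt ≅ X) ∧
      ∀ i, P (f i) := by
  obtain ⟨ι, _, G, p, q, hG, e⟩ := hX
  obtain ⟨n, ⟨eqv⟩⟩ : ∃ n, Nonempty (Fin n ≃ ι) := ⟨_, ⟨(Fintype.equivFin ι).symm⟩⟩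
  rw [← Equiv.sum_comp eqv] at e
  generalize hG' : (fun i => G (eqv i)) = G' at *
  have key : ∀ (n : ℕ) (X : A) (G : Fin n → A) (p : ∀ i, X ⟶ G i) (q : ∀ i, G i ⟶ X),
      (∀ i, P (G i)) → ∑ i, p i ≫ q i = 𝟙 X →
      ∃ (n : ℕ) (f : Fin n → A) (b : Bicone f), Nonempty b.IsBilimit ∧ Nonempty (b.pt ≅ X) ∧
        ∀ i, P (f i) := by
    intro n
    induction n with
    | zero =>
      intro X G p q hG e
      refine ⟨0, G, ⟨X, fun i => i.elim0, fun i => i.elim0, fun i => i.elim0⟩,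
        ⟨isBilimitOfTotal _ ?_⟩, ⟨Iso.refl _⟩, hG⟩
      rw [← e]
      simp
    | succ n ih =>
      intro X G p q hG e
      rw [Fin.sum_univ_succ] at e
      have loc := hP _ (hG 0)
      -- Either `G 0` splits off `X` through some `x`, and the complement is handled by induction.
      -- Or no such composite is a unit. Then `x = 𝟙 X` and locality make `𝟙 - q 0 ≫ p 0`
      -- invertible, hence also `𝟙 - p 0 ≫ q 0`, which is the sum of the remaining terms; `G 0` is
      -- dropped and the inverse is absorbed into the maps `q`.
      by_cases hu : ∃ x : X ⟶ X, IsUnit (M := End (G 0)) (q 0 ≫ x ≫ p 0)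
      · obtain ⟨x, u, hu⟩ := hu
        let g : G 0 ⟶ G 0 := (↑(u⁻¹ : (End (G 0))ˣ) : End (G 0))
        have hg : g ≫ q 0 ≫ x ≫ p 0 = 𝟙 _ := by
          rw [← hu]
          exact u.mul_inv
        let i : G 0 ⟶ X := g ≫ q 0 ≫ x
        have hi : i ≫ p 0 = 𝟙 _ := by simpa [i] using hg
        obtain ⟨Y, j, k, hjk, hkj⟩ := IsIdempotentComplete.idempotents_split X (𝟙 X - p 0 ≫ i)
          (by
            simp only [Preadditive.sub_comp, Preadditive.comp_sub, Category.id_comp,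
              Category.comp_id, Category.assoc]
            rw [← Category.assoc i, hi]
            simp)
        have hjp : j ≫ p 0 = 0 := by
          have : j ≫ p 0 = (j ≫ k) ≫ j ≫ p 0 := by rw [hjk, Category.id_comp]
          rw [this, Category.assoc, ← Category.assoc k, hkj]
          simp [Preadditive.sub_comp, hi]
        have hik : i ≫ k = 0 := by
          have : i ≫ k = i ≫ (k ≫ j) ≫ k := by rw [Category.assoc k, hjk, Category.comp_id]
          rw [this, hkj]
          simp only [Preadditive.sub_comp, Preadditive.comp_sub, Category.id_comp, Category.assoc]
          rw [← Category.assoc i, hi]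
          simp
        obtain ⟨m, f, b, ⟨hb⟩, ⟨eb⟩, hf⟩ := ih Y (fun a => G a.succ) (fun a => j ≫ p a.succ)
          (fun a => q a.succ ≫ k) (fun a => hG _) (by
            have := congrArg (fun f => j ≫ f ≫ k) e
            simp only [Preadditive.add_comp, Preadditive.comp_add, Preadditive.sum_comp,
              Preadditive.comp_sum, Category.id_comp, Category.assoc] at this
            rw [← Category.assoc j (p 0), hjp, zero_comp, zero_add, hjk] at this
            simpa using this)
        obtain ⟨b', hb', hpt⟩ := exists_bicone_cons b hb eb i (p 0) j k hi hjk hik hjp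
          (by rw [hkj]; simp)
        exact ⟨m + 1, _, b', hb', ⟨eqToIso hpt⟩, Fin.cases (hG 0) hf⟩
      · push Not at hu
        have h1 : IsUnit (M := End X) (𝟙 X - p 0 ≫ q 0) := by
          have : IsUnit (M := End (G 0)) (𝟙 (G 0) - q 0 ≫ p 0) := by
            have := hu (𝟙 X)
            rw [Category.id_comp] at this
            let c : End (G 0) := q 0 ≫ p 0
            exact (IsLocalRing.isUnit_or_isUnit_of_add_one (add_sub_cancel c 1)).resolve_left this
          obtain ⟨u, hu⟩ := this
          let g : G 0 ⟶ G 0 := (↑(u⁻¹ : (End (G 0))ˣ) : End (G 0))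
          have hg : g - g ≫ q 0 ≫ p 0 = 𝟙 _ := by
            have := u.mul_inv
            rw [hu] at this
            have h2 : g ≫ (𝟙 _ - q 0 ≫ p 0) = 𝟙 _ := this
            simpa [Preadditive.comp_sub] using h2
          have hg' : g - q 0 ≫ p 0 ≫ g = 𝟙 _ := by
            have := u.inv_mul
            rw [hu] at this
            have h2 : (𝟙 _ - q 0 ≫ p 0) ≫ g = 𝟙 _ := this
            simpa [Preadditive.sub_comp] using h2
          -- If `g` inverts 1 − qp, then 1 + pgq inverts 1 − pq.
          refine ⟨⟨𝟙 X - p 0 ≫ q 0, 𝟙 X + p 0 ≫ g ≫ q 0, ?_, ?_⟩, rfl⟩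
          · change (𝟙 X + p 0 ≫ g ≫ q 0) ≫ (𝟙 X - p 0 ≫ q 0) = 𝟙 X
            have := congrArg (fun f => p 0 ≫ f ≫ q 0) hg
            simp only [Preadditive.sub_comp, Preadditive.comp_sub, Category.id_comp,
              Category.assoc] at this
            simp only [Preadditive.add_comp, Preadditive.comp_sub, Category.id_comp,
              Category.comp_id, Category.assoc]
            generalize p 0 ≫ g ≫ q 0 ≫ p 0 ≫ q 0 = z at *
            rw [eq_add_of_sub_eq this]
            abel
          · change (𝟙 X - p 0 ≫ q 0) ≫ (𝟙 X + p 0 ≫ g ≫ q 0) = 𝟙 X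
            have := congrArg (fun f => p 0 ≫ f ≫ q 0) hg'
            simp only [Preadditive.sub_comp, Preadditive.comp_sub, Category.id_comp,
              Category.assoc] at this
            simp only [Preadditive.sub_comp, Preadditive.comp_add, Category.id_comp,
              Category.comp_id, Category.assoc]
            generalize p 0 ≫ q 0 ≫ p 0 ≫ g ≫ q 0 = z at *
            rw [eq_add_of_sub_eq this]
            abel
        obtain ⟨u, hu⟩ := h1
        let v : X ⟶ X := (↑(u⁻¹ : (End X)ˣ) : End X)
        have hv : (𝟙 X - p 0 ≫ q 0) ≫ v = 𝟙 X := by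
          rw [← hu]
          exact u.inv_mul
        refine ih X (fun a => G a.succ) (fun a => p a.succ) (fun a => q a.succ ≫ v)
          (fun a => hG _) ?_
        rw [← hv, ← e, add_sub_cancel_left, Preadditive.sum_comp]
        simp
  subst hG'
  exact key n X _ (fun i => p (eqv i)) (fun i => q (eqv i)) (fun i => hG _) e

/-- Take a decomposition with local summands and split off the first one. Indecomposability forces
the complement to be zero, since a local summand is not. -/
theorem Indec.exists_iso [IsIdempotentComplete A] {P : ObjectProperty A}
    (hP : ∀ G, P G → IsLocalRing (End G)) {X : A} (hX : Dominated P X) (hi : TwoRep.Indec X) :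
    ∃ G, P G ∧ Nonempty (X ≅ G) := by
  obtain ⟨n, f, b, ⟨hb⟩, ⟨e⟩, hf⟩ := exists_decomposition hP hX
  have tot := IsBilimit.total hb
  rcases n with _ | n
  · refine (hi.1 ?_).elim
    refine IsZero.of_iso ?_ e.symm
    rw [IsZero.iff_id_eq_zero, ← tot]
    simp
  · have loc := hP _ (hf 0)
    obtain ⟨Y, j, k, hjk, hkj⟩ := IsIdempotentComplete.idempotents_split b.pt
      (𝟙 b.pt - b.π 0 ≫ b.ι 0) (by
        simp [Preadditive.sub_comp, Preadditive.comp_sub])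
    have hjp : j ≫ b.π 0 = 0 := by
      have : j ≫ b.π 0 = (j ≫ k) ≫ j ≫ b.π 0 := by rw [hjk, Category.id_comp]
      rw [this, Category.assoc, ← Category.assoc k, hkj]
      simp [Preadditive.sub_comp]
    have hik : b.ι 0 ≫ k = 0 := by
      have : b.ι 0 ≫ k = b.ι 0 ≫ (k ≫ j) ≫ k := by rw [Category.assoc k, hjk, Category.comp_id]
      rw [this, hkj]
      simp [Preadditive.sub_comp, Preadditive.comp_sub]
    let c : BinaryBicone (f 0) Y :=
      { pt := b.pt, fst := b.π 0, snd := k, inl := b.ι 0, inr := j, inl_fst := by simp,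
        inl_snd := hik, inr_fst := hjp, inr_snd := hjk }
    have hc : c.IsBilimit := isBinaryBilimitOfTotal c (by
      change b.π 0 ≫ b.ι 0 + k ≫ j = 𝟙 b.pt
      rw [hkj]
      simp)
    rcases hi.2 _ _ c hc ⟨e⟩ with h0 | h0
    · exact (not_isZero_of_isLocalRing h0).elim
    · refine ⟨f 0, hf 0, ⟨e.symm ≪≫ ⟨b.π 0, b.ι 0, ?_, by simp⟩⟩⟩
      have : k ≫ j = 0 := by rw [h0.eq_of_src j 0, comp_zero]
      rw [this] at hkj
      exact (sub_eq_zero.1 hkj.symm).symm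

end Domination

end SoergelA2

namespace SoergelA2

/-! ### Idempotents and biproducts in full subcategories and in quotients by ideals -/

section FullSubcategories

universe w₁ w₂

variable {A : Type w₁} [Category.{w₂} A] {P : ObjectProperty A}

theorem isIdempotentComplete_fullSubcategory [IsIdempotentComplete A]
    (hr : ∀ X Y, Retract X Y → P Y → P X) : IsIdempotentComplete P.FullSubcategory where
  idempotents_split X p hp := by
    obtain ⟨Y, i, e, h1, h2⟩ := IsIdempotentComplete.idempotents_split X.obj p.hom
      (congrArg InducedCategory.Hom.hom hp)
    exact ⟨⟨Y, hr Y X.obj ⟨i, e, h1⟩ X.property⟩, ObjectProperty.homMk i, ObjectProperty.homMk e,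
      ObjectProperty.hom_ext _ h1, ObjectProperty.hom_ext _ h2⟩

theorem hasFiniteBiproducts_fullSubcategory [Preadditive A] [HasBinaryBiproducts A]
    (h0 : ∃ Z, IsZero Z ∧ P Z)
    (hb : ∀ (X Y : A) (b : BinaryBicone X Y), b.IsBilimit → P X → P Y → P b.pt) :
    HasFiniteBiproducts P.FullSubcategory := by
  have hbin : HasBinaryBiproducts P.FullSubcategory := ⟨fun X Y => by
    let b := BinaryBiproduct.bicone X.obj Y.obj
    have hb' : b.IsBilimit := BinaryBiproduct.isBilimit X.obj Y.obj
    let Z : P.FullSubcategory := ⟨b.pt, hb _ _ b hb' X.property Y.property⟩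
    let c : BinaryBicone X Y :=
      { pt := Z
        fst := ObjectProperty.homMk b.fst
        snd := ObjectProperty.homMk b.snd
        inl := ObjectProperty.homMk b.inl
        inr := ObjectProperty.homMk b.inr
        inl_fst := ObjectProperty.hom_ext _ b.inl_fst
        inl_snd := ObjectProperty.hom_ext _ b.inl_snd
        inr_fst := ObjectProperty.hom_ext _ b.inr_fst
        inr_snd := ObjectProperty.hom_ext _ b.inr_snd }
    exact HasBinaryBiproduct.mk ⟨c, isBinaryBilimitOfTotal c
      (ObjectProperty.hom_ext _ (IsBilimit.binary_total hb'))⟩⟩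
  obtain ⟨Z, hZ, hPZ⟩ := h0
  have hz : IsZero (⟨Z, hPZ⟩ : P.FullSubcategory) := by
    rw [IsZero.iff_id_eq_zero]
    exact ObjectProperty.hom_ext _ (hZ.eq_of_src _ _)
  have : HasZeroObject P.FullSubcategory := ⟨⟨_, hz⟩⟩
  have : HasFiniteProducts P.FullSubcategory := hasFiniteProducts_of_has_binary_and_terminal
  exact HasFiniteBiproducts.of_hasFiniteProducts

end FullSubcategories

section Lifting

open Polynomial in
/-- In a finite dimensional algebra, a polynomial in `f` which is idempotent and agrees with `f`
modulo `f ^ 2 - f`. -/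
theorem exists_idempotent_lift {E : Type*} [Ring E] [Algebra ℂ E] [FiniteDimensional ℂ E] (f : E) :
    ∃ e g : E, e * e = e ∧ e - f = (f * f - f) * g := by
  -- The extra factor `X` makes the multiplicity `a` of the root 0 positive even when `f` is
  -- invertible.
  have hm : minpoly ℂ f * X ≠ 0 :=
    mul_ne_zero (minpoly.ne_zero (Algebra.IsIntegral.isIntegral f)) X_ne_zero
  obtain ⟨h, hh, hnd⟩ := Polynomial.exists_eq_pow_rootMultiplicity_mul_and_not_dvd
    (minpoly ℂ f * X) hm 0
  rw [C_0, sub_zero] at hh hnd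
  set a := rootMultiplicity 0 (minpoly ℂ f * X) with ha
  have ha1 : a ≠ 0 := by
    intro h0
    rw [h0, pow_zero, one_mul] at hh
    exact hnd ⟨minpoly ℂ f, by rw [← hh, mul_comm]⟩
  -- In the Bézout identity u X^a + v h (X − 1) = 1 the product of the two terms is a multiple of
  -- the minimal polynomial, so u X^a becomes idempotent at `f`. The factor X − 1 makes it congruent
  -- to 1 modulo X − 1.
  have hcop : IsCoprime (X ^ a : ℂ[X]) (h * (X - 1)) := by
    refine IsCoprime.pow_left ((Polynomial.irreducible_X.coprime_iff_not_dvd).2 ?_)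
    intro hd
    rcases (Polynomial.prime_X.dvd_or_dvd hd) with hd | hd
    · exact hnd hd
    · rw [X_dvd_iff] at hd
      simp at hd
  obtain ⟨u, v, huv⟩ := hcop
  have hdvd : (X * (X - 1) : ℂ[X]) ∣ u * X ^ a - X := by
    refine IsCoprime.mul_dvd ⟨1, -1, by ring⟩ ?_ ?_
    · exact dvd_sub (Dvd.dvd.mul_left (dvd_pow_self X ha1) u) dvd_rfl
    · refine ⟨-(v * h) - 1, ?_⟩
      linear_combination huv
  obtain ⟨w, hw⟩ := hdvd
  refine ⟨aeval f (u * X ^ a), aeval f w, ?_, ?_⟩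
  · have : (u * X ^ a) * (u * X ^ a) = u * X ^ a - (minpoly ℂ f) * (X * (u * v * (X - 1))) := by
      have e1 : u * X ^ a * (v * (h * (X - 1))) = minpoly ℂ f * (X * (u * v * (X - 1))) := by
        linear_combination (u * v * (X - 1)) * (-hh)
      linear_combination (u * X ^ a) * huv - e1
    rw [← map_mul, this, map_sub, map_mul (aeval f) (minpoly ℂ f), minpoly.aeval, zero_mul, sub_zero]
  · have := congrArg (aeval f) hw
    rw [map_sub, aeval_X] at this
    rw [this]
    simp [mul_sub]

end Lifting

section Quotients

universe w₁ w₂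

variable {M : TwoRep.{w₂, w₁}} (I : TwoRep.StableIdeal M)

theorem quotient_functor_map_eq_zero {X Y : M.carrier} (f : X ⟶ Y) :
    (CategoryTheory.Quotient.functor I.rel).map f = 0 ↔ f ∈ I.mem X Y := by
  have h0 : (CategoryTheory.Quotient.functor I.rel).map (0 : X ⟶ Y) = 0 := Functor.map_zero _ _ _
  rw [← h0, CategoryTheory.Quotient.functor_map_eq_iff]
  change f - 0 ∈ I.mem X Y ↔ _
  rw [sub_zero]

/-- An idempotent of the quotient is represented by `f` with f² − f in the ideal. By
`exists_idempotent_lift` it agrees modulo f² − f with a true idempotent, which splits before passing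
to the quotient. -/
theorem quotient_isIdempotentComplete [IsIdempotentComplete M.carrier]
    (hfin : ∀ X Y : M.carrier, FiniteDimensional ℂ (X ⟶ Y)) :
    IsIdempotentComplete (CategoryTheory.Quotient I.rel) where
  idempotents_split := by
    rintro ⟨X⟩ p hp
    obtain ⟨f, rfl⟩ := (CategoryTheory.Quotient.functor I.rel).map_surjective
      (X := X) (Y := X) p
    have : FiniteDimensional ℂ (End X) := hfin X X
    obtain ⟨e, g, he, heg⟩ := exists_idempotent_lift (E := End X) f
    have hf : (f ≫ f - f : X ⟶ X) ∈ I.mem X X := by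
      have h1 : (CategoryTheory.Quotient.functor I.rel).map (f ≫ f) =
        (CategoryTheory.Quotient.functor I.rel).map f := by
          rw [Functor.map_comp]; exact hp
      exact (CategoryTheory.Quotient.functor_map_eq_iff I.rel _ _).1 h1
    have hef : (CategoryTheory.Quotient.functor I.rel).map e =
        (CategoryTheory.Quotient.functor I.rel).map f := by
      refine (CategoryTheory.Quotient.functor_map_eq_iff I.rel _ _).2 ?_
      have heg' : (show X ⟶ X from e) - f = g ≫ (f ≫ f - f) := heg
      change (show X ⟶ X from e) - f ∈ I.mem X X
      rw [heg']
      exact I.comp_left g _ hf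
    obtain ⟨Y, i, k, h1, h2⟩ := IsIdempotentComplete.idempotents_split X e he
    refine ⟨(CategoryTheory.Quotient.functor I.rel).obj Y,
      (CategoryTheory.Quotient.functor I.rel).map i,
      (CategoryTheory.Quotient.functor I.rel).map k, ?_, ?_⟩
    · rw [← Functor.map_comp, h1, CategoryTheory.Functor.map_id]
    · rw [← hef, ← Functor.map_comp, h2]

theorem quotient_hasFiniteBiproducts [HasFiniteBiproducts M.carrier] :
    HasFiniteBiproducts (CategoryTheory.Quotient I.rel) := by
  refine ⟨fun n => ⟨fun f => ⟨⟨?_⟩⟩⟩⟩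
  let b := biproduct.bicone fun i => (f i).as
  have hb : b.IsBilimit := biproduct.isBilimit _
  let c : Bicone f := (CategoryTheory.Quotient.functor I.rel).mapBicone b
  have hc : ∑ j, c.π j ≫ c.ι j = 𝟙 c.pt := by
    have h1 := congrArg (CategoryTheory.Quotient.functor I.rel).map (IsBilimit.total hb)
    rw [Functor.map_sum, CategoryTheory.Functor.map_id] at h1
    refine Eq.trans ?_ h1
    exact Finset.sum_congr rfl fun j _ =>
      ((CategoryTheory.Quotient.functor I.rel).map_comp _ _).symm
  exact ⟨c, isBilimitOfTotal c hc⟩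

theorem quotient_finiteDimensional (hfin : ∀ X Y : M.carrier, FiniteDimensional ℂ (X ⟶ Y))
    (X Y : CategoryTheory.Quotient I.rel) : FiniteDimensional ℂ (X ⟶ Y) := by
  have := hfin X.as Y.as
  let φ : (X.as ⟶ Y.as) →ₗ[ℂ] (X ⟶ Y) :=
    { toFun := fun f => (CategoryTheory.Quotient.functor I.rel).map f
      map_add' := fun f g => Functor.map_add _
      map_smul' := fun c f =>
        CategoryTheory.Functor.Linear.map_smul (F := CategoryTheory.Quotient.functor I.rel) f c }
  exact Module.Finite.of_surjective φ
    ((CategoryTheory.Quotient.functor I.rel).map_surjective (X := X.as) (Y := Y.as))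

end Quotients

end SoergelA2

/-! ### The coinvariant algebra as a free module of rank two over the invariants -/

noncomputable section

namespace SoergelA2

/-- Coordinates of a commutative algebra `R`, free of rank two with basis `1, β` over the subalgebra
generated by `α`, where `α ^ 2 + α * β + β ^ 2 = 0`. -/
structure Coords {R : Type} [CommRing R] [Algebra ℂ R] (A : Subalgebra ℂ R) (α β : R) where
  g₀ : R →ₗ[A] A
  g₁ : R →ₗ[A] A
  decomp : ∀ c, (g₀ c : R) + g₁ c * β = c
  g₀_one : g₀ 1 = 1
  g₁_one : g₁ 1 = 0
  g₀_gen : g₀ β = 0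
  g₁_gen : g₁ β = 1
  adjoin_eq : Algebra.adjoin ℂ {α} = A
  rel : α ^ 2 + α * β + β ^ 2 = 0
  cube : α ^ 3 = 0

theorem coord_sum : coord 0 + coord 1 + coord 2 = 0 := by
  simp only [coord, ← map_add]
  rw [Ideal.Quotient.eq_zero_iff_mem]
  exact Ideal.subset_span (Or.inl rfl)

theorem coord_e₂ : coord 0 * coord 1 + coord 0 * coord 2 + coord 1 * coord 2 = 0 := by
  simp only [coord, ← map_add, ← map_mul]
  rw [Ideal.Quotient.eq_zero_iff_mem]
  exact Ideal.subset_span (Or.inr (Or.inl rfl))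

/-- This is the vanishing of the second elementary symmetric function, with a variable eliminated by
means of the first. -/
theorem coord_rel {i j : Fin 3} (h : i ≠ j) :
    coord i ^ 2 + coord i * coord j + coord j ^ 2 = 0 := by
  have h1 := coord_sum
  have h2 := coord_e₂
  have h3 : coord 1 = -coord 0 - coord 2 := by linear_combination h1
  rw [h3] at h2
  fin_cases i <;> fin_cases j <;> simp only [Fin.zero_eta, Fin.mk_one, Fin.reduceFinMk, ne_eq,
    not_true_eq_false, h3] at h ⊢ <;> linear_combination -h2

/-- The algebra homomorphism from `C` given by the images of the variables. -/
def coinvLift {T : Type*} [CommRing T] [Algebra ℂ T] (v : Fin 3 → T) (h1 : v 0 + v 1 + v 2 = 0)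
    (h2 : v 0 * v 1 + v 0 * v 2 + v 1 * v 2 = 0) (h3 : v 0 * v 1 * v 2 = 0) : Coinv →ₐ[ℂ] T :=
  Ideal.Quotient.liftₐ coinvIdeal (MvPolynomial.aeval v) (by
    have : coinvIdeal ≤ RingHom.ker (MvPolynomial.aeval v : Poly →ₐ[ℂ] T) := by
      refine Ideal.span_le.2 ?_
      rintro p (rfl | rfl | rfl)
      · simpa using h1
      · simpa using h2
      · simpa using h3
    exact fun a ha => this ha)

theorem coinvLift_coord {T : Type*} [CommRing T] [Algebra ℂ T] (v : Fin 3 → T) (h1 h2 h3)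
    (i : Fin 3) : coinvLift v h1 h2 h3 (coord i) = v i := by
  change MvPolynomial.aeval v (MvPolynomial.X i) = v i
  simp

theorem coinv_induction {P : Coinv → Prop} (hC : ∀ z : ℂ, P (algebraMap ℂ Coinv z))
    (hadd : ∀ c d, P c → P d → P (c + d)) (hmul : ∀ c i, P c → P (c * coord i)) (c : Coinv) :
    P c := by
  obtain ⟨p, rfl⟩ := Ideal.Quotient.mk_surjective c
  induction p using MvPolynomial.induction_on with
  | C a => exact hC a
  | add p q hp hq => rw [map_add]; exact hadd _ _ hp hq
  | mul_X p i hp => rw [map_mul]; exact hmul _ _ hp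

/-- The algebra `ℂ[t] / (t ^ 3)`. -/
abbrev Trunc : Type := AdjoinRoot (Polynomial.X ^ 3 : Polynomial ℂ)

/-- The class of `t` in `ℂ[t] / (t ^ 3)`. -/
abbrev truncVar : Trunc := AdjoinRoot.root _

theorem truncVar_cube : truncVar ^ 3 = 0 := by
  have := AdjoinRoot.eval₂_root (Polynomial.X ^ 3 : Polynomial ℂ)
  simpa using this

/-- The algebra `ℂ[t, w] / (t ^ 3, w ^ 2 + t w + t ^ 2)`. -/
abbrev CoinvModel : Type := QuadraticAlgebra Trunc (-truncVar ^ 2) (-truncVar)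

/-- The class of `t`. -/
def modelT : CoinvModel := algebraMap Trunc CoinvModel truncVar

/-- The class of `w`. -/
def modelW : CoinvModel := ⟨0, 1⟩

theorem model_rel : modelT ^ 2 + modelT * modelW + modelW ^ 2 = 0 := by
  ext
  · simp [modelT, modelW, pow_two, QuadraticAlgebra.algebraMap_eq]
  · simp [modelT, modelW, pow_two, QuadraticAlgebra.algebraMap_eq]

theorem model_cube : modelT ^ 3 = 0 := by
  rw [modelT, ← map_pow, truncVar_cube, map_zero]

section Model

variable {i j : Fin 3} (hij : i ≠ j)

/-- The image of the variables in the model. -/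
def modelVar (i j n : Fin 3) : CoinvModel :=
  if n = i then modelT else if n = j then modelW else -modelT - modelW

include hij in
/-- The map from `C` to the model which sends `coord i` to `t` and `coord j` to `w`. -/
theorem exists_toModel : ∃ f : Coinv →ₐ[ℂ] CoinvModel, f (coord i) = modelT ∧
    f (coord j) = modelW := by
  have h2 := model_rel
  have h3 := model_cube
  refine ⟨coinvLift (modelVar i j) ?_ ?_ ?_, ?_, ?_⟩
  · fin_cases i <;> fin_cases j <;> simp [modelVar] at hij ⊢ <;> ring
  · fin_cases i <;> fin_cases j <;> simp [modelVar] at hij ⊢ <;> linear_combination -h2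
  · fin_cases i <;> fin_cases j <;> simp [modelVar] at hij ⊢ <;>
      linear_combination -modelT * h2 + h3
  · rw [coinvLift_coord]
    simp [modelVar]
  · rw [coinvLift_coord]
    simp [modelVar, hij.symm]

/-- The map `t ↦ coord i`. -/
def truncToCoinv (i : Fin 3) : Trunc →ₐ[ℂ] Coinv :=
  AdjoinRoot.liftAlgHom _ (Algebra.ofId ℂ Coinv) (coord i) (by simp [coord_cube])

theorem truncToCoinv_var (i : Fin 3) : truncToCoinv i truncVar = coord i :=
  AdjoinRoot.liftAlgHom_root _ _ _ _

theorem truncToCoinv_mem (i : Fin 3) (d : Trunc) :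
    truncToCoinv i d ∈ Algebra.adjoin ℂ {coord i} := by
  induction d using AdjoinRoot.induction_on with
  | _ p =>
    rw [truncToCoinv, AdjoinRoot.liftAlgHom_mk]
    exact (Algebra.adjoin_singleton_eq_range_aeval ℂ (coord i)) ▸ ⟨p, rfl⟩

-- Spanning is an induction on monomials. Uniqueness of coordinates is obtained by mapping to the
-- explicit rank two algebra `CoinvModel`: its two coordinates, carried back by t ↦ `coord i`, serve
-- as g₀ and g₁.
include hij in
theorem exists_coords_aux : Nonempty (Coords (Algebra.adjoin ℂ {coord i}) (coord i) (coord j)) := by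
  obtain ⟨f, hfi, hfj⟩ := exists_toModel hij
  have hf : ∀ a ∈ Algebra.adjoin ℂ {coord i}, ∃ d : Trunc, truncToCoinv i d = a ∧
      f a = algebraMap Trunc CoinvModel d := by
    intro a ha
    induction ha using Algebra.adjoin_induction with
    | mem x hx =>
      obtain rfl : x = coord i := hx
      exact ⟨truncVar, truncToCoinv_var i, hfi⟩
    | algebraMap r =>
      refine ⟨algebraMap ℂ Trunc r, AlgHom.commutes _ _, ?_⟩
      rw [AlgHom.commutes]
      rfl
    | add x y _ _ hx hy =>
      obtain ⟨d, h1, h2⟩ := hx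
      obtain ⟨d', h1', h2'⟩ := hy
      exact ⟨d + d', by rw [map_add, h1, h1'], by rw [map_add, map_add, h2, h2']⟩
    | mul x y _ _ hx hy =>
      obtain ⟨d, h1, h2⟩ := hx
      obtain ⟨d', h1', h2'⟩ := hy
      exact ⟨d * d', by rw [map_mul, h1, h1'], by rw [map_mul, map_mul, h2, h2']⟩
  have hdec : ∀ c, truncToCoinv i (f c).re + truncToCoinv i (f c).im * coord j = c := by
    intro c
    induction c using coinv_induction with
    | hC z =>
      rw [AlgHom.commutes]
      have : algebraMap ℂ CoinvModel z = ⟨algebraMap ℂ Trunc z, 0⟩ := rfl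
      rw [this]
      simp only [map_zero, zero_mul, add_zero, AlgHom.commutes]
    | hadd c d hc hd =>
      conv_rhs => rw [← hc, ← hd]
      simp only [map_add, QuadraticAlgebra.re_add, QuadraticAlgebra.im_add]
      ring
    | hmul c n hc =>
      have hsum := coord_sum
      have hrel := coord_rel hij
      have hf0 : ∀ z : ℂ, f (algebraMap ℂ Coinv z) = ⟨algebraMap ℂ Trunc z, 0⟩ := fun z =>
        AlgHom.commutes f z
      -- Since the variables sum to zero, each is a scalar combination of `coord i` and `coord j`.
      -- For such a combination the product is reduced by the quadratic relation.
      have key : ∀ u v : ℂ,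
          coord n = algebraMap ℂ Coinv u * coord i + algebraMap ℂ Coinv v * coord j →
          truncToCoinv i (f (c * coord n)).re + truncToCoinv i (f (c * coord n)).im * coord j =
            c * coord n := by
        intro u v hn
        rw [hn]
        conv_rhs => rw [← hc]
        simp only [map_mul, map_add, hf0, hfi, hfj, modelT, modelW,
          QuadraticAlgebra.algebraMap_eq, QuadraticAlgebra.re_mul, QuadraticAlgebra.im_mul,
          QuadraticAlgebra.re_add, QuadraticAlgebra.im_add, truncToCoinv_var, map_neg, map_pow,
          add_zero, zero_add, mul_zero, zero_mul, mul_one, AlgHom.commutes]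
        linear_combination (-truncToCoinv i (f c).im * algebraMap ℂ Coinv v) * hrel
      by_cases h1 : n = i
      · exact key 1 0 (by simp [h1])
      by_cases h2 : n = j
      · exact key 0 1 (by simp [h2])
      refine key (-1) (-1) ?_
      rw [map_neg, map_one]
      fin_cases i <;> fin_cases j <;> fin_cases n <;> simp at hij h1 h2 ⊢ <;>
        linear_combination hsum
  -- The subalgebra is carried into `Trunc`, over which multiplication acts on each coordinate
  -- separately.
  have hcomm : ∀ (a : Algebra.adjoin ℂ {coord i}) (c : Coinv),
      truncToCoinv i (f (a • c)).re = a * truncToCoinv i (f c).re ∧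
      truncToCoinv i (f (a • c)).im = a * truncToCoinv i (f c).im := by
    rintro ⟨a, ha⟩ c
    obtain ⟨d, rfl, hd⟩ := hf a ha
    change truncToCoinv i (f (truncToCoinv i d * c)).re = _ ∧ truncToCoinv i (f (truncToCoinv i d * c)).im = _
    rw [map_mul, hd]
    simp [QuadraticAlgebra.algebraMap_eq]
  refine ⟨{
    g₀ := { toFun := fun c => ⟨truncToCoinv i (f c).re, truncToCoinv_mem i _⟩
            map_add' := fun c d => Subtype.ext (by simp)
            map_smul' := fun a c => Subtype.ext (hcomm a c).1 }
    g₁ := { toFun := fun c => ⟨truncToCoinv i (f c).im, truncToCoinv_mem i _⟩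
            map_add' := fun c d => Subtype.ext (by simp)
            map_smul' := fun a c => Subtype.ext (hcomm a c).2 }
    decomp := hdec
    g₀_one := Subtype.ext ?_
    g₁_one := Subtype.ext ?_
    g₀_gen := Subtype.ext ?_
    g₁_gen := Subtype.ext ?_
    adjoin_eq := rfl
    rel := coord_rel hij
    cube := coord_cube i }⟩
  · change truncToCoinv i (f 1).re = 1
    rw [map_one]
    exact map_one _
  · change truncToCoinv i (f 1).im = 0
    rw [map_one]
    exact map_zero _
  · change truncToCoinv i (f (coord j)).re = 0
    rw [hfj]
    exact map_zero _
  · change truncToCoinv i (f (coord j)).im = 1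
    rw [hfj]
    exact map_one _

end Model

theorem permAct_coord (σ : Equiv.Perm (Fin 3)) (i : Fin 3) :
    permAct σ (coord i) = coord (σ i) := by
  change Ideal.Quotient.mk coinvIdeal (MvPolynomial.rename σ (MvPolynomial.X i)) = _
  rw [MvPolynomial.rename_X]
  rfl

/-- Write c = g₀ + g₁β, with coefficients already fixed by σ. If c is fixed too, subtracting σ(c)
gives g₁(β − σβ) = g₁(2β + α) = 0, and the β-coordinate 2g₁ of this must vanish. -/
theorem invariants_eq {σ : Equiv.Perm (Fin 3)} {i j k : Fin 3} (hij : i ≠ j)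
    (hσ : σ i = i) (hσj : σ j = k) (hsum : coord i + coord j + coord k = 0) :
    Algebra.adjoin ℂ {coord i} = invariants σ := by
  have hle : Algebra.adjoin ℂ {coord i} ≤ invariants σ := by
    refine Algebra.adjoin_le ?_
    rintro _ rfl
    change permAct σ (coord i) = coord i
    rw [permAct_coord, hσ]
  refine le_antisymm hle fun c hc => ?_
  obtain ⟨K⟩ := exists_coords_aux hij
  have h0 : permAct σ c = c := hc
  have h1 : permAct σ (K.g₀ c : Coinv) = K.g₀ c := hle (K.g₀ c).2
  have h2 : permAct σ (K.g₁ c : Coinv) = K.g₁ c := hle (K.g₁ c).2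
  have h3 : (2 * K.g₁ c) • coord j + (K.g₁ c * ⟨coord i, Algebra.self_mem_adjoin_singleton ℂ _⟩) •
      (1 : Coinv) = 0 := by
    have h4 := K.decomp c
    have h5 := congrArg (permAct σ) h4
    rw [map_add, map_mul, h1, h2, h0, permAct_coord, hσj] at h5
    change (2 * (K.g₁ c : Coinv)) * coord j + (K.g₁ c * coord i) * 1 = 0
    linear_combination h4 - h5 + (K.g₁ c : Coinv) * hsum
  have h6 := congrArg K.g₁ h3
  rw [map_add, map_smul, map_smul, K.g₁_gen, K.g₁_one, map_zero, smul_zero, add_zero] at h6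
  have h7 : K.g₁ c = 0 := by
    have h8 : (2 : Algebra.adjoin ℂ {coord i}) * K.g₁ c = 0 := by simpa using h6
    have h9 : algebraMap ℂ (Algebra.adjoin ℂ {coord i}) (1 / 2) * 2 = 1 := by
      rw [← map_ofNat (algebraMap ℂ (Algebra.adjoin ℂ {coord i})) 2, ← map_mul]
      norm_num
    linear_combination -(K.g₁ c) * h9 + algebraMap ℂ (Algebra.adjoin ℂ {coord i}) (1 / 2) * h8
  have := K.decomp c
  rw [h7] at this
  simp only [ZeroMemClass.coe_zero, zero_mul, add_zero] at this
  rw [← this]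
  exact (K.g₀ c).2

/-- The invariants of `s`. -/
abbrev invS : Subalgebra ℂ Coinv := invariants (Equiv.swap 0 1)

/-- The invariants of `t`. -/
abbrev invT : Subalgebra ℂ Coinv := invariants (Equiv.swap 1 2)

theorem exists_coordsS : Nonempty (Coords invS (coord 2) (coord 0)) := by
  rw [invS, ← invariants_eq (i := 2) (j := 0) (k := 1) (by decide) (by decide) (by decide)
    (by linear_combination coord_sum)]
  exact exists_coords_aux (by decide)

theorem exists_coordsT : Nonempty (Coords invT (coord 0) (coord 2)) := by
  rw [invT, ← invariants_eq (i := 0) (j := 2) (k := 1) (by decide) (by decide) (by decide)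
    (by linear_combination coord_sum)]
  exact exists_coords_aux (by decide)

/-- Coordinates of `C` over the invariants of `s`. -/
def coordsS : Coords invS (coord 2) (coord 0) := exists_coordsS.some

/-- Coordinates of `C` over the invariants of `t`. -/
def coordsT : Coords invT (coord 0) (coord 2) := exists_coordsT.some

end SoergelA2

end

noncomputable section

namespace SoergelA2

/-! ### A criterion for local endomorphism rings -/

section ScalarNil

/-- Every element of the `ℂ`-algebra is a scalar plus a nilpotent element. -/
def ScalarNil (T : Type*) [Ring T] [Algebra ℂ T] : Prop :=
  ∀ t : T, ∃ z : ℂ, IsNilpotent (t - algebraMap ℂ T z)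

theorem ScalarNil.isUnit_or {T : Type*} [CommRing T] [Algebra ℂ T] (h : ScalarNil T) (t : T) :
    IsUnit t ∨ IsUnit (1 - t) := by
  obtain ⟨z, hz⟩ := h t
  have key : ∀ (w : ℂ) (n : T), w ≠ 0 → IsNilpotent n → IsUnit (algebraMap ℂ T w + n) :=
    fun w n hw hn => by
      exact hn.isUnit_add_left_of_commute ((isUnit_iff_ne_zero.2 hw).map (algebraMap ℂ T))
        (Commute.all _ _)
  by_cases h0 : z = 0
  · right
    have := key 1 (-(t - algebraMap ℂ T z)) one_ne_zero hz.neg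
    rw [h0, map_zero, sub_zero, map_one, ← sub_eq_add_neg] at this
    exact this
  · left
    have := key z _ h0 hz
    rwa [add_sub_cancel] at this

/-- A nonzero scalar plus a nilpotent is a unit; if the scalar part of t is zero, 1 − t is a unit.
Surjections preserve this dichotomy, so it applies to any endomorphism ring onto which such a
commutative algebra maps. -/
theorem ScalarNil.isLocalRing {T E : Type*} [CommRing T] [Algebra ℂ T] (h : ScalarNil T) [Ring E]
    [Nontrivial E] (φ : T →+* E) (hφ : Function.Surjective φ) : IsLocalRing E where
  isUnit_or_isUnit_of_add_one {a b} hab := by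
    obtain ⟨t, rfl⟩ := hφ a
    have hb : b = φ (1 - t) := by rw [map_sub, map_one, ← hab, add_sub_cancel_left]
    rcases h.isUnit_or t with h1 | h1
    · exact Or.inl (h1.map φ)
    · exact Or.inr (hb ▸ h1.map φ)

theorem scalarNil_coinv : ScalarNil Coinv := by
  intro c
  induction c using coinv_induction with
  | hC z => exact ⟨z, by rw [sub_self]; exact IsNilpotent.zero⟩
  | hadd c d hc hd =>
    obtain ⟨z, hz⟩ := hc
    obtain ⟨w, hw⟩ := hd
    refine ⟨z + w, ?_⟩
    rw [map_add, add_sub_add_comm]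
    exact Commute.isNilpotent_add (Commute.all _ _) hz hw
  | hmul c i _ =>
    refine ⟨0, ?_⟩
    rw [map_zero, sub_zero]
    exact Commute.isNilpotent_mul_left (Commute.all _ _) ⟨3, coord_cube i⟩

theorem ScalarNil.tensor {T T' : Type*} [CommRing T] [Algebra ℂ T] [CommRing T'] [Algebra ℂ T']
    (h : ScalarNil T) (h' : ScalarNil T') : ScalarNil (T ⊗[ℂ] T') := by
  intro t
  induction t using TensorProduct.induction_on with
  | zero => exact ⟨0, by rw [map_zero, sub_self]; exact IsNilpotent.zero⟩
  | add x y hx hy =>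
    obtain ⟨z, hz⟩ := hx
    obtain ⟨w, hw⟩ := hy
    refine ⟨z + w, ?_⟩
    rw [map_add, add_sub_add_comm]
    exact Commute.isNilpotent_add (Commute.all _ _) hz hw
  | tmul c d =>
    obtain ⟨z, hz⟩ := h c
    obtain ⟨w, hw⟩ := h' d
    refine ⟨z * w, ?_⟩
    have e : c ⊗ₜ[ℂ] d - algebraMap ℂ (T ⊗[ℂ] T') (z * w) =
        (Algebra.TensorProduct.includeLeft (R := ℂ) (S := ℂ) (c - algebraMap ℂ T z)) *
          Algebra.TensorProduct.includeRight d +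
        algebraMap ℂ (T ⊗[ℂ] T') z *
          Algebra.TensorProduct.includeRight (R := ℂ) (d - algebraMap ℂ T' w) := by
      have e1 : c ⊗ₜ[ℂ] d = Algebra.TensorProduct.includeLeft (R := ℂ) (S := ℂ) (B := T') c *
          Algebra.TensorProduct.includeRight d := by simp
      rw [e1, map_sub, map_sub, AlgHom.commutes, AlgHom.commutes, map_mul]
      ring
    rw [e]
    refine Commute.isNilpotent_add (Commute.all _ _) ?_ ?_
    · exact Commute.isNilpotent_mul_right (Commute.all _ _) (hz.map _)
    · exact Commute.isNilpotent_mul_left (Commute.all _ _) (hw.map _)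

end ScalarNil

/-! ### The linear forms ℓ = ax + by and ℓ' = bx + ay -/

section LinearPart

/-- The quotient map from `C` onto its truncation in degrees at most one. -/
def linearPart : Coinv →ₐ[ℂ] TrivSqZeroExt ℂ (ℂ × ℂ) :=
  coinvLift ![TrivSqZeroExt.inr (1, 0), TrivSqZeroExt.inr (0, 1), TrivSqZeroExt.inr (-1, -1)]
    (by
      simp only [Matrix.cons_val_zero, Matrix.cons_val_one, Matrix.cons_val,
        ← TrivSqZeroExt.inr_add]
      simp only [Prod.mk_add_mk, add_zero, zero_add, add_neg_cancel]
      exact TrivSqZeroExt.inr_zero ℂ)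
    (by simp) (by simp)

theorem linearPart_ell (a b : ℂ) :
    linearPart (a • coord 0 + b • coord 1) = TrivSqZeroExt.inr (a, b) := by
  rw [map_add, map_smul, map_smul, linearPart, coinvLift_coord, coinvLift_coord]
  simp [← TrivSqZeroExt.inr_smul, ← TrivSqZeroExt.inr_add]

instance nontrivial_coinv : Nontrivial Coinv :=
  linearPart.toRingHom.domain_nontrivial

instance isLocalRing_coinv : IsLocalRing Coinv :=
  scalarNil_coinv.isLocalRing (RingHom.id _) Function.surjective_id

/-- The generator `a x + b y` of `K_{a,b}`. -/
abbrev ell (a b : ℂ) : Coinv := a • coord 0 + b • coord 1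

theorem coinv_smul (z : ℂ) (c : Coinv) : z • c = algebraMap ℂ Coinv z * c := by
  obtain ⟨p, rfl⟩ := Ideal.Quotient.mk_surjective c
  change Ideal.Quotient.mk coinvIdeal (z • p) = Ideal.Quotient.mk coinvIdeal (MvPolynomial.C z * p)
  rw [MvPolynomial.smul_eq_C_mul]

theorem ell_eq (a b : ℂ) :
    ell a b = algebraMap ℂ Coinv a * coord 0 + algebraMap ℂ Coinv b * coord 1 :=
  congrArg₂ (· + ·) (coinv_smul _ _) (coinv_smul _ _)

theorem ell_ne_zero {a b : ℂ} (h : Admissible a b) : ell a b ≠ 0 := by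
  intro h0
  have h1 := linearPart_ell a b
  rw [ell] at h0
  rw [h0, map_zero] at h1
  have h2 := congrArg (fun x => (TrivSqZeroExt.snd x).1) h1
  exact h.2.1 (by simpa using h2.symm)

theorem ell_mem_genIdeal (a b : ℂ) : ell a b ∈ genIdeal a b := Ideal.mem_span_singleton_self _

/-- If ℓ_{a,b} = c·ℓ_{a',b'}, only the constant term of c contributes in degree one; it is the
required factor, and it is nonzero since a ≠ 0. -/
theorem exists_smul_of_genIdeal_eq {a b a' b' : ℂ} (h : Admissible a b)
    (e : genIdeal a b = genIdeal a' b') : ∃ c : ℂ, c ≠ 0 ∧ a = c * a' ∧ b = c * b' := by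
  have h1 : ell a b ∈ genIdeal a' b' := e ▸ ell_mem_genIdeal a b
  obtain ⟨c, hc⟩ := Ideal.mem_span_singleton'.1 h1
  have h2 := congrArg linearPart hc
  rw [ell, map_mul, linearPart_ell, linearPart_ell] at h2
  have h3 := congrArg (fun x => (TrivSqZeroExt.snd x).1) h2
  have h4 := congrArg (fun x => (TrivSqZeroExt.snd x).2) h2
  simp at h3 h4
  refine ⟨(linearPart c).fst, ?_, h3.symm, h4.symm⟩
  intro h0
  rw [h0, zero_mul] at h3
  exact h.2.1 h3.symm

theorem genIdeal_smul {a b c : ℂ} (hc : c ≠ 0) : genIdeal (c * a) (c * b) = genIdeal a b := by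
  refine le_antisymm ?_ ?_
  · refine (Ideal.span_singleton_le_span_singleton).2 ⟨algebraMap ℂ Coinv c, ?_⟩
    change ell _ _ = ell _ _ * _
    rw [ell_eq, ell_eq, map_mul, map_mul]
    ring
  · refine (Ideal.span_singleton_le_span_singleton).2 ⟨algebraMap ℂ Coinv c⁻¹, ?_⟩
    have : algebraMap ℂ Coinv c * algebraMap ℂ Coinv c⁻¹ = 1 := by
      rw [← map_mul, mul_inv_cancel₀ hc, map_one]
    change ell _ _ = ell _ _ * _
    rw [ell_eq, ell_eq, map_mul, map_mul]
    linear_combination (-(algebraMap ℂ Coinv a * coord 0 + algebraMap ℂ Coinv b * coord 1)) * this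

/-- The annihilator of C/I is I itself, so M_{a,b} remembers its ideal. -/
theorem genIdeal_eq_of_annihilator {a b a' b' : ℂ}
    (h : ∀ c : Coinv, (∀ m : quotMod a b, c • m = 0) ↔ ∀ m : quotMod a' b', c • m = 0) :
    genIdeal a b = genIdeal a' b' := by
  have key : ∀ (a b : ℂ) (c : Coinv), (∀ m : quotMod a b, c • m = 0) ↔ c ∈ genIdeal a b := by
    intro a b c
    exact Module.mem_annihilator.symm.trans
      (Eq.to_iff (congrArg (c ∈ ·) (Ideal.annihilator_quotient (I := genIdeal a b))))
  ext c
  rw [← key, ← key, h]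

/-- The linear form annihilated by `a x + b y`. -/
abbrev ellDual (a b : ℂ) : Coinv := ell b a

/-- The product is ab(x² + xy + y²) + (a² − ab + b²)xy, and both terms vanish. -/
theorem ell_mul_ellDual {a b : ℂ} (h : Admissible a b) : ell a b * ellDual a b = 0 := by
  have h1 : algebraMap ℂ Coinv a ^ 2 - algebraMap ℂ Coinv a * algebraMap ℂ Coinv b +
      algebraMap ℂ Coinv b ^ 2 = 0 := by
    rw [← map_pow, ← map_pow, ← map_mul, ← map_sub, ← map_add, h.1, map_zero]
  have h2 := coord_rel (i := 0) (j := 1) (by decide)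
  rw [ellDual, ell_eq, ell_eq]
  linear_combination (algebraMap ℂ Coinv a * algebraMap ℂ Coinv b) * h2 +
    coord 0 * coord 1 * h1

/-- If b = a or b = −a, then (∗) reads a² = 0 or 3a² = 0. -/
theorem Admissible.sq_sub_sq_ne_zero {a b : ℂ} (h : Admissible a b) : a ^ 2 - b ^ 2 ≠ 0 := by
  intro h0
  have h1 : (a - b) * (a + b) = 0 := by linear_combination h0
  obtain ⟨h2, ha, _⟩ := h
  rcases mul_eq_zero.1 h1 with h3 | h3
  · have : b = a := by linear_combination -h3
    subst this
    exact ha (pow_eq_zero_iff (two_ne_zero) |>.1 (by linear_combination h2))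
  · have : b = -a := by linear_combination h3
    subst this
    exact ha (pow_eq_zero_iff (two_ne_zero) |>.1 (by linear_combination (1 / 3 : ℂ) * h2))

/-- The matrix expressing ℓ and ℓ' in x and y has determinant a² − b² ≠ 0, so the two forms generate
the augmentation ideal. -/
theorem exists_eq_scalar_add {a b : ℂ} (h : Admissible a b) (c : Coinv) :
    ∃ (z : ℂ) (p q : Coinv), c = algebraMap ℂ Coinv z + p * ell a b + q * ellDual a b := by
  have hz : algebraMap ℂ Coinv (a ^ 2 - b ^ 2)⁻¹ *
      (algebraMap ℂ Coinv a ^ 2 - algebraMap ℂ Coinv b ^ 2) = 1 := by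
    rw [← map_pow, ← map_pow, ← map_sub, ← map_mul, inv_mul_cancel₀ h.sq_sub_sq_ne_zero, map_one]
  set w := algebraMap ℂ Coinv (a ^ 2 - b ^ 2)⁻¹
  induction c using coinv_induction with
  | hC z => exact ⟨z, 0, 0, by simp⟩
  | hadd c d hc hd =>
    obtain ⟨z, p, q, rfl⟩ := hc
    obtain ⟨z', p', q', rfl⟩ := hd
    exact ⟨z + z', p + p', q + q', by rw [map_add]; ring⟩
  | hmul c i _ =>
    have h0 : coord 0 = w * algebraMap ℂ Coinv a * ell a b -
        w * algebraMap ℂ Coinv b * ellDual a b := by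
      rw [ellDual, ell_eq, ell_eq]
      linear_combination (-coord 0) * hz
    have h1 : coord 1 = w * algebraMap ℂ Coinv a * ellDual a b -
        w * algebraMap ℂ Coinv b * ell a b := by
      rw [ellDual, ell_eq, ell_eq]
      linear_combination (-coord 1) * hz
    have h2 : coord 2 = -coord 0 - coord 1 := by linear_combination coord_sum
    generalize ell a b = e at *
    generalize ellDual a b = e' at *
    fin_cases i
    · refine ⟨0, c * (w * algebraMap ℂ Coinv a), -c * (w * algebraMap ℂ Coinv b), ?_⟩
      simp only [Fin.zero_eta, map_zero, h0]
      ring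
    · refine ⟨0, -c * (w * algebraMap ℂ Coinv b), c * (w * algebraMap ℂ Coinv a), ?_⟩
      simp only [Fin.mk_one, map_zero, h1]
      ring
    · refine ⟨0, c * (w * algebraMap ℂ Coinv b) - c * (w * algebraMap ℂ Coinv a),
        c * (w * algebraMap ℂ Coinv b) - c * (w * algebraMap ℂ Coinv a), ?_⟩
      simp only [Fin.reduceFinMk, map_zero, h2]
      rw [h0, h1]
      ring

end LinearPart

/-! ### M_{a,b} is free of rank one over the invariants -/

section Retraction

/-- If `A` is a complement of the ideal of `a x + b y`, then `M_{a,b}` is free of rank one over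
`A`. -/
theorem Coords.exists_retraction {A : Subalgebra ℂ Coinv} {α β : Coinv} (K : Coords A α β)
    {a b p q : ℂ} (hp : p ≠ 0) (hpq : p ^ 2 - p * q + q ^ 2 = 0)
    (hell : ell a b = algebraMap ℂ Coinv p * β + algebraMap ℂ Coinv q * α) :
    ∃ π : quotMod a b →ₗ[A] A, π (Ideal.Quotient.mk _ 1) = 1 ∧
      ∀ m, π m • (Ideal.Quotient.mk _ 1 : quotMod a b) = m := by
  let α' : A := ⟨α, K.adjoin_eq ▸ Algebra.self_mem_adjoin_singleton ℂ α⟩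
  let r : A := algebraMap ℂ A (q / p)
  -- Modulo ℓ = pβ + qα one has β = −(q/p)α; `π₀` makes this substitution in g₀ + g₁β.
  let π₀ : Coinv →ₗ[A] A := 
    { toFun := fun c => K.g₀ c - r * α' * K.g₁ c
      map_add' := fun c d => by rw [map_add, map_add]; ring
      map_smul' := fun x c => by
        simp only [map_smul, smul_eq_mul, RingHom.id_apply]
        ring }
  have hr : algebraMap ℂ A p * r = algebraMap ℂ A q := by
    rw [← map_mul, mul_div_cancel₀ _ hp]
  have hker : ∀ c ∈ (genIdeal a b).restrictScalars A, π₀ c = 0 := by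
    intro c hc
    obtain ⟨d, rfl⟩ := Ideal.mem_span_singleton'.1 hc
    -- The product dℓ is written in the basis 1, β by means of β² = −α² − αβ. After the substitution
    -- the g₀ part cancels and the g₁ part is a multiple of p² − pq + q².
    have e1 : d * ell a b = (algebraMap ℂ A q * α' * K.g₀ d - algebraMap ℂ A p * α' ^ 2 * K.g₁ d)
        • (1 : Coinv) + (algebraMap ℂ A p * K.g₀ d + algebraMap ℂ A q * α' * K.g₁ d -
          algebraMap ℂ A p * α' * K.g₁ d) • β := by
      rw [hell]
      nth_rewrite 1 [← K.decomp d]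
      change _ = (algebraMap ℂ Coinv q * α * K.g₀ d - algebraMap ℂ Coinv p * α ^ 2 * K.g₁ d) * 1 +
        (algebraMap ℂ Coinv p * K.g₀ d + algebraMap ℂ Coinv q * α * K.g₁ d -
          algebraMap ℂ Coinv p * α * K.g₁ d) * β
      linear_combination (algebraMap ℂ Coinv p * K.g₁ d) * K.rel
    have hpq' : algebraMap ℂ A p ^ 2 - algebraMap ℂ A p * algebraMap ℂ A q +
        algebraMap ℂ A q ^ 2 = 0 := by
      rw [← map_pow, ← map_pow, ← map_mul, ← map_sub, ← map_add, hpq, map_zero]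
    have hp' : algebraMap ℂ A p⁻¹ * algebraMap ℂ A p = 1 := by
      rw [← map_mul, inv_mul_cancel₀ hp, map_one]
    change K.g₀ (d * ell a b) - r * α' * K.g₁ (d * ell a b) = 0
    rw [e1]
    simp only [map_add, map_smul, K.g₀_one, K.g₁_one, K.g₀_gen, K.g₁_gen, smul_eq_mul]
    have hr' : r = algebraMap ℂ A p⁻¹ * algebraMap ℂ A q := by
      linear_combination (-r) * hp' + algebraMap ℂ A p⁻¹ * hr
    rw [hr']
    linear_combination (-algebraMap ℂ A q * α' * K.g₀ d + algebraMap ℂ A p * α' ^ 2 * K.g₁ d -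
      0) * hp' - algebraMap ℂ A p⁻¹ * α' ^ 2 * K.g₁ d * hpq'
  let π : quotMod a b →ₗ[A] A := (((genIdeal a b).restrictScalars A).liftQ π₀ hker) ∘ₗ
    (Submodule.Quotient.restrictScalarsEquiv A (genIdeal a b)).symm.toLinearMap
  have hπ : ∀ c, π (Ideal.Quotient.mk _ c) = π₀ c := fun c => rfl
  refine ⟨π, ?_, ?_⟩
  · rw [hπ]
    change K.g₀ 1 - r * α' * K.g₁ 1 = 1
    rw [K.g₀_one, K.g₁_one, mul_zero, sub_zero]
  · intro m
    obtain ⟨c, rfl⟩ := Ideal.Quotient.mk_surjective m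
    rw [hπ]
    change Ideal.Quotient.mk (genIdeal a b) ((π₀ c : Coinv) * 1) = _
    rw [Ideal.Quotient.eq]
    -- The difference c − π₀(c) = g₁(c)(β + (q/p)α) equals p⁻¹ g₁(c) ℓ.
    refine Ideal.mem_span_singleton'.2 ⟨-(algebraMap ℂ Coinv p⁻¹ * K.g₁ c), ?_⟩
    have hp' : algebraMap ℂ Coinv p⁻¹ * algebraMap ℂ Coinv p = 1 := by
      rw [← map_mul, inv_mul_cancel₀ hp, map_one]
    have hr' : algebraMap ℂ Coinv (q / p) = algebraMap ℂ Coinv p⁻¹ * algebraMap ℂ Coinv q := by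
      rw [← map_mul, div_eq_inv_mul]
    change _ * ell a b = ((K.g₀ c : Coinv) - algebraMap ℂ Coinv (q / p) * α * K.g₁ c) * 1 - c
    nth_rewrite 4 [← K.decomp c]
    rw [hell, hr']
    linear_combination (-K.g₁ c * β) * hp'

/-- Here β = x and α = z, and eliminating y gives ℓ = (a − b)x − bz. The coefficient of β is nonzero
because a² ≠ b², and p² − pq + q² is again a² − ab + b². -/
theorem exists_retractionS {a b : ℂ} (h : Admissible a b) :
    ∃ π : quotMod a b →ₗ[invS] invS, π (Ideal.Quotient.mk _ 1) = 1 ∧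
      ∀ m, π m • (Ideal.Quotient.mk _ 1 : quotMod a b) = m := by
  refine coordsS.exists_retraction (p := a - b) (q := -b) ?_ (by linear_combination h.1) ?_
  · intro h0
    exact h.sq_sub_sq_ne_zero (by linear_combination (a + b) * h0)
  · rw [ell_eq, map_sub, map_neg]
    linear_combination (algebraMap ℂ Coinv b) * coord_sum

/-- The same expression ℓ = (a − b)x − bz, now with β = z and α = x; this is where b ≠ 0 enters. -/
theorem exists_retractionT {a b : ℂ} (h : Admissible a b) :
    ∃ π : quotMod a b →ₗ[invT] invT, π (Ideal.Quotient.mk _ 1) = 1 ∧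
      ∀ m, π m • (Ideal.Quotient.mk _ 1 : quotMod a b) = m := by
  refine coordsT.exists_retraction (p := -b) (q := a - b) (neg_ne_zero.2 h.2.2)
    (by linear_combination h.1) ?_
  rw [ell_eq, map_sub, map_neg]
  linear_combination (algebraMap ℂ Coinv b) * coord_sum

end Retraction

end SoergelA2

end

noncomputable section

namespace SoergelA2

/-! ### Maps out of R ⊗_A M, contractions and dual bases -/

section Unbundled

variable {R : Type} [CommRing R] [Algebra ℂ R]
  {L M N : Type} [AddCommGroup L] [AddCommGroup M] [AddCommGroup N]
  [Module R L] [Module R M] [Module R N]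

theorem tmul_coe_smul (A : Subalgebra ℂ R) (r : R) (a : A) (m : M) :
    r ⊗ₜ[A] ((a : R) • m) = ((a : R) * r) ⊗ₜ[A] m :=
  (TensorProduct.smul_tmul a r m).symm

theorem tmul_smul_of_mem {A : Subalgebra ℂ R} {a : R} (ha : a ∈ A) (r : R) (m : M) :
    r ⊗ₜ[A] (a • m) = (a * r) ⊗ₜ[A] m := tmul_coe_smul A r ⟨a, ha⟩ m

theorem smul_theta_tmul (A : Subalgebra ℂ R) (c r : R) (m : M) :
    c • (r ⊗ₜ[A] m) = (c * r) ⊗ₜ[A] m := rfl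

/-- An additive map out of `R ⊗_A M` which is balanced. -/
def tensorLift (A : Subalgebra ℂ R) (f : R →+ M →+ N)
    (hf : ∀ (a : A) (r : R) (m : M), f (a * r) m = f r ((a : R) • m)) : R ⊗[A] M →+ N :=
  TensorProduct.liftAddHom f hf

/-- Maps out of `R ⊗_A M` are `A`-linear maps out of `M`. -/
def indLift (A : Subalgebra ℂ R) (f : M →+ N) (hf : ∀ (a : A) (m : M), f ((a : R) • m) = (a : R) • f m) :
    R ⊗[A] M →ₗ[R] N :=
  { tensorLift A ((AddMonoidHom.compHom.flip f).comp (smulAddHom R N))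
      (fun a r m => by
        change ((a : R) * r) • f m = r • f ((a : R) • m)
        rw [hf, smul_smul, mul_comm]) with
    map_smul' := fun c x => by
      induction x using TensorProduct.induction_on with
      | zero => simp
      | add x y hx hy =>
        simp only [smul_add, ZeroHom.toFun_eq_coe, AddMonoidHom.toZeroHom_coe, map_add,
          RingHom.id_apply] at hx hy ⊢
        rw [hx, hy]
      | tmul r m => exact mul_smul c r (f m) }

theorem indLift_tmul (A : Subalgebra ℂ R) (f : M →+ N) (hf) (r : R) (m : M) :
    indLift A f hf (r ⊗ₜ[A] m) = r • f m := rfl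

/-- The map `id ⊗ f` for an `A`-linear map `f`. -/
def indMap (A : Subalgebra ℂ R) (f : M →+ N) (hf : ∀ (a : A) (m : M), f ((a : R) • m) = (a : R) • f m) :
    R ⊗[A] M →ₗ[R] R ⊗[A] N :=
  indLift A
    { toFun := fun m => (1 : R) ⊗ₜ[A] f m
      map_zero' := by rw [map_zero, TensorProduct.tmul_zero]
      map_add' := fun x y => by rw [map_add, TensorProduct.tmul_add] }
    (fun a m => by
      change (1 : R) ⊗ₜ[A] f ((a : R) • m) = (a : R) • ((1 : R) ⊗ₜ[A] f m)
      rw [hf, tmul_coe_smul, smul_theta_tmul])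

theorem indMap_tmul (A : Subalgebra ℂ R) (f : M →+ N) (hf) (r : R) (m : M) :
    indMap A f hf (r ⊗ₜ[A] m) = r ⊗ₜ[A] f m := by
  change r • ((1 : R) ⊗ₜ[A] f m) = _
  rw [smul_theta_tmul, mul_one]

theorem ind_ext {A : Subalgebra ℂ R} {f g : R ⊗[A] M →+ N}
    (h : ∀ r m, f (r ⊗ₜ[A] m) = g (r ⊗ₜ[A] m)) (x : R ⊗[A] M) : f x = g x := by
  induction x using TensorProduct.induction_on with
  | zero => rw [map_zero, map_zero]
  | add x y hx hy => rw [map_add, map_add, hx, hy]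
  | tmul r m => exact h r m

theorem ind_ext_one {A : Subalgebra ℂ R} {f g : R ⊗[A] M →ₗ[R] N}
    (h : ∀ m, f ((1 : R) ⊗ₜ[A] m) = g ((1 : R) ⊗ₜ[A] m)) : f = g := by
  refine LinearMap.ext fun x =>
    ind_ext (f := f.toAddMonoidHom) (g := g.toAddMonoidHom) (fun r m => ?_) x
  have : r ⊗ₜ[A] m = r • ((1 : R) ⊗ₜ[A] m) := by rw [smul_theta_tmul, mul_one]
  change f _ = g _
  rw [this, map_smul, map_smul, h]

/-- The map `m ↦ e ⊗ m`. -/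
def insTmul (A : Subalgebra ℂ R) (M : Type) [AddCommGroup M] [Module R M] (e : R) :
    M →+ R ⊗[A] M where
  toFun m := e ⊗ₜ[A] m
  map_zero' := TensorProduct.tmul_zero _ _
  map_add' := TensorProduct.tmul_add _

theorem insTmul_apply (A : Subalgebra ℂ R) (e : R) (m : M) : insTmul A M e m = e ⊗ₜ[A] m := rfl

theorem insTmul_smul {A : Subalgebra ℂ R} {b : R} (hb : b ∈ A) (e : R) (m : M) :
    insTmul A M e (b • m) = b • insTmul A M e m := by
  rw [insTmul_apply, insTmul_apply, tmul_smul_of_mem hb, smul_theta_tmul]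

/-- The contraction `r ⊗ m ↦ φ(r) m` of a linear form `φ : R → A`. -/
def contract {A : Subalgebra ℂ R} (φ : R →ₗ[A] A) (M : Type) [AddCommGroup M] [Module R M] :
    R ⊗[A] M →+ M :=
  tensorLift A ((smulAddHom R M).comp (A.val.toLinearMap.toAddMonoidHom.comp φ.toAddMonoidHom))
    (fun a r m => by
      have h : φ ((a : R) * r) = a * φ r := φ.map_smul a r
      change (φ ((a : R) * r) : R) • m = (φ r : R) • (a : R) • m
      rw [h, smul_smul, mul_comm]
      rfl)

theorem contract_tmul {A : Subalgebra ℂ R} (φ : R →ₗ[A] A) (r : R) (m : M) :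
    contract φ M (r ⊗ₜ[A] m) = (φ r : R) • m := rfl

theorem contract_smul {A : Subalgebra ℂ R} (φ : R →ₗ[A] A) {a : R} (ha : a ∈ A) (x : R ⊗[A] M) :
    contract φ M (a • x) = a • contract φ M x := by
  induction x using TensorProduct.induction_on with
  | zero => simp
  | add x y hx hy => rw [smul_add, map_add, map_add, hx, hy, smul_add]
  | tmul r m =>
    have h : φ (a * r) = ⟨a, ha⟩ * φ r := φ.map_smul ⟨a, ha⟩ r
    rw [smul_theta_tmul, contract_tmul, contract_tmul, h, smul_smul]
    rfl

theorem contract_natural {A : Subalgebra ℂ R} (φ : R →ₗ[A] A) (f : M →ₗ[R] N) (x : R ⊗[A] M) :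
    contract φ N (thetaMap A f x) = f (contract φ M x) := by
  refine ind_ext (f := (contract φ N).comp (thetaMap A f).toAddMonoidHom)
    (g := f.toAddMonoidHom.comp (contract φ M)) (fun r m => ?_) x
  exact (map_smul f _ _).symm

/-- The map `r ⊗ x ↦ φ(r) ⊗ x` of `R ⊗_B M` for a linear form `φ : R → A` and `B ≤ A`. -/
def contractLeft {A B : Subalgebra ℂ R} (hBA : B ≤ A) (φ : R →ₗ[A] A) (M : Type) [AddCommGroup M]
    [Module R M] : R ⊗[B] M →+ R ⊗[B] M :=
  tensorLift B
    { toFun := fun r => insTmul B M (φ r)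
      map_zero' := by
        ext m
        simp [insTmul_apply]
      map_add' := fun r r' => by
        ext m
        simp [insTmul_apply, TensorProduct.add_tmul] }
    (fun b r m => by
      have h : φ ((b : R) * r) = ⟨b, hBA b.2⟩ * φ r := φ.map_smul ⟨b, hBA b.2⟩ r
      change (φ ((b : R) * r) : R) ⊗ₜ[B] m = (φ r : R) ⊗ₜ[B] ((b : R) • m)
      rw [h, tmul_coe_smul]
      rfl)

theorem contractLeft_tmul {A B : Subalgebra ℂ R} (hBA : B ≤ A) (φ : R →ₗ[A] A) (r : R) (m : M) :
    contractLeft hBA φ M (r ⊗ₜ[B] m) = (φ r : R) ⊗ₜ[B] m := rfl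

theorem contractLeft_smul {A B : Subalgebra ℂ R} (hBA : B ≤ A) (φ : R →ₗ[A] A) (a : A)
    (x : R ⊗[B] M) :
    contractLeft hBA φ M ((a : R) • x) = (a : R) • contractLeft hBA φ M x := by
  induction x using TensorProduct.induction_on with
  | zero => simp
  | add x y hx hy => rw [smul_add, map_add, map_add, hx, hy, smul_add]
  | tmul r m =>
    have h : φ ((a : R) * r) = a * φ r := φ.map_smul a r
    rw [smul_theta_tmul, contractLeft_tmul, contractLeft_tmul, h, smul_theta_tmul]
    rfl

theorem contractLeft_natural {A B : Subalgebra ℂ R} (hBA : B ≤ A) (φ : R →ₗ[A] A)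
    (f : M →ₗ[R] N) (x : R ⊗[B] M) :
    contractLeft hBA φ N (thetaMap B f x) = thetaMap B f (contractLeft hBA φ M x) :=
  ind_ext (f := (contractLeft hBA φ N).comp (thetaMap B f).toAddMonoidHom)
    (g := (thetaMap B f).toAddMonoidHom.comp (contractLeft hBA φ M)) (fun _ _ => rfl) x

/-- A dual basis of `R` over a subalgebra. -/
structure DualBasis (A : Subalgebra ℂ R) where
  ι : Type
  [fintype : Fintype ι]
  e : ι → R
  φ : ι → R →ₗ[A] A
  total : ∀ r, ∑ i, (φ i r : R) * e i = r

attribute [instance] DualBasis.fintype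

/-- On r ⊗ m this is the expansion r = Σ φᵢ(r)eᵢ with the coefficients in A moved across the tensor
sign. -/
theorem DualBasis.sum_tmul_contract {A : Subalgebra ℂ R} (D : DualBasis A) (x : R ⊗[A] M) :
    ∑ i, D.e i ⊗ₜ[A] contract (D.φ i) M x = x := by
  have : ∑ i, (insTmul A M (D.e i)).comp (contract (D.φ i) M) = AddMonoidHom.id _ := by
    refine AddMonoidHom.ext fun x => ind_ext (fun r m => ?_) x
    rw [AddMonoidHom.finsetSum_apply]
    conv_rhs => rw [← D.total r, TensorProduct.sum_tmul]
    exact Finset.sum_congr rfl fun i _ => tmul_coe_smul A _ _ _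
  have h2 := DFunLike.congr_fun this x
  rw [AddMonoidHom.finsetSum_apply] at h2
  exact h2

theorem insTmul_one_comp_smul {A B : Subalgebra ℂ R} (hBA : B ≤ A) (e : R) (b : B) (m : M) :
    (insTmul A (R ⊗[B] M) 1).comp (insTmul B M e) ((b : R) • m) =
      (b : R) • (insTmul A (R ⊗[B] M) 1).comp (insTmul B M e) m := by
  rw [AddMonoidHom.comp_apply, insTmul_smul b.2, insTmul_smul (hBA b.2)]
  rfl

/-- The inner factor is expanded as r = Σ φᵢ(r)eᵢ and the coefficients pass to the outer factor of R
⊗_A R ⊗_B M. What remains depends only on r through φᵢ(r) ⊗ m in R ⊗_B M. -/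
theorem DualBasis.sum_indLift_contractLeft {A B : Subalgebra ℂ R} (hBA : B ≤ A) (D : DualBasis A)
    (x : R ⊗[B] M) :
    ∑ i, indLift B ((insTmul A (R ⊗[B] M) 1).comp (insTmul B M (D.e i)))
      (insTmul_one_comp_smul hBA (D.e i)) (contractLeft hBA (D.φ i) M x) = 1 ⊗ₜ[A] x := by
  have : ∑ i, (indLift B ((insTmul A (R ⊗[B] M) 1).comp (insTmul B M (D.e i)))
      (insTmul_one_comp_smul hBA (D.e i))).toAddMonoidHom.comp (contractLeft hBA (D.φ i) M) =
      insTmul A (R ⊗[B] M) 1 := by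
    refine AddMonoidHom.ext fun x => ind_ext (fun r m => ?_) x
    rw [AddMonoidHom.finsetSum_apply, insTmul_apply]
    conv_rhs => rw [← D.total r, TensorProduct.sum_tmul, TensorProduct.tmul_sum]
    refine Finset.sum_congr rfl fun i _ => ?_
    change ((D.φ i r : A) : R) • ((1 : R) ⊗ₜ[A] (D.e i ⊗ₜ[B] m)) = _
    rw [smul_theta_tmul, ← tmul_coe_smul, smul_theta_tmul]
  have h2 := DFunLike.congr_fun this x
  rw [AddMonoidHom.finsetSum_apply] at h2
  exact h2

end Unbundled

/-! ### Products θ_Aθ_B for nested subalgebras -/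

section Bundled

variable {R : Type} [CommRing R] [Algebra ℂ R]

/-- A natural transformation from a natural family of linear maps. -/
def mkNat {F G : FGModuleCat.{0} R ⥤ FGModuleCat.{0} R}
    (app : ∀ X : FGModuleCat.{0} R, F.obj X →ₗ[R] G.obj X)
    (nat : ∀ (X Y : FGModuleCat.{0} R) (f : X ⟶ Y),
      app Y ∘ₗ (F.map f).hom.hom = (G.map f).hom.hom ∘ₗ app X) : F ⟶ G where
  app X := FGModuleCat.ofHom (app X)
  naturality X Y f := FGModuleCat.hom_ext (nat X Y f)

theorem nat_ext {F G : FGModuleCat.{0} R ⥤ FGModuleCat.{0} R} {α β : F ⟶ G}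
    (h : ∀ X, (α.app X).hom.hom = (β.app X).hom.hom) : α = β := by
  ext X : 2
  exact FGModuleCat.hom_ext (h X)

variable [Module.Finite ℂ R]

theorem hom_sum_apply {X Y : FGModuleCat.{0} R} {ι : Type} [Fintype ι] (f : ι → (X ⟶ Y)) (x : X) :
    (∑ i, f i).hom.hom x = ∑ i, (f i).hom.hom x := by
  have h : ∀ s : Finset ι, (∑ i ∈ s, f i).hom.hom x = ∑ i ∈ s, (f i).hom.hom x := by
    classical
    intro s
    induction s using Finset.induction_on with
    | empty => rfl
    | insert a s ha ih => rw [Finset.sum_insert ha, Finset.sum_insert ha, ← ih]; rfl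
  exact h _

theorem nat_sum_app {F G : FGModuleCat.{0} R ⥤ FGModuleCat.{0} R} {ι : Type} [Fintype ι]
    (α : ι → (F ⟶ G)) (X : FGModuleCat.{0} R) : (∑ i, α i).app X = ∑ i, (α i).app X := by
  have h : ∀ s : Finset ι, (∑ i ∈ s, α i).app X = ∑ i ∈ s, (α i).app X := by
    classical
    intro s
    induction s using Finset.induction_on with
    | empty => rfl
    | insert a s ha ih => rw [Finset.sum_insert ha, Finset.sum_insert ha, ← ih]; rfl
  exact h _

/-- The natural transformation induced by a natural family of `A`-linear maps. -/
def natIndLift (A : Subalgebra ℂ R) {F G : FGModuleCat.{0} R ⥤ FGModuleCat.{0} R}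
    (p : ∀ X, F.obj X →+ G.obj X) (hp : ∀ X (a : A) x, p X ((a : R) • x) = (a : R) • p X x)
    (nat : ∀ X Y (f : X ⟶ Y) x, p Y ((F.map f).hom.hom x) = (G.map f).hom.hom (p X x)) :
    F ⋙ theta A ⟶ G :=
  mkNat (F := F ⋙ theta A) (fun X => indLift A (p X) (hp X)) fun X Y f => ind_ext_one fun x => by
    change indLift A (p Y) (hp Y) ((1 : R) ⊗ₜ[A] (F.map f).hom.hom x) =
      (G.map f).hom.hom (indLift A (p X) (hp X) ((1 : R) ⊗ₜ[A] x))
    rw [indLift_tmul, indLift_tmul, one_smul, one_smul, nat]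

theorem natIndLift_app (A : Subalgebra ℂ R) {F G : FGModuleCat.{0} R ⥤ FGModuleCat.{0} R}
    (p : ∀ X, F.obj X →+ G.obj X) (hp nat) (X : FGModuleCat.{0} R) (r : R) (x : F.obj X) :
    ((natIndLift A p hp nat).app X).hom.hom (r ⊗ₜ[A] x) = r • p X x := rfl

/-- The natural transformation `θ_A F ⟶ θ_A G` induced by a natural family of `A`-linear maps. -/
def natIndMap (A : Subalgebra ℂ R) {F G : FGModuleCat.{0} R ⥤ FGModuleCat.{0} R}
    (p : ∀ X, F.obj X →+ G.obj X) (hp : ∀ X (a : A) x, p X ((a : R) • x) = (a : R) • p X x)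
    (nat : ∀ X Y (f : X ⟶ Y) x, p Y ((F.map f).hom.hom x) = (G.map f).hom.hom (p X x)) :
    F ⋙ theta A ⟶ G ⋙ theta A :=
  mkNat (F := F ⋙ theta A) (G := G ⋙ theta A) (fun X => indMap A (p X) (hp X))
    fun X Y f => ind_ext_one fun x => by
      change indMap A (p Y) (hp Y) ((1 : R) ⊗ₜ[A] (F.map f).hom.hom x) =
        thetaMap A (G.map f).hom.hom (indMap A (p X) (hp X) ((1 : R) ⊗ₜ[A] x))
      rw [indMap_tmul, indMap_tmul, thetaMap_tmul, nat]

theorem natIndMap_app (A : Subalgebra ℂ R) {F G : FGModuleCat.{0} R ⥤ FGModuleCat.{0} R}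
    (p : ∀ X, F.obj X →+ G.obj X) (hp nat) (X : FGModuleCat.{0} R) (r : R) (x : F.obj X) :
    ((natIndMap A p hp nat).app X).hom.hom (r ⊗ₜ[A] x) = r ⊗ₜ[A] p X x :=
  indMap_tmul A (p X) (hp X) r x

/-- Components out of `F ⋙ theta A` are R-linear maps on R ⊗_A F(X), so they are determined on the
elements 1 ⊗ x. -/
theorem sum_comp_eq_id {A : Subalgebra ℂ R} {F : FGModuleCat.{0} R ⥤ FGModuleCat.{0} R}
    {ι : Type} [Fintype ι] {G : ι → (FGModuleCat.{0} R ⥤ FGModuleCat.{0} R)}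
    (p : ∀ i, F ⋙ theta A ⟶ G i) (q : ∀ i, G i ⟶ F ⋙ theta A)
    (h : ∀ X (x : F.obj X), ∑ i, ((q i).app X).hom.hom (((p i).app X).hom.hom ((1 : R) ⊗ₜ[A] x)) =
      (1 : R) ⊗ₜ[A] x) : ∑ i, p i ≫ q i = 𝟙 _ := by
  refine nat_ext fun X => ind_ext_one fun x => ?_
  rw [nat_sum_app]
  exact (hom_sum_apply _ _).trans (h X x)

/-- `θ_B θ_A` is a summand of a multiple of `θ_B` for `B ≤ A`. -/
theorem dominated_theta_comp_left {A B : Subalgebra ℂ R} (hBA : B ≤ A) (D : DualBasis A) :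
    Dominated (· = theta B) (theta A ⋙ theta B) := by
  -- Over B, the module R ⊗_A X is a sum of pieces eᵢ ⊗ X. The maps are coordinate and inclusion for
  -- each piece, induced from B to R.
  let p (i : D.ι) : theta A ⋙ theta B ⟶ theta B :=
    natIndMap B (F := theta A) (G := 𝟭 _) (fun X => contract (D.φ i) X)
      (fun X b x => contract_smul (D.φ i) (hBA b.2) x)
      (fun X Y f x => contract_natural (D.φ i) f.hom.hom x)
  let q (i : D.ι) : theta B ⟶ theta A ⋙ theta B :=
    natIndMap B (F := 𝟭 _) (G := theta A) (fun X => insTmul A X (D.e i))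
      (fun X b x => insTmul_smul (hBA b.2) (D.e i) x) (fun X Y f x => rfl)
  refine ⟨D.ι, inferInstance, fun _ => theta B, p, q, fun _ => rfl,
    sum_comp_eq_id p q fun X x => ?_⟩
  have key : ∀ i, ((q i).app X).hom.hom (((p i).app X).hom.hom ((1 : R) ⊗ₜ[B] x)) =
      insTmul B (R ⊗[A] X) 1 (D.e i ⊗ₜ[A] contract (D.φ i) X x) := by
    intro i
    exact (congrArg _ (natIndMap_app B _ _ _ X 1 x)).trans (natIndMap_app B _ _ _ X 1 _)
  refine (Finset.sum_congr rfl fun i _ => key i).trans ?_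
  exact (map_sum (insTmul B (R ⊗[A] X) 1) _ _).symm.trans
    (congrArg (insTmul B (R ⊗[A] X) 1) (D.sum_tmul_contract x))

/-- `θ_A θ_B` is a summand of a multiple of `θ_B` for `B ≤ A`. -/
theorem dominated_theta_comp_right {A B : Subalgebra ℂ R} (hBA : B ≤ A) (D : DualBasis A) :
    Dominated (· = theta B) (theta B ⋙ theta A) := by
  -- Here it is the left A-module R that is expanded in the dual basis; each summand returns to R
  -- ⊗_B X because induction from A is applied to it.
  let p (i : D.ι) : theta B ⋙ theta A ⟶ theta B :=
    natIndLift A (F := theta B) (G := theta B) (fun X => contractLeft hBA (D.φ i) X)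
      (fun X => contractLeft_smul hBA (D.φ i))
      (fun X Y f x => contractLeft_natural hBA (D.φ i) f.hom.hom x)
  let q (i : D.ι) : theta B ⟶ theta B ⋙ theta A :=
    natIndLift B (F := 𝟭 _) (G := theta B ⋙ theta A)
      (fun X => (insTmul A (R ⊗[B] X) 1).comp (insTmul B X (D.e i)))
      (fun X b x => insTmul_one_comp_smul hBA (D.e i) b x)
      (fun X Y f x => rfl)
  refine ⟨D.ι, inferInstance, fun _ => theta B, p, q, fun _ => rfl,
    sum_comp_eq_id p q fun X x => ?_⟩
  have key : ∀ i, ((q i).app X).hom.hom (((p i).app X).hom.hom ((1 : R) ⊗ₜ[A] x)) =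
      ((q i).app X).hom.hom (contractLeft hBA (D.φ i) X x) := by
    intro i
    exact congrArg _ ((natIndLift_app A _ _ _ X 1 x).trans (one_smul _ _))
  refine (Finset.sum_congr rfl fun i _ => key i).trans ?_
  exact D.sum_indLift_contractLeft hBA x

end Bundled

end SoergelA2

end

noncomputable section

namespace SoergelA2

/-! ### The decomposition θ_sθ_tθ_s = θ_{sts} ⊕ θ_s -/

section BottSamelson

variable {R : Type} [CommRing R] [Algebra ℂ R] {A B : Subalgebra ℂ R} {α β : R}

theorem Coords.gen_mem (K : Coords A α β) : α ∈ A :=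
  K.adjoin_eq ▸ Algebra.self_mem_adjoin_singleton ℂ α

/-- Multiplication by β in the basis 1, β, using β² = −α² − αβ. -/
theorem Coords.gen_mul_eq (K : Coords A α β) (d : R) :
    β * d = (-(⟨α, K.gen_mem⟩ ^ 2 * K.g₁ d) : A) • (1 : R) +
      (K.g₀ d - ⟨α, K.gen_mem⟩ * K.g₁ d : A) • β := by
  change β * d = -(α ^ 2 * (K.g₁ d : R)) * 1 + ((K.g₀ d : R) - α * K.g₁ d) * β
  nth_rewrite 1 [← K.decomp d]
  linear_combination (K.g₁ d : R) * K.rel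

theorem Coords.g₀_gen_mul (K : Coords A α β) (d : R) :
    (K.g₀ (β * d) : R) = -(α ^ 2 * K.g₁ d) := by
  rw [K.gen_mul_eq, map_add, map_smul, map_smul, K.g₀_one, K.g₀_gen, smul_zero, add_zero]
  change -(α ^ 2 * (K.g₁ d : R)) * 1 = _
  rw [mul_one]

theorem Coords.g₁_gen_mul (K : Coords A α β) (d : R) :
    (K.g₁ (β * d) : R) = K.g₀ d - α * K.g₁ d := by
  rw [K.gen_mul_eq, map_add, map_smul, map_smul, K.g₁_one, K.g₁_gen, smul_zero, zero_add]
  change ((K.g₀ d : R) - α * K.g₁ d) * 1 = _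
  rw [mul_one]

variable {M N : Type} [AddCommGroup M] [AddCommGroup N] [Module R M] [Module R N]

theorem tmul_smul_of_mem₂ {B : Subalgebra ℂ R} {b : R} (hb : b ∈ B) (r : R) (y : R ⊗[A] M) :
    r ⊗ₜ[B] (b • y) = (b * r) ⊗ₜ[B] y := tmul_smul_of_mem (M := R ⊗[A] M) hb r y

theorem tmul_smul_of_mem₃ {D : Subalgebra ℂ R} {d : R} (hd : d ∈ D) (r : R)
    (y : R ⊗[B] (R ⊗[A] M)) :
    r ⊗ₜ[D] (d • y) = (d * r) ⊗ₜ[D] y := tmul_smul_of_mem (M := R ⊗[B] (R ⊗[A] M)) hd r y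

theorem Coords.contract₀_gen_smul (K : Coords A α β) (w : R ⊗[A] M) :
    contract K.g₀ M (β • w) = -(α ^ 2 • contract K.g₁ M w) := by
  induction w using TensorProduct.induction_on with
  | zero => simp
  | add x y hx hy => rw [smul_add, map_add, map_add, hx, hy, smul_add, neg_add]
  | tmul r m =>
    rw [smul_theta_tmul, contract_tmul, contract_tmul, K.g₀_gen_mul, neg_smul, mul_smul]

theorem Coords.contract₁_gen_smul (K : Coords A α β) (w : R ⊗[A] M) :
    contract K.g₁ M (β • w) = contract K.g₀ M w - α • contract K.g₁ M w := by
  induction w using TensorProduct.induction_on with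
  | zero => simp
  | add x y hx hy =>
    simp only [smul_add, map_add, hx, hy]
    abel
  | tmul r m =>
    simp only [smul_theta_tmul, contract_tmul, K.g₁_gen_mul, sub_smul, mul_smul]

theorem Coords.contract_decomp (K : Coords A α β) (w : R ⊗[A] M) :
    (1 : R) ⊗ₜ[A] contract K.g₀ M w + β ⊗ₜ[A] contract K.g₁ M w = w := by
  induction w using TensorProduct.induction_on with
  | zero => simp
  | add x y hx hy =>
    conv_rhs => rw [← hx, ← hy]
    simp only [map_add, TensorProduct.tmul_add]
    abel
  | tmul r m =>
    rw [contract_tmul, contract_tmul, tmul_coe_smul, tmul_coe_smul, ← TensorProduct.add_tmul,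
      mul_one, K.decomp]

/-- The biadditive map underlying the projection `θ_A θ_B θ_A → θ_{sts}`. -/
def Coords.bottFun (K : Coords A α β) (d : R) (w : R ⊗[A] M) : R ⊗[(⊥ : Subalgebra ℂ R)] M :=
  (K.g₀ d : R) ⊗ₜ contract K.g₀ M w
    - ((α * K.g₀ d) ⊗ₜ contract K.g₁ M w + (K.g₀ d : R) ⊗ₜ (α • contract K.g₁ M w)
      + (α * K.g₁ d) ⊗ₜ contract K.g₀ M w + (K.g₁ d : R) ⊗ₜ (α • contract K.g₀ M w))
    + (α * K.g₁ d) ⊗ₜ (α • contract K.g₁ M w)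

/-- The biadditive map underlying the projection `θ_A θ_B θ_A → θ_{sts}`. -/
def Coords.bottHom (K : Coords A α β) (M : Type) [AddCommGroup M] [Module R M] :
    R →+ R ⊗[A] M →+ R ⊗[(⊥ : Subalgebra ℂ R)] M :=
  AddMonoidHom.mk' (fun d => AddMonoidHom.mk' (fun w => K.bottFun d w) fun w w' => by
      simp only [Coords.bottFun, map_add, smul_add, TensorProduct.tmul_add]
      abel)
    fun d d' => by
      ext w
      simp only [AddMonoidHom.mk'_apply, AddMonoidHom.add_apply, Coords.bottFun, map_add, mul_add,
        TensorProduct.add_tmul, Subalgebra.coe_add]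
      abel

theorem Coords.bottHom_apply (K : Coords A α β) (d : R) (w : R ⊗[A] M) :
    K.bottHom M d w = K.bottFun d w := rfl

/-- The formula `bottFun` extends 1⊗1 ↦ 1⊗1, with β⊗1 and 1⊗β both sent to −(α⊗1 + 1⊗α) and β⊗β to
α⊗α. These values are compatible with β² = −α² − αβ, since β²⊗1 is then sent to −α²⊗1 + α(α⊗1 + 1⊗α)
= α⊗α; α³ = 0 removes the cubic terms. -/
theorem Coords.bottHom_gen (K : Coords A α β) (d : R) (w : R ⊗[A] M) :
    K.bottHom M (β * d) w = K.bottHom M d (β • w) := by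
  simp only [Coords.bottHom_apply, Coords.bottFun, K.g₀_gen_mul, K.g₁_gen_mul,
    K.contract₀_gen_smul, K.contract₁_gen_smul]
  generalize (K.g₀ d : R) = d₀
  generalize (K.g₁ d : R) = d₁
  generalize contract K.g₀ M w = w₀
  generalize contract K.g₁ M w = w₁
  have e1 : α * -(α ^ 2 * d₁) = 0 := by linear_combination (-d₁) * K.cube
  have e2 : α • -(α ^ 2 • w₁) = 0 := by
    rw [smul_neg, smul_smul, ← pow_succ', K.cube, zero_smul, neg_zero]
  have e3 : α * (d₀ - α * d₁) = α * d₀ - α ^ 2 * d₁ := by ring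
  have e4 : α • (w₀ - α • w₁) = α • w₀ - α ^ 2 • w₁ := by
    rw [smul_sub, smul_smul, ← pow_two]
  rw [e1, e2, e3, e4]
  simp only [TensorProduct.sub_tmul, TensorProduct.tmul_sub, TensorProduct.neg_tmul,
    TensorProduct.tmul_neg, TensorProduct.zero_tmul, TensorProduct.tmul_zero]
  abel

/-- Both scalars and β can be moved across, and B is generated by β. -/
theorem Coords.bottHom_balanced (K : Coords A α β) (hB : Algebra.adjoin ℂ {β} = B) (b : B) (d : R)
    (w : R ⊗[A] M) : K.bottHom M (b * d) w = K.bottHom M d ((b : R) • w) := by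
  obtain ⟨b, hb⟩ := b
  change K.bottHom M (b * d) w = K.bottHom M d (b • w)
  rw [← hB] at hb
  induction hb using Algebra.adjoin_induction generalizing d w with
  | mem x hx =>
    obtain rfl : x = β := hx
    exact K.bottHom_gen d w
  | algebraMap z =>
    have h0 : (K.g₀ (algebraMap ℂ R z * d) : R) = algebraMap ℂ R z * K.g₀ d :=
      congrArg Subtype.val (K.g₀.map_smul (algebraMap ℂ A z) d)
    have h1 : (K.g₁ (algebraMap ℂ R z * d) : R) = algebraMap ℂ R z * K.g₁ d :=
      congrArg Subtype.val (K.g₁.map_smul (algebraMap ℂ A z) d)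
    have hz : algebraMap ℂ R z ∈ (⊥ : Subalgebra ℂ R) := Subalgebra.algebraMap_mem _ z
    have hA : algebraMap ℂ R z ∈ A := Subalgebra.algebraMap_mem _ z
    simp only [Coords.bottHom_apply, Coords.bottFun, h0, h1, contract_smul _ hA,
      smul_comm α (algebraMap ℂ R z), tmul_smul_of_mem hz, mul_left_comm α (algebraMap ℂ R z)]
  | add x y _ _ hx hy =>
    rw [add_mul, map_add, AddMonoidHom.add_apply, hx, hy, add_smul, map_add]
  | mul x y _ _ hx hy =>
    rw [mul_assoc, hx, hy, smul_smul, mul_comm]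

/-- The projection `C ⊗_B C ⊗_A M → C ⊗_ℂ M`. -/
def Coords.bott (K : Coords A α β) (hB : Algebra.adjoin ℂ {β} = B) (M : Type) [AddCommGroup M]
    [Module R M] : R ⊗[B] (R ⊗[A] M) →+ R ⊗[(⊥ : Subalgebra ℂ R)] M :=
  tensorLift B (K.bottHom M) (K.bottHom_balanced hB)

theorem Coords.bott_tmul (K : Coords A α β) (hB : Algebra.adjoin ℂ {β} = B) (d : R)
    (w : R ⊗[A] M) : K.bott hB M (d ⊗ₜ[B] w) = K.bottFun d w := rfl

theorem Coords.bott_smul (K : Coords A α β) (hB : Algebra.adjoin ℂ {β} = B) (a : A)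
    (x : R ⊗[B] (R ⊗[A] M)) : K.bott hB M ((a : R) • x) = (a : R) • K.bott hB M x := by
  induction x using TensorProduct.induction_on with
  | zero => simp
  | add x y hx hy => rw [smul_add, map_add, map_add, hx, hy, smul_add]
  | tmul d w =>
    have h0 : (K.g₀ (a * d) : R) = a * K.g₀ d := congrArg Subtype.val (K.g₀.map_smul a d)
    have h1 : (K.g₁ (a * d) : R) = a * K.g₁ d := congrArg Subtype.val (K.g₁.map_smul a d)
    rw [smul_theta_tmul]
    simp only [Coords.bott_tmul, Coords.bottFun, h0, h1, smul_add, smul_sub, smul_theta_tmul,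
      mul_left_comm α (a : R)]

theorem Coords.bott_natural (K : Coords A α β) (hB : Algebra.adjoin ℂ {β} = B) (f : M →ₗ[R] N)
    (x : R ⊗[B] (R ⊗[A] M)) :
    K.bott hB N (thetaMap B (thetaMap A f) x) = thetaMap ⊥ f (K.bott hB M x) := by
  refine ind_ext (f := (K.bott hB N).comp (thetaMap B (thetaMap A f)).toAddMonoidHom)
    (g := (thetaMap ⊥ f).toAddMonoidHom.comp (K.bott hB M)) (fun d w => ?_) x
  change K.bottFun d (thetaMap A f w) = thetaMap ⊥ f (K.bottFun d w)
  simp only [Coords.bottFun, contract_natural, map_add, map_sub, thetaMap_tmul, map_smul]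

/-- The multiplication map `R ⊗_B N → N`. -/
def mulMap (B : Subalgebra ℂ R) (N : Type) [AddCommGroup N] [Module R N] : R ⊗[B] N →ₗ[R] N :=
  indLift B (AddMonoidHom.id N) fun _ _ => rfl

/-- The map `C ⊗_B C ⊗_A M → M` induced by multiplication and the Demazure operator. -/
def Coords.demazure (K : Coords A α β) (B : Subalgebra ℂ R) (M : Type) [AddCommGroup M]
    [Module R M] : R ⊗[B] (R ⊗[A] M) →+ M :=
  (contract K.g₁ M).comp (mulMap B (R ⊗[A] M)).toAddMonoidHom

theorem Coords.demazure_tmul (K : Coords A α β) (d : R) (w : R ⊗[A] M) :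
    K.demazure B M (d ⊗ₜ[B] w) = (K.g₀ d : R) • contract K.g₁ M w +
      (K.g₁ d : R) • contract K.g₀ M w - ((K.g₁ d : R) * α) • contract K.g₁ M w := by
  change contract K.g₁ M (d • w) = _
  nth_rewrite 1 [← K.decomp d]
  rw [add_smul, mul_smul, map_add, contract_smul _ (K.g₀ d).2, contract_smul _ (K.g₁ d).2,
    K.contract₁_gen_smul, smul_sub, smul_smul]
  abel

theorem Coords.demazure_smul (K : Coords A α β) (a : A) (x : R ⊗[B] (R ⊗[A] M)) :
    K.demazure B M ((a : R) • x) = (a : R) • K.demazure B M x := by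
  change contract K.g₁ M (mulMap B (R ⊗[A] M) ((a : R) • x)) = _
  rw [map_smul, contract_smul _ a.2]
  rfl

theorem Coords.demazure_natural (K : Coords A α β) (f : M →ₗ[R] N) (x : R ⊗[B] (R ⊗[A] M)) :
    K.demazure B N (thetaMap B (thetaMap A f) x) = f (K.demazure B M x) := by
  refine ind_ext (f := (K.demazure B N).comp (thetaMap B (thetaMap A f)).toAddMonoidHom)
    (g := f.toAddMonoidHom.comp (K.demazure B M)) (fun d w => ?_) x
  change contract K.g₁ N (d • thetaMap A f w) = f (contract K.g₁ M (d • w))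
  rw [← contract_natural]
  exact congrArg (contract K.g₁ N) (LinearMap.map_smul (thetaMap A f) d w).symm

/-- The bimodule map `m ↦ β ⊗ 1 ⊗ m + α ⊗ 1 ⊗ m + 1 ⊗ 1 ⊗ α m`. -/
def Coords.casimir (_ : Coords A α β) (B : Subalgebra ℂ R) (M : Type) [AddCommGroup M]
    [Module R M] : M →+ R ⊗[B] (R ⊗[A] M) :=
  AddMonoidHom.mk' (fun m => β ⊗ₜ[B] ((1 : R) ⊗ₜ[A] m) + α ⊗ₜ[B] ((1 : R) ⊗ₜ[A] m) +
      (1 : R) ⊗ₜ[B] ((1 : R) ⊗ₜ[A] (α • m))) fun m m' => by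
    simp only [smul_add, TensorProduct.tmul_add]
    abel

theorem Coords.casimir_apply (K : Coords A α β) (m : M) :
    K.casimir B M m = β ⊗ₜ[B] ((1 : R) ⊗ₜ[A] m) + α ⊗ₜ[B] ((1 : R) ⊗ₜ[A] m) +
      (1 : R) ⊗ₜ[B] ((1 : R) ⊗ₜ[A] (α • m)) := rfl

/-- By the relation, αβ + α² = −β². So the terms where the two sides differ are β²⊗1⊗m and 1⊗β²⊗m up
to sign, and β² ∈ B passes across the tensor sign. -/
theorem Coords.casimir_gen (K : Coords A α β) (hB : Algebra.adjoin ℂ {β} = B) (m : M) :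
    K.casimir B M (α • m) = α • K.casimir B M m := by
  have hβ : β ∈ B := hB ▸ Algebra.self_mem_adjoin_singleton ℂ β
  have key : β ⊗ₜ[B] ((1 : R) ⊗ₜ[A] (α • m)) + (1 : R) ⊗ₜ[B] ((1 : R) ⊗ₜ[A] (α • α • m)) =
      (α * β) ⊗ₜ[B] ((1 : R) ⊗ₜ[A] m) + (α * α) ⊗ₜ[B] ((1 : R) ⊗ₜ[A] m) := by
    have e1 : β ⊗ₜ[B] ((1 : R) ⊗ₜ[A] (α • m)) = (1 : R) ⊗ₜ[B] ((β * α) ⊗ₜ[A] m) := by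
      rw [tmul_smul_of_mem K.gen_mem, mul_one, ← mul_one β, ← tmul_smul_of_mem hβ, smul_theta_tmul,
        mul_one]
    have e2 : (1 : R) ⊗ₜ[A] (α • α • m) = (α * α) ⊗ₜ[A] m := by
      rw [tmul_smul_of_mem K.gen_mem, tmul_smul_of_mem K.gen_mem, mul_one]
    have e3 : β * α + α * α = -(β * β) := by linear_combination K.rel
    rw [e1, e2, ← TensorProduct.tmul_add, ← TensorProduct.add_tmul, e3, ← TensorProduct.add_tmul]
    have e4 : α * β + α * α = -(β * β) := by linear_combination K.rel
    rw [e4, TensorProduct.neg_tmul, TensorProduct.neg_tmul, TensorProduct.tmul_neg]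
    have e5 : (β * β) ⊗ₜ[A] m = (β * β) • ((1 : R) ⊗ₜ[A] m) := by rw [smul_theta_tmul, mul_one]
    rw [e5, tmul_smul_of_mem₂ (B.mul_mem hβ hβ), mul_one]
  simp only [Coords.casimir_apply, smul_add, smul_theta_tmul, mul_one]
  rw [← key, tmul_smul_of_mem (A := A) K.gen_mem]
  have : (α * 1 : R) ⊗ₜ[A] m = (1 : R) ⊗ₜ[A] (α • m) := (tmul_smul_of_mem K.gen_mem 1 m).symm
  rw [this]
  abel

theorem Coords.casimir_smul (K : Coords A α β) (hB : Algebra.adjoin ℂ {β} = B) (a : A) (m : M) :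
    K.casimir B M ((a : R) • m) = (a : R) • K.casimir B M m := by
  obtain ⟨a, ha⟩ := a
  change K.casimir B M (a • m) = a • K.casimir B M m
  rw [← K.adjoin_eq] at ha
  induction ha using Algebra.adjoin_induction generalizing m with
  | mem x hx =>
    obtain rfl : x = α := hx
    exact K.casimir_gen hB m
  | algebraMap z =>
    have hA : algebraMap ℂ R z ∈ A := Subalgebra.algebraMap_mem _ z
    have hB : algebraMap ℂ R z ∈ B := Subalgebra.algebraMap_mem _ z
    have key : ∀ (c : R) (m : M), c ⊗ₜ[B] ((1 : R) ⊗ₜ[A] (algebraMap ℂ R z • m)) =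
        algebraMap ℂ R z • (c ⊗ₜ[B] ((1 : R) ⊗ₜ[A] m)) := fun c m => by
      rw [tmul_smul_of_mem hA, ← smul_theta_tmul, tmul_smul_of_mem₂ hB, smul_theta_tmul]
    simp only [Coords.casimir_apply, smul_comm α (algebraMap ℂ R z), key, smul_add]
  | add x y _ _ hx hy => rw [add_smul, map_add, hx, hy, add_smul]
  | mul x y _ _ hx hy => rw [mul_smul, hx, hy, mul_smul]

/-- The map `m ↦ 1 ⊗ 1 ⊗ 1 ⊗ m`. -/
def insTriple (A B : Subalgebra ℂ R) (M : Type) [AddCommGroup M] [Module R M] :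
    M →+ R ⊗[A] (R ⊗[B] (R ⊗[A] M)) :=
  (insTmul A _ 1).comp ((insTmul B _ 1).comp (insTmul A M 1))

theorem insTriple_smul (z : (⊥ : Subalgebra ℂ R)) (m : M) :
    insTriple A B M ((z : R) • m) = (z : R) • insTriple A B M m := by
  have hz : ∀ A : Subalgebra ℂ R, (z : R) ∈ A := fun A => (bot_le : ⊥ ≤ A) z.2
  simp only [insTriple, AddMonoidHom.comp_apply, insTmul_smul (hz _)]

/-- The map `C ⊗_ℂ M → C ⊗_A C ⊗_B C ⊗_A M`. -/
def fromBot (A B : Subalgebra ℂ R) (M : Type) [AddCommGroup M] [Module R M] :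
    R ⊗[(⊥ : Subalgebra ℂ R)] M →ₗ[R] R ⊗[A] (R ⊗[B] (R ⊗[A] M)) :=
  indLift ⊥ (insTriple A B M) insTriple_smul

theorem fromBot_tmul (r : R) (m : M) :
    fromBot A B M (r ⊗ₜ m) = r ⊗ₜ[A] ((1 : R) ⊗ₜ[B] ((1 : R) ⊗ₜ[A] m)) := by
  change r • ((1 : R) ⊗ₜ[A] ((1 : R) ⊗ₜ[B] ((1 : R) ⊗ₜ[A] m))) = _
  rw [smul_theta_tmul, mul_one]

/-- The normalisation that makes `fromBotNat` a section of `toBotNat`. -/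
theorem Coords.bott_one (K : Coords A α β) (hB : Algebra.adjoin ℂ {β} = B) (m : M) :
    K.bott hB M ((1 : R) ⊗ₜ[B] ((1 : R) ⊗ₜ[A] m)) = (1 : R) ⊗ₜ m := by
  rw [Coords.bott_tmul, Coords.bottFun]
  simp only [contract_tmul, K.g₀_one, K.g₁_one, OneMemClass.coe_one, one_smul,
    ZeroMemClass.coe_zero, zero_smul, smul_zero, mul_zero, TensorProduct.tmul_zero,
    TensorProduct.zero_tmul, add_zero, sub_zero]

/-- The two composites are complementary: one factors through θ_{sts}, the other through θ_A, and
together they give the identity of θ_Aθ_Bθ_A on the generating elements 1 ⊗ x. The proof expands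
both sides in the coordinates of d and w. -/
theorem Coords.total (K : Coords A α β) (hB : Algebra.adjoin ℂ {β} = B)
    (x : R ⊗[B] (R ⊗[A] M)) :
    fromBot A B M (K.bott hB M x) + (1 : R) ⊗ₜ[A] K.casimir B M (K.demazure B M x) =
      (1 : R) ⊗ₜ[A] x := by
  have hβ : β ∈ B := hB ▸ Algebra.self_mem_adjoin_singleton ℂ β
  refine ind_ext (f := (fromBot A B M).toAddMonoidHom.comp (K.bott hB M) +
    (insTmul A _ 1).comp ((K.casimir B M).comp (K.demazure B M)))
    (g := insTmul A (R ⊗[B] (R ⊗[A] M)) 1) (fun d w => ?_) x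
  change fromBot A B M (K.bottFun d w) + (1 : R) ⊗ₜ[A] K.casimir B M (K.demazure B M (d ⊗ₜ w)) =
    (1 : R) ⊗ₜ[A] (d ⊗ₜ w)
  have cas : ∀ a ∈ A, ∀ m : M, (1 : R) ⊗ₜ[A] K.casimir B M (a • m) =
      a ⊗ₜ[A] (β ⊗ₜ[B] ((1 : R) ⊗ₜ[A] m)) + (a * α) ⊗ₜ[A] ((1 : R) ⊗ₜ[B] ((1 : R) ⊗ₜ[A] m)) +
        a ⊗ₜ[A] ((1 : R) ⊗ₜ[B] ((1 : R) ⊗ₜ[A] (α • m))) := fun a ha m => by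
    rw [K.casimir_smul hB ⟨a, ha⟩, tmul_smul_of_mem₃ ha, K.casimir_apply, TensorProduct.tmul_add,
      TensorProduct.tmul_add, mul_one]
    have : α ⊗ₜ[B] ((1 : R) ⊗ₜ[A] m) = α • ((1 : R) ⊗ₜ[B] ((1 : R) ⊗ₜ[A] m)) := by
      rw [smul_theta_tmul, mul_one]
    rw [this, tmul_smul_of_mem₃ K.gen_mem, mul_comm α]
  -- Normal form: elements of A are moved to the outer factor, β of the inner factor is moved left
  -- across B, and the resulting β² is reduced, so that the middle factor is 1 or β.
  have rhs : (1 : R) ⊗ₜ[A] (d ⊗ₜ[B] w) =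
      (K.g₀ d : R) ⊗ₜ[A] ((1 : R) ⊗ₜ[B] ((1 : R) ⊗ₜ[A] contract K.g₀ M w)) +
      (K.g₀ d : R) ⊗ₜ[A] (β ⊗ₜ[B] ((1 : R) ⊗ₜ[A] contract K.g₁ M w)) +
      (K.g₁ d : R) ⊗ₜ[A] (β ⊗ₜ[B] ((1 : R) ⊗ₜ[A] contract K.g₀ M w)) -
      ((K.g₁ d : R) * α) ⊗ₜ[A] (β ⊗ₜ[B] ((1 : R) ⊗ₜ[A] contract K.g₁ M w)) -
      ((K.g₁ d : R) * α * α) ⊗ₜ[A] ((1 : R) ⊗ₜ[B] ((1 : R) ⊗ₜ[A] contract K.g₁ M w)) := by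
    have e1 : d ⊗ₜ[B] w = (K.g₀ d : R) • ((1 : R) ⊗ₜ[B] w) + (K.g₁ d : R) • (β ⊗ₜ[B] w) := by
      rw [smul_theta_tmul, smul_theta_tmul, ← TensorProduct.add_tmul, mul_one, K.decomp]
    rw [e1, TensorProduct.tmul_add, tmul_smul_of_mem₃ (K.g₀ d).2, tmul_smul_of_mem₃ (K.g₁ d).2,
      mul_one, mul_one]
    have e2 : ∀ c : R, c ⊗ₜ[B] w = c ⊗ₜ[B] ((1 : R) ⊗ₜ[A] contract K.g₀ M w) +
        (c * β) ⊗ₜ[B] ((1 : R) ⊗ₜ[A] contract K.g₁ M w) := by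
      intro c
      conv_lhs => rw [← K.contract_decomp w, TensorProduct.tmul_add]
      congr 1
      rw [mul_comm, ← tmul_smul_of_mem₂ hβ, smul_theta_tmul, mul_one]
    have e3 : (β * β) ⊗ₜ[B] ((1 : R) ⊗ₜ[A] contract K.g₁ M w) =
        -(α • (β ⊗ₜ[B] ((1 : R) ⊗ₜ[A] contract K.g₁ M w))) -
        α • α • ((1 : R) ⊗ₜ[B] ((1 : R) ⊗ₜ[A] contract K.g₁ M w)) := by
      rw [smul_theta_tmul, smul_theta_tmul, smul_theta_tmul, ← TensorProduct.neg_tmul,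
        ← TensorProduct.sub_tmul]
      congr 1
      linear_combination K.rel
    rw [e2 1, e2 β, e3, one_mul]
    simp only [TensorProduct.tmul_add, TensorProduct.tmul_sub, TensorProduct.tmul_neg,
      tmul_smul_of_mem₃ K.gen_mem]
    rw [mul_comm α (K.g₁ d : R), mul_comm α ((K.g₁ d : R) * α)]
    abel
  rw [rhs, K.demazure_tmul, map_sub, map_add, TensorProduct.tmul_sub, TensorProduct.tmul_add,
    cas _ (K.g₀ d).2, cas _ (K.g₁ d).2, cas _ (A.mul_mem (K.g₁ d).2 K.gen_mem)]
  simp only [Coords.bottFun, map_add, map_sub, fromBot_tmul, mul_comm α]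
  abel

end BottSamelson

section Bundled

variable {R : Type} [CommRing R] [Algebra ℂ R] [Module.Finite ℂ R]
  {A B : Subalgebra ℂ R} {α β : R}

/-- The projection `θ_A θ_B θ_A ⟶ θ_{sts}`. -/
def Coords.toBotNat (K : Coords A α β) (hB : Algebra.adjoin ℂ {β} = B) :
    (theta A ⋙ theta B) ⋙ theta A ⟶ theta ⊥ :=
  natIndLift A (F := theta A ⋙ theta B) (G := theta ⊥) (fun X => K.bott hB X)
    (fun _ => K.bott_smul hB) (fun _ _ f => K.bott_natural hB f.hom.hom)

/-- The inclusion `θ_{sts} ⟶ θ_A θ_B θ_A`. -/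
def fromBotNat (A B : Subalgebra ℂ R) : theta ⊥ ⟶ (theta A ⋙ theta B) ⋙ theta A :=
  natIndLift ⊥ (F := 𝟭 _) (G := (theta A ⋙ theta B) ⋙ theta A) (fun X => insTriple A B X)
    (fun _ => insTriple_smul) (fun _ _ _ _ => rfl)

/-- The projection `θ_A θ_B θ_A ⟶ θ_A`. -/
def Coords.demazureNat (K : Coords A α β) (B : Subalgebra ℂ R) :
    (theta A ⋙ theta B) ⋙ theta A ⟶ theta A :=
  natIndMap A (F := theta A ⋙ theta B) (G := 𝟭 _) (fun X => K.demazure B X)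
    (fun _ => K.demazure_smul) (fun _ _ f => K.demazure_natural f.hom.hom)

/-- The inclusion `θ_A ⟶ θ_A θ_B θ_A`. -/
def Coords.casimirNat (K : Coords A α β) (hB : Algebra.adjoin ℂ {β} = B) :
    theta A ⟶ (theta A ⋙ theta B) ⋙ theta A :=
  natIndMap A (F := 𝟭 _) (G := theta A ⋙ theta B) (fun X => K.casimir B X)
    (fun _ => K.casimir_smul hB) (fun X Y f (x : X) => by
      change K.casimir B Y (f.hom.hom x) = thetaMap B (thetaMap A f.hom.hom) (K.casimir B X x)
      simp only [Coords.casimir_apply, map_add]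
      rw [← map_smul]
      rfl)

/-- `θ_{sts}` is a direct summand of `θ_A θ_B θ_A`. -/
def Coords.retractBot (K : Coords A α β) (hB : Algebra.adjoin ℂ {β} = B) :
    Retract (theta (⊥ : Subalgebra ℂ R)) ((theta A ⋙ theta B) ⋙ theta A) where
  i := fromBotNat A B
  r := K.toBotNat hB
  retract := by
    refine nat_ext fun X => ind_ext_one fun x => ?_
    have e : ((fromBotNat A B).app X).hom.hom ((1 : R) ⊗ₜ x) = insTriple A B X x :=
      one_smul R (insTriple A B X x)
    exact (congrArg ((K.toBotNat hB).app X).hom.hom e).trans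
      ((one_smul R (K.bott hB X ((1 : R) ⊗ₜ[B] ((1 : R) ⊗ₜ[A] x)))).trans (K.bott_one hB x))

/-- `θ_A θ_B θ_A` is a direct sum of `θ_{sts}` and `θ_A`. -/
theorem Coords.dominated_triple (K : Coords A α β) (hB : Algebra.adjoin ℂ {β} = B) :
    Dominated (fun F => F = theta ⊥ ∨ F = theta A) ((theta A ⋙ theta B) ⋙ theta A) := by
  refine Dominated.biprod (K.toBotNat hB) (fromBotNat A B) (K.demazureNat B) (K.casimirNat hB)
    ?_ (Dominated.of (Or.inl rfl)) (Dominated.of (Or.inr rfl))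
  refine nat_ext fun X => ind_ext_one fun x => ?_
  have e1 : ((K.toBotNat hB ≫ fromBotNat A B).app X).hom.hom ((1 : R) ⊗ₜ[A] x) =
      fromBot A B X (K.bott hB X x) :=
    congrArg (fromBot A B X) (one_smul R _)
  have e2 : ((K.demazureNat B ≫ K.casimirNat hB).app X).hom.hom ((1 : R) ⊗ₜ[A] x) =
      (1 : R) ⊗ₜ[A] K.casimir B X (K.demazure B X x) :=
    (congrArg (indMap A (K.casimir B X) (K.casimir_smul hB))
      (indMap_tmul A (K.demazure B X) K.demazure_smul 1 x)).trans
      (indMap_tmul A (K.casimir B X) (K.casimir_smul hB) 1 (K.demazure B X x))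
  refine (congrArg₂ (· + ·) e1 e2).trans ?_
  exact K.total hB x

end Bundled

end SoergelA2

end

noncomputable section

namespace SoergelA2

/-! ### Every 1-morphism is dominated by the six functors θ_w -/

section DualBases

variable {R : Type} [CommRing R] [Algebra ℂ R]

/-- The dual basis of coordinates. -/
def Coords.dualBasis {A : Subalgebra ℂ R} {α β : R} (K : Coords A α β) : DualBasis A where
  ι := Fin 2
  e := ![1, β]
  φ := ![K.g₀, K.g₁]
  total r := by
    rw [Fin.sum_univ_two]
    simpa using K.decomp r

/-- A dual basis over the scalars. -/
def botDualBasis [Module.Finite ℂ R] [Nontrivial R] : DualBasis (⊥ : Subalgebra ℂ R) :=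
  let b := (Module.finBasis ℂ R).mapCoeffs (Algebra.botEquiv ℂ R).symm.toRingEquiv fun z r => by
    change algebraMap ℂ R z * r = _
    rw [Algebra.smul_def]
  { ι := Fin (Module.finrank ℂ R)
    e := b
    φ := b.coord
    total := fun r => b.sum_repr r }

end DualBases

section Basic

/-- The five functors `θ_w` with `w ≠ e`. -/
def IsBasicPos : ObjectProperty (ModC ⥤ ModC) := fun F =>
  F = thetaS ∨ F = thetaT ∨ F = thetaT ⋙ thetaS ∨ F = thetaS ⋙ thetaT ∨ F = thetaSTS

/-- The six functors `θ_w`. -/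
def IsBasic : ObjectProperty (ModC ⥤ ModC) := fun F => F = 𝟭 ModC ∨ IsBasicPos F

/-- θ_{sts} is a direct summand of θ_sθ_tθ_s. -/
theorem thetaSTS_isSoergel : IsSoergel thetaSTS :=
  IsSoergel.retract (coordsS.retractBot coordsT.adjoin_eq)
    (IsSoergel.comp IsSoergel.theta_s (IsSoergel.comp IsSoergel.theta_t IsSoergel.theta_s))

theorem IsBasic.isSoergel {F : ModC ⥤ ModC} (h : IsBasic F) : IsSoergel F := by
  rcases h with rfl | rfl | rfl | rfl | rfl | rfl
  exacts [.id, .theta_s, .theta_t, .comp .theta_s .theta_t, .comp .theta_t .theta_s,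
    thetaSTS_isSoergel]

theorem dominated_precomp {P Q : ObjectProperty (ModC ⥤ ModC)} (F : ModC ⥤ ModC)
    {G : ModC ⥤ ModC} (h : Dominated P G) (hPQ : ∀ K, P K → Dominated Q (F ⋙ K)) :
    Dominated Q (F ⋙ G) := by
  have : ((Functor.whiskeringLeft ModC ModC ModC).obj F).Additive := ⟨rfl⟩
  exact h.map ((Functor.whiskeringLeft ModC ModC ModC).obj F) hPQ

theorem dominated_postcomp {P Q : ObjectProperty (ModC ⥤ ModC)} (F : ModC ⥤ ModC) [F.Additive]
    {G : ModC ⥤ ModC} (h : Dominated P G) (hPQ : ∀ K, P K → Dominated Q (K ⋙ F)) :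
    Dominated Q (G ⋙ F) := by
  have : ((Functor.whiskeringRight ModC ModC ModC).obj F).Additive := ⟨by
    intro X Y f g
    ext Z : 2
    exact F.map_add⟩
  exact h.map ((Functor.whiskeringRight ModC ModC ModC).obj F) hPQ

theorem dominated_theta_theta {A : Subalgebra ℂ Coinv} (D : DualBasis A) :
    Dominated (· = theta A) (theta A ⋙ theta A) := dominated_theta_comp_left le_rfl D

/-- Left multiplication by `θ_A` on the functors `θ_w`. -/
theorem dominated_comp_theta {A B : Subalgebra ℂ Coinv} {α β : Coinv} (K : Coords A α β)
    (hB : Algebra.adjoin ℂ {β} = B) {P : ObjectProperty (ModC ⥤ ModC)}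
    (h1 : P (theta A)) (h2 : P (theta B ⋙ theta A)) (h3 : P (theta ⊥)) {G : ModC ⥤ ModC}
    (hG : G = 𝟭 ModC ∨ G = theta A ∨ G = theta B ∨ G = theta B ⋙ theta A ∨
      G = theta A ⋙ theta B ∨ G = theta ⊥) : Dominated P (G ⋙ theta A) := by
  have hid : Dominated P (theta A ⋙ theta A) := (dominated_theta_theta K.dualBasis).mono (by
    rintro _ rfl
    exact h1)
  rcases hG with rfl | rfl | rfl | rfl | rfl | rfl
  · exact Dominated.of h1
  · exact hid
  · exact Dominated.of h2
  · exact dominated_precomp (theta B) (dominated_theta_theta K.dualBasis) (by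
      rintro _ rfl
      exact Dominated.of h2)
  · exact (K.dominated_triple hB).mono (by
      rintro _ (rfl | rfl)
      exacts [h3, h1])
  · exact (dominated_theta_comp_right bot_le K.dualBasis).mono (by
      rintro _ rfl
      exact h3)

/-- The first two parts are the table `dominated_comp_theta` with the roles of s and t exchanged. In
the third, θ_{sts} absorbs θ_s and θ_t because C is free over their invariants. -/
theorem IsBasic.comp_theta {G : ModC ⥤ ModC} (hG : IsBasic G) :
    Dominated IsBasic (G ⋙ thetaS) ∧ Dominated IsBasic (G ⋙ thetaT) ∧
      Dominated IsBasic (G ⋙ thetaSTS) := by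
  refine ⟨dominated_comp_theta coordsS coordsT.adjoin_eq (Or.inr (Or.inl rfl))
      (Or.inr (Or.inr (Or.inr (Or.inl rfl)))) (Or.inr (Or.inr (Or.inr (Or.inr (Or.inr rfl))))) hG,
    dominated_comp_theta coordsT coordsS.adjoin_eq (Or.inr (Or.inr (Or.inl rfl)))
      (Or.inr (Or.inr (Or.inr (Or.inr (Or.inl rfl)))))
      (Or.inr (Or.inr (Or.inr (Or.inr (Or.inr rfl))))) ?_, ?_⟩
  · unfold IsBasic IsBasicPos at hG
    tauto
  · have h6 : ∀ F, F = thetaSTS → Dominated IsBasic F := by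
      rintro _ rfl
      exact Dominated.of (Or.inr (Or.inr (Or.inr (Or.inr (Or.inr rfl)))))
    have hS : Dominated (· = thetaSTS) (thetaS ⋙ thetaSTS) :=
      dominated_theta_comp_left bot_le coordsS.dualBasis
    have hT : Dominated (· = thetaSTS) (thetaT ⋙ thetaSTS) :=
      dominated_theta_comp_left bot_le coordsT.dualBasis
    rcases hG with rfl | rfl | rfl | rfl | rfl | rfl
    · exact h6 _ rfl
    · exact hS.trans h6
    · exact hT.trans h6
    · refine dominated_precomp thetaT hS ?_
      rintro _ rfl
      exact hT.trans h6
    · refine dominated_precomp thetaS hT ?_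
      rintro _ rfl
      exact hS.trans h6
    · exact Dominated.trans (dominated_theta_theta (A := ⊥) botDualBasis) h6

theorem IsBasic.comp {F G : ModC ⥤ ModC} (hF : IsBasic F) (hG : IsBasic G) :
    Dominated IsBasic (G ⋙ F) := by
  have : thetaS.Additive := theta_additive _
  have : thetaT.Additive := theta_additive _
  rcases hF with rfl | rfl | rfl | rfl | rfl | rfl
  · exact Dominated.of hG
  · exact hG.comp_theta.1
  · exact hG.comp_theta.2.1
  · exact dominated_postcomp thetaS hG.comp_theta.2.1 fun K hK => hK.comp_theta.1
  · exact dominated_postcomp thetaT hG.comp_theta.1 fun K hK => hK.comp_theta.2.1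
  · exact hG.comp_theta.2.2

/-- Domination passes through every constructor of `IsSoergel`; composition is the only one that
needs the multiplication table `IsBasic.comp`. -/
theorem IsSoergel.dominated {F : ModC ⥤ ModC} (h : IsSoergel F) : Dominated IsBasic F := by
  induction h with
  | id => exact Dominated.of (Or.inl rfl)
  | theta_s => exact Dominated.of (Or.inr (Or.inl rfl))
  | theta_t => exact Dominated.of (Or.inr (Or.inr (Or.inl rfl)))
  | @comp F G _ _ hF hG =>
    refine dominated_precomp G hF fun K hK => ?_
    have := hK.isSoergel.additive_linear.1
    exact dominated_postcomp K hG fun L hL => hK.comp hL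
  | biprod b hb _ _ hF hG => exact Dominated.bicone hb hF hG
  | retract r _ hG => exact hG.retract r

theorem Dominated.fullSubcategory {A : Type*} [Category A] [Preadditive A]
    {P Q : ObjectProperty A} (hQP : Q ≤ P) {X : P.FullSubcategory} (h : Dominated Q X.obj) :
    Dominated (fun Y : P.FullSubcategory => Q Y.obj) X := by
  obtain ⟨ι, _, G, p, q, hG, e⟩ := h
  refine ⟨ι, inferInstance, fun i => ⟨G i, hQP _ (hG i)⟩, fun i => ObjectProperty.homMk (p i),
    fun i => ObjectProperty.homMk (q i), hG, ?_⟩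
  refine P.ι.map_injective ?_
  rw [Functor.map_sum]
  exact e

theorem S.dominated (F : S) : Dominated (fun G : S => IsBasic G.obj) F :=
  Dominated.fullSubcategory (fun _ h => h.isSoergel) F.property.dominated

end Basic

/-! ### Cyclic bimodules and the indecomposable 1-morphisms -/

section Cyclic

/-- `C` as an object of `C`-mod. -/
abbrev regC : ModC := FGModuleCat.of Coinv Coinv

/-- The map `C → X` with `1 ↦ x`. -/
def orbitMap {X : ModC} (x : X) : regC ⟶ X := FGModuleCat.ofHom (LinearMap.toSpanSingleton Coinv X x)

/-- `g` generates the bimodule of `F`. -/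
def IsGenerator (F : ModC ⥤ ModC) (g : F.obj regC) : Prop :=
  ∀ (X : ModC) (y : F.obj X),
    y ∈ Submodule.span Coinv (Set.range fun x : X => (F.map (orbitMap x)).hom.hom g)

theorem isGenerator_id : IsGenerator (𝟭 ModC) (1 : Coinv) := fun X y => by
  refine Submodule.subset_span ⟨y, ?_⟩
  exact one_smul Coinv y

theorem isGenerator_theta (A : Subalgebra ℂ Coinv) :
    IsGenerator (theta A) ((1 : Coinv) ⊗ₜ[A] (1 : Coinv)) := fun X y => by
  have key : ∀ y : Coinv ⊗[A] X, y ∈ Submodule.span Coinv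
      (Set.range fun x : X => thetaMap A (LinearMap.toSpanSingleton Coinv X x) (1 ⊗ₜ[A] 1)) := by
    intro y
    induction y using TensorProduct.induction_on with
    | zero => exact Submodule.zero_mem _
    | add y z hy hz => exact Submodule.add_mem _ hy hz
    | tmul r x =>
      have : r ⊗ₜ[A] x = r • thetaMap A (LinearMap.toSpanSingleton Coinv X x) (1 ⊗ₜ[A] 1) := by
        rw [thetaMap_tmul, smul_theta_tmul, mul_one, LinearMap.toSpanSingleton_apply, one_smul]
      rw [this]
      exact Submodule.smul_mem _ _ (Submodule.subset_span ⟨x, rfl⟩)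
  exact key y

/-- The inner factor can be emptied: its A-coefficients move left, and the basis vectors, lying in
B, move right onto X. For θ_sθ_t this applies because the basis 1, x of C over C^s lies in C^t;
likewise 1, z for θ_tθ_s. -/
theorem isGenerator_theta_theta {A B : Subalgebra ℂ Coinv} (D : DualBasis A)
    (hD : ∀ i, D.e i ∈ B) :
    IsGenerator (theta B ⋙ theta A) ((1 : Coinv) ⊗ₜ[A] ((1 : Coinv) ⊗ₜ[B] (1 : Coinv))) :=
  fun X y => by
  have key : ∀ y : Coinv ⊗[A] (Coinv ⊗[B] X), y ∈ Submodule.span Coinv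
      (Set.range fun x : X => thetaMap A (thetaMap B (LinearMap.toSpanSingleton Coinv X x))
        (1 ⊗ₜ[A] (1 ⊗ₜ[B] 1))) := by
    intro y
    induction y using TensorProduct.induction_on with
    | zero => exact Submodule.zero_mem _
    | add y z hy hz => exact Submodule.add_mem _ hy hz
    | tmul r w =>
      induction w using TensorProduct.induction_on with
      | zero => rw [TensorProduct.tmul_zero]; exact Submodule.zero_mem _
      | add y z hy hz => rw [TensorProduct.tmul_add]; exact Submodule.add_mem _ hy hz
      | tmul r' x =>
        have e1 : r' ⊗ₜ[B] x = ∑ i, (D.φ i r' : Coinv) • ((1 : Coinv) ⊗ₜ[B] (D.e i • x)) := by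
          conv_lhs => rw [← D.total r', TensorProduct.sum_tmul]
          refine Finset.sum_congr rfl fun i _ => ?_
          rw [tmul_smul_of_mem (hD i), smul_theta_tmul, mul_one]
        rw [e1, TensorProduct.tmul_sum]
        refine Submodule.sum_mem _ fun i _ => ?_
        have : r ⊗ₜ[A] ((D.φ i r' : Coinv) • ((1 : Coinv) ⊗ₜ[B] (D.e i • x))) =
            ((D.φ i r' : Coinv) * r) • thetaMap A (thetaMap B
              (LinearMap.toSpanSingleton Coinv X (D.e i • x))) (1 ⊗ₜ[A] (1 ⊗ₜ[B] 1)) := by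
          rw [tmul_smul_of_mem₂ (D.φ i r').2, thetaMap_tmul, thetaMap_tmul, smul_theta_tmul,
            mul_one, LinearMap.toSpanSingleton_apply, one_smul]
        rw [this]
        exact Submodule.smul_mem _ _ (Submodule.subset_span ⟨D.e i • x, rfl⟩)
  exact key y

theorem IsBasic.exists_generator {F : ModC ⥤ ModC} (h : IsBasic F) : ∃ g, IsGenerator F g := by
  have mS : coord 2 ∈ invS := coordsS.gen_mem
  have mT : coord 0 ∈ invT := coordsT.gen_mem
  rcases h with rfl | rfl | rfl | rfl | rfl | rfl
  · exact ⟨_, isGenerator_id⟩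
  · exact ⟨_, isGenerator_theta _⟩
  · exact ⟨_, isGenerator_theta _⟩
  · refine ⟨_, isGenerator_theta_theta (A := invS) (B := invT) coordsS.dualBasis fun i => ?_⟩
    fin_cases i
    exacts [Subalgebra.one_mem _, mT]
  · refine ⟨_, isGenerator_theta_theta (A := invT) (B := invS) coordsT.dualBasis fun i => ?_⟩
    fin_cases i
    exacts [Subalgebra.one_mem _, mS]
  · exact ⟨_, isGenerator_theta _⟩

/-- Multiplication by a scalar. -/
def scalarEnd (X : ModC) (c : Coinv) : X ⟶ X := FGModuleCat.ofHom (LinearMap.lsmul Coinv X c)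

theorem scalarEnd_apply {X : ModC} (c : Coinv) (x : X) : (scalarEnd X c).hom.hom x = c • x := rfl

/-- The action of `C` on `F` by multiplication on the target. -/
def leftMul (F : ModC ⥤ ModC) : Coinv →+* End F where
  toFun c := mkNat (fun X => LinearMap.lsmul Coinv (F.obj X) c) fun X Y f => by
    ext x
    exact ((F.map f).hom.hom.map_smul c x).symm
  map_one' := nat_ext fun X => LinearMap.ext fun x => one_smul Coinv x
  map_zero' := nat_ext fun X => LinearMap.ext fun x => zero_smul Coinv x
  map_add' c d := nat_ext fun X => LinearMap.ext fun x => add_smul c d x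
  map_mul' c d := nat_ext fun X => LinearMap.ext fun x => mul_smul c d x

/-- The action of `C` on `F` by multiplication on the source. -/
def rightMul (F : ModC ⥤ ModC) [F.Additive] : Coinv →+* End F where
  toFun c :=
    { app := fun X => F.map (scalarEnd X c)
      naturality := fun X Y f => by
        rw [← F.map_comp, ← F.map_comp]
        congr 1
        refine FGModuleCat.hom_ext (LinearMap.ext fun x => ?_)
        exact (f.hom.hom.map_smul c x).symm }
  map_one' := by
    refine NatTrans.ext (funext fun X => ?_)
    refine Eq.trans ?_ (F.map_id X)
    exact congrArg F.map (FGModuleCat.hom_ext (LinearMap.ext fun x => one_smul Coinv x))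
  map_zero' := by
    refine NatTrans.ext (funext fun X => ?_)
    refine Eq.trans ?_ (F.map_zero X X)
    exact congrArg F.map (FGModuleCat.hom_ext (LinearMap.ext fun x => zero_smul Coinv x))
  map_add' c d := by
    refine NatTrans.ext (funext fun X => ?_)
    refine Eq.trans ?_ (F.map_add (f := scalarEnd X c) (g := scalarEnd X d))
    exact congrArg F.map (FGModuleCat.hom_ext (LinearMap.ext fun x => add_smul c d x))
  map_mul' c d := by
    refine NatTrans.ext (funext fun X => ?_)
    refine Eq.trans ?_ (F.map_comp (scalarEnd X d) (scalarEnd X c))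
    exact congrArg F.map (FGModuleCat.hom_ext (LinearMap.ext fun x => mul_smul c d x))

/-- Naturality along the orbit maps C → X determines a transformation on a spanning set of F(X) from
its value at g. -/
theorem IsGenerator.nat_ext {F G : ModC ⥤ ModC} {g : F.obj regC} (hg : IsGenerator F g)
    {σ τ : F ⟶ G} (h : (σ.app regC).hom.hom g = (τ.app regC).hom.hom g) : σ = τ := by
  refine SoergelA2.nat_ext fun X => LinearMap.ext fun y => ?_
  refine Submodule.span_induction (p := fun y _ => (σ.app X).hom.hom y = (τ.app X).hom.hom y)
    ?_ (by rw [map_zero, map_zero]) (fun y z _ _ hy hz => by rw [map_add, map_add, hy, hz])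
    (fun c y _ hy => by rw [map_smul, map_smul, hy]) (hg X y)
  rintro _ ⟨x, rfl⟩
  have nat : ∀ τ : F ⟶ G, (τ.app X).hom.hom ((F.map (orbitMap x)).hom.hom g) =
      (G.map (orbitMap x)).hom.hom ((τ.app regC).hom.hom g) := fun τ =>
    congrArg (fun f => f.hom.hom g) (τ.naturality (orbitMap x))
  exact (nat σ).trans ((congrArg _ h).trans (nat τ).symm)

/-- The action of `C ⊗ C` on the functor of a bimodule. -/
def bimoduleAct (F : ModC ⥤ ModC) [F.Additive] [F.Linear ℂ] : Coinv ⊗[ℂ] Coinv →ₐ[ℂ] End F :=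
  Algebra.TensorProduct.lift
    (AlgHom.mk (leftMul F) fun z => SoergelA2.nat_ext fun X => LinearMap.ext fun x => rfl)
    (AlgHom.mk (rightMul F) fun z => NatTrans.ext (funext fun X => by
      refine Eq.trans ?_ (congrArg (z • ·) (F.map_id X))
      exact CategoryTheory.Functor.Linear.map_smul (F := F) (𝟙 X) z))
    fun c d => NatTrans.ext (funext fun X => ((leftMul F c).naturality (scalarEnd X d)))

theorem bimoduleAct_tmul (F : ModC ⥤ ModC) [F.Additive] [F.Linear ℂ] (c d : Coinv) :
    bimoduleAct F (c ⊗ₜ d) = leftMul F c * rightMul F d :=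
  Algebra.TensorProduct.lift_tmul _ _ _ _ _

/-- The elements F(·d)(g) span F(C) over C, so every element of F(C) has the form t·g with t ∈ C ⊗
C. Choosing t for the value σ(g) makes its action agree with σ at g, hence everywhere. -/
theorem IsGenerator.bimoduleAct_surjective {F : ModC ⥤ ModC} [F.Additive] [F.Linear ℂ]
    {g : F.obj regC} (hg : IsGenerator F g) : Function.Surjective (bimoduleAct F) := by
  have key : ∀ y : F.obj regC, ∃ t : Coinv ⊗[ℂ] Coinv,
      (NatTrans.app (bimoduleAct F t) regC).hom.hom g = y := by
    intro y
    refine Submodule.span_induction (p := fun y _ => ∃ t : Coinv ⊗[ℂ] Coinv,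
      (NatTrans.app (bimoduleAct F t) regC).hom.hom g = y) ?_ ?_ ?_ ?_ (hg regC y)
    · rintro _ ⟨d, rfl⟩
      refine ⟨1 ⊗ₜ d, ?_⟩
      rw [bimoduleAct_tmul, map_one, one_mul]
      refine congrArg (fun f => (F.map f).hom.hom g)
        (FGModuleCat.hom_ext (LinearMap.ext fun x => mul_comm _ _))
    · exact ⟨0, by rw [map_zero]; rfl⟩
    · rintro _ _ _ _ ⟨t, rfl⟩ ⟨t', rfl⟩
      exact ⟨t + t', by rw [map_add]; rfl⟩
    · rintro c _ _ ⟨t, rfl⟩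
      refine ⟨c ⊗ₜ 1 * t, ?_⟩
      rw [map_mul, bimoduleAct_tmul, map_one, mul_one]
      rfl
  intro σ
  obtain ⟨t, ht⟩ := key ((NatTrans.app σ regC).hom.hom g)
  exact ⟨t, hg.nat_ext ht⟩

/-- Multiplication C ⊗_A X → X takes the value 1; this serves only to show that the functor is
nonzero. -/
theorem IsBasic.exists_map_nonzero {F : ModC ⥤ ModC} (h : IsBasic F) :
    ∃ (τ : F ⟶ 𝟭 ModC) (g : F.obj regC), (τ.app regC).hom.hom g = (1 : Coinv) := by
  have key : ∀ A : Subalgebra ℂ Coinv, ∃ (τ : theta A ⟶ 𝟭 ModC), ∀ (X : ModC) (x : X),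
      (τ.app X).hom.hom ((1 : Coinv) ⊗ₜ[A] x) = x := fun A =>
    ⟨natIndLift A (F := 𝟭 ModC) (G := 𝟭 ModC) (fun X => AddMonoidHom.id X) (fun _ _ _ => rfl)
      (fun _ _ _ _ => rfl), fun X x => one_smul Coinv x⟩
  have key₂ : ∀ A B : Subalgebra ℂ Coinv, ∃ (τ : theta A ⋙ theta B ⟶ 𝟭 ModC)
      (g : (theta A ⋙ theta B).obj regC), (τ.app regC).hom.hom g = (1 : Coinv) := fun A B => by
    obtain ⟨σ, hσ⟩ := key A
    obtain ⟨τ, hτ⟩ := key B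
    refine ⟨Functor.whiskerLeft (theta A) τ ≫ σ, (1 : Coinv) ⊗ₜ[B] ((1 : Coinv) ⊗ₜ[A] (1 : Coinv)), ?_⟩
    exact (congrArg (σ.app regC).hom.hom (hτ ((theta A).obj regC) _)).trans (hσ regC _)
  rcases h with rfl | rfl | rfl | rfl | rfl | rfl
  · exact ⟨𝟙 _, (1 : Coinv), rfl⟩
  · exact ⟨_, _, (key invS).choose_spec regC (1 : Coinv)⟩
  · exact ⟨_, _, (key invT).choose_spec regC (1 : Coinv)⟩
  · exact key₂ _ _
  · exact key₂ _ _
  · exact ⟨_, _, (key ⊥).choose_spec regC (1 : Coinv)⟩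

/-- The ring is a nonzero quotient of C ⊗ C, in which every element is a scalar plus a nilpotent. -/
theorem IsBasic.isLocalRing {F : S} (h : IsBasic F.obj) : IsLocalRing (End F) := by
  obtain ⟨g, hg⟩ := h.exists_generator
  let φ : End F.obj →+* End F :=
    { toFun := fun f => ObjectProperty.homMk f
      map_one' := rfl
      map_mul' := fun _ _ => rfl
      map_zero' := rfl
      map_add' := fun _ _ => rfl }
  have hφ : Function.Surjective φ := fun f => ⟨f.hom, rfl⟩
  have : Nontrivial (End F) := by
    refine ⟨⟨0, 1, fun h01 => ?_⟩⟩
    obtain ⟨τ, g, hg⟩ := h.exists_map_nonzero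
    have h0 : (0 : F.obj ⟶ F.obj) = 𝟙 F.obj := congrArg InducedCategory.Hom.hom h01
    have h1 : g = 0 := (congrArg (fun f : F.obj ⟶ F.obj => (NatTrans.app f regC).hom.hom g) h0).symm
    rw [h1, map_zero] at hg
    exact zero_ne_one (α := Coinv) hg
  exact (scalarNil_coinv.tensor scalarNil_coinv).isLocalRing
    (φ.comp (bimoduleAct F.obj).toRingHom) (hφ.comp hg.bimoduleAct_surjective)

instance : HasFiniteBiproducts S := by
  refine hasFiniteBiproducts_fullSubcategory ?_ fun _ _ b hb => IsSoergel.biprod b hb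
  obtain ⟨Z, hZ⟩ := HasZeroObject.zero (C := ModC ⥤ ModC)
  exact ⟨Z, hZ, IsSoergel.retract (IsZero.retract _ hZ) IsSoergel.id⟩

instance : IsIdempotentComplete S :=
  isIdempotentComplete_fullSubcategory fun _ _ r => IsSoergel.retract r

theorem S.exists_iso_basic {F : S} (hF : TwoRep.Indec F) :
    ∃ G : S, IsBasic G.obj ∧ Nonempty (F ≅ G) :=
  Indec.exists_iso (fun _ h => h.isLocalRing) F.dominated hF

end Cyclic

end SoergelA2

end

noncomputable section

namespace SoergelA2

/-! ### Projective modules, M_{a,b} and the action of the θ_w on them -/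

section AdditiveClosure

/-- Each partial sum of the composites factors through an iterated biproduct of the dominating
objects; the full sum is the identity, so `X` is a retract. -/
theorem Dominated.addClosure_of {A : Type 1} [Category.{0} A] [Preadditive A]
    [HasFiniteBiproducts A] {P : ObjectProperty A} {X : A} (h : Dominated P X) :
    AddClosure P X := by
  obtain ⟨ι, _, G, p, q, hG, e⟩ := h
  have key : ∀ s : Finset ι, ∃ (Y : A) (i : X ⟶ Y) (r : Y ⟶ X), AddClosure P Y ∧
      i ≫ r = ∑ j ∈ s, p j ≫ q j := by
    classical
    have : HasZeroObject A := hasZeroObject_of_hasFiniteBiproducts A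
    have : HasBinaryBiproducts A := hasBinaryBiproducts_of_finite_biproducts A
    intro s
    induction s using Finset.induction_on with
    | empty =>
      obtain ⟨Z, hZ⟩ := HasZeroObject.zero (C := A)
      exact ⟨Z, 0, 0, AddClosure.zero hZ, by simp⟩
    | insert a s ha ih =>
      obtain ⟨Y, i, r, hY, hir⟩ := ih
      refine ⟨G a ⊞ Y, biprod.lift (p a) i, biprod.desc (q a) r, ?_, ?_⟩
      · exact AddClosure.biprod (BinaryBiproduct.bicone (G a) Y)
          (BinaryBiproduct.isBilimit (G a) Y) (AddClosure.of (hG a)) hY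
      · rw [biprod.lift_desc, hir, Finset.sum_insert ha]
  obtain ⟨Y, i, r, hY, hir⟩ := key Finset.univ
  exact AddClosure.retract ⟨i, r, hir.trans e⟩ hY

theorem addClosure_iff_dominated {A : Type 1} [Category.{0} A] [Preadditive A]
    [HasFiniteBiproducts A] {P : ObjectProperty A} {X : A} :
    AddClosure P X ↔ Dominated P X :=
  ⟨Dominated.addClosure fun _ h => Dominated.of h, Dominated.addClosure_of⟩

end AdditiveClosure

section Modules

instance : HasFiniteBiproducts ModC := Abelian.hasFiniteBiproducts

theorem projC_iff {X : ModC} : projC X ↔ Dominated (· = regC) X := by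
  constructor
  · intro h
    have : Module.Projective Coinv X := h
    obtain ⟨n, f, hf⟩ := Module.Finite.exists_fin' Coinv X
    obtain ⟨g, hg⟩ := Module.projective_lifting_property f LinearMap.id hf
    refine ⟨Fin n, inferInstance, fun _ => regC,
      fun i => FGModuleCat.ofHom ((LinearMap.proj i : (Fin n → Coinv) →ₗ[Coinv] Coinv) ∘ₗ g),
      fun i => FGModuleCat.ofHom (f ∘ₗ (LinearMap.single Coinv (fun _ => Coinv) i)),
      fun _ => rfl, FGModuleCat.hom_ext (LinearMap.ext fun x => ?_)⟩
    refine (hom_sum_apply _ x).trans ?_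
    change ∑ i, f (Pi.single i (g x i)) = x
    rw [← map_sum, Finset.univ_sum_single]
    exact LinearMap.congr_fun hg x
  · rintro ⟨ι, _, G, p, q, hG, e⟩
    obtain rfl : G = fun _ => regC := funext hG
    let i : X →ₗ[Coinv] (ι → Coinv) := LinearMap.pi fun j => (p j).hom.hom
    let s : (ι → Coinv) →ₗ[Coinv] X := ∑ j, (q j).hom.hom ∘ₗ (LinearMap.proj j)
    refine Module.Projective.of_split i s (LinearMap.ext fun x => ?_)
    have h1 := (hom_sum_apply (fun j => p j ≫ q j) x).symm.trans
      (congrArg (fun f => f.hom.hom x) e)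
    refine Eq.trans ?_ h1
    change (∑ j, (q j).hom.hom ∘ₗ (LinearMap.proj j)) (i x) = _
    rw [LinearMap.sum_apply]
    rfl

theorem projAnd_iff {a b : ℂ} {X : ModC} :
    projAnd a b X ↔ Dominated (fun Y => Y = regC ∨ Y = quotObj a b) X := by
  refine addClosure_iff_dominated.trans ⟨fun h => h.trans ?_, fun h => h.mono ?_⟩
  · rintro G (hG | rfl)
    · exact (projC_iff.1 hG).mono fun _ h => Or.inl h
    · exact Dominated.of (Or.inr rfl)
  · rintro G (rfl | rfl)
    · exact Or.inl (projC_iff.2 (Dominated.of rfl))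
    · exact Or.inr rfl

theorem finiteDimensional_hom (X Y : ModC) : FiniteDimensional ℂ (X ⟶ Y) := by
  let T : Type := X →ₗ[Coinv] Y
  let : Module Coinv T := inferInstanceAs (Module Coinv (X →ₗ[Coinv] Y))
  have : Module.Finite Coinv T := inferInstanceAs (Module.Finite Coinv (X →ₗ[Coinv] Y))
  let : Module ℂ T := Module.compHom T (algebraMap ℂ Coinv)
  have : IsScalarTower ℂ Coinv T := ⟨fun z c f => by
    rw [coinv_smul]
    exact mul_smul (algebraMap ℂ Coinv z) c (show X →ₗ[Coinv] Y from f)⟩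
  have : Module.Finite ℂ T := Module.Finite.trans Coinv T
  let e : T →ₗ[ℂ] (X ⟶ Y) :=
    { toFun := fun f => FGModuleCat.ofHom f
      map_add' := fun _ _ => rfl
      map_smul' := fun _ _ => rfl }
  exact Module.Finite.of_surjective e fun f => ⟨f.hom.hom, rfl⟩

/-- Endomorphism rings of cyclic modules are local. -/
theorem isLocalRing_end_of_cyclic {X : ModC} {x : X} (h0 : x ≠ 0) (hx : ∀ y : X, ∃ c : Coinv, c • x = y) :
    IsLocalRing (End X) := by
  let φ : Coinv →+* End X :=
    { toFun := scalarEnd X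
      map_one' := FGModuleCat.hom_ext (LinearMap.ext fun x => one_smul Coinv x)
      map_zero' := FGModuleCat.hom_ext (LinearMap.ext fun x => zero_smul Coinv x)
      map_add' := fun c d => FGModuleCat.hom_ext (LinearMap.ext fun x => add_smul c d x)
      map_mul' := fun c d => FGModuleCat.hom_ext (LinearMap.ext fun x => mul_smul c d x) }
  have : Nontrivial (End X) :=
    ⟨⟨0, 1, fun h => h0 (congrArg (fun f : X ⟶ X => f.hom.hom x) h).symm⟩⟩
  refine scalarNil_coinv.isLocalRing φ fun f => ?_
  obtain ⟨c, hc⟩ := hx ((show X ⟶ X from f).hom.hom x)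
  refine ⟨c, FGModuleCat.hom_ext (LinearMap.ext fun y => ?_)⟩
  obtain ⟨d, rfl⟩ := hx y
  change c • d • x = (show X ⟶ X from f).hom.hom (d • x)
  rw [map_smul, ← hc, smul_comm]

theorem isLocalRing_end_regC : IsLocalRing (End regC) :=
  isLocalRing_end_of_cyclic (X := regC) (x := (1 : Coinv)) one_ne_zero fun y => ⟨y, mul_one y⟩

/-- The generator of `M_{a,b}`. -/
def quotGen (a b : ℂ) : quotObj a b := (Ideal.Quotient.mk (genIdeal a b) 1 : quotMod a b)

theorem exists_smul_quotGen {a b : ℂ} (y : quotObj a b) : ∃ c : Coinv, c • quotGen a b = y := by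
  obtain ⟨c, hc⟩ := Ideal.Quotient.mk_surjective (I := genIdeal a b) y
  refine ⟨c, Eq.trans ?_ hc⟩
  change Ideal.Quotient.mk (genIdeal a b) (c * 1) = _
  rw [mul_one]

theorem smul_quotGen_eq_zero_iff {a b : ℂ} {c : Coinv} :
    c • quotGen a b = 0 ↔ c ∈ genIdeal a b := by
  change Ideal.Quotient.mk (genIdeal a b) (c * 1) = 0 ↔ _
  rw [mul_one, Ideal.Quotient.eq_zero_iff_mem]

theorem Admissible.symm {a b : ℂ} (h : Admissible a b) : Admissible b a :=
  ⟨by linear_combination h.1, h.2.2, h.2.1⟩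

theorem not_isUnit_ell {a b : ℂ} (h : Admissible a b) : ¬ IsUnit (ell a b) := fun hu =>
  ell_ne_zero h.symm ((hu.mul_right_eq_zero).1 (ell_mul_ellDual h))

theorem quotGen_ne_zero {a b : ℂ} (h : Admissible a b) : quotGen a b ≠ 0 := by
  intro h0
  have h1 : (1 : Coinv) ∈ genIdeal a b := smul_quotGen_eq_zero_iff.1 ((one_smul _ _).trans h0)
  exact not_isUnit_ell h (Ideal.span_singleton_eq_top.1 ((Ideal.eq_top_iff_one _).2 h1))

theorem isLocalRing_end_quotObj {a b : ℂ} (h : Admissible a b) : IsLocalRing (End (quotObj a b)) :=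
  isLocalRing_end_of_cyclic (quotGen_ne_zero h) exists_smul_quotGen

theorem ell_smul_quotObj {a b : ℂ} (m : quotObj a b) : ell a b • m = 0 := by
  obtain ⟨c, rfl⟩ := exists_smul_quotGen m
  rw [smul_smul, mul_comm, mul_smul, smul_quotGen_eq_zero_iff.2 (ell_mem_genIdeal a b), smul_zero]

theorem not_iso_quotObj_regC {a b : ℂ} (h : Admissible a b) : ¬ Nonempty (quotObj a b ≅ regC) := by
  rintro ⟨e⟩
  have h1 : (e.inv ≫ e.hom).hom.hom (1 : Coinv) = (1 : Coinv) :=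
    congrArg (fun f => f.hom.hom (1 : Coinv)) e.inv_hom_id
  have h2 : ell a b • (e.inv ≫ e.hom).hom.hom (1 : Coinv) = 0 := by
    change ell a b • e.hom.hom.hom (e.inv.hom.hom (1 : Coinv)) = 0
    rw [← map_smul, ell_smul_quotObj, map_zero]
  rw [h1] at h2
  exact ell_ne_zero h ((mul_one (ell a b)).symm.trans h2)

/-- A projective indecomposable would be isomorphic to C, but ℓ kills M_{a,b} and not C. -/
theorem not_projC_quotObj {a b : ℂ} (h : Admissible a b) : ¬ projC (quotObj a b) := by
  intro hP
  have := isLocalRing_end_quotObj h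
  obtain ⟨G, rfl, e⟩ := Indec.exists_iso (P := (· = regC)) (by
    rintro _ rfl
    exact isLocalRing_end_regC) (projC_iff.1 hP) indec_of_isLocalRing
  exact not_iso_quotObj_regC h e

theorem projC_of_retract {X Y : ModC} (r : Retract X Y) (h : projC Y) : projC X :=
  projC_iff.2 ((projC_iff.1 h).retract r)

/-- Linear maps out of `C ⊗_A X` as morphisms of `C`-mod. -/
def homTheta {A : Subalgebra ℂ Coinv} {X Y : ModC} (p : Coinv ⊗[A] X →ₗ[Coinv] Y) :
    (theta A).obj X ⟶ Y := FGModuleCat.ofHom p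

/-- `C` is a summand of `θ_B X` if there is an `A`-linear form on `X` with value one. -/
theorem exists_retract_theta {A B : Subalgebra ℂ Coinv} (hBA : B ≤ A) {X : ModC} (π : X →ₗ[A] A)
    {x : X} (hx : π x = 1) : Nonempty (Retract regC ((theta B).obj X)) := by
  let p : Coinv ⊗[B] X →ₗ[Coinv] Coinv := indLift B
    (A.val.toLinearMap.toAddMonoidHom.comp π.toAddMonoidHom) (fun b m =>
      congrArg Subtype.val (π.map_smul ⟨b, hBA b.2⟩ m))
  refine ⟨⟨orbitMap (X := (theta B).obj X) ((1 : Coinv) ⊗ₜ[B] x),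
    homTheta (Y := regC) p, FGModuleCat.hom_ext (LinearMap.ext fun c => ?_)⟩⟩
  refine (p.map_smul c ((1 : Coinv) ⊗ₜ[B] x)).trans ?_
  change c * ((1 : Coinv) * (π x : Coinv)) = c
  rw [hx, one_mul]
  exact mul_one c

/-- `θ_A X` is projective if `X` is free of rank one over `A`. -/
theorem projC_theta_of_retraction {A : Subalgebra ℂ Coinv} {X : ModC} (π : X →ₗ[A] A) {x : X}
    (hx : ∀ m, (π m : Coinv) • x = m) : projC ((theta A).obj X) := by
  let p : Coinv ⊗[A] X →ₗ[Coinv] Coinv := indLift A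
    (A.val.toLinearMap.toAddMonoidHom.comp π.toAddMonoidHom) (fun b m =>
      congrArg Subtype.val (π.map_smul b m))
  have hpr : homTheta (Y := regC) p ≫ orbitMap (X := (theta A).obj X) ((1 : Coinv) ⊗ₜ[A] x) =
      𝟙 ((theta A).obj X) := by
    refine FGModuleCat.hom_ext (ind_ext_one fun m => ?_)
    change ((1 : Coinv) * (π m : Coinv)) • ((1 : Coinv) ⊗ₜ[A] x) = (1 : Coinv) ⊗ₜ[A] m
    rw [one_mul, smul_theta_tmul, ← tmul_coe_smul, hx]
  exact projC_of_retract ⟨_, _, hpr⟩ (projC_iff.2 (Dominated.of rfl))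

theorem projC_theta_regC {A : Subalgebra ℂ Coinv} (D : DualBasis A) :
    projC ((theta A).obj regC) := by
  let p (i : D.ι) : Coinv ⊗[A] Coinv →ₗ[Coinv] Coinv := indLift A
    (A.val.toLinearMap.toAddMonoidHom.comp (D.φ i).toAddMonoidHom) (fun b m =>
      congrArg Subtype.val ((D.φ i).map_smul b m))
  refine projC_iff.2 ⟨D.ι, inferInstance, fun _ => regC, fun i => homTheta (X := regC) (Y := regC) (p i),
    fun i => orbitMap (X := (theta A).obj regC) ((1 : Coinv) ⊗ₜ[A] D.e i), fun _ => rfl,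
    FGModuleCat.hom_ext (ind_ext_one fun m => ?_)⟩
  refine (hom_sum_apply _ _).trans ?_
  change ∑ i, ((1 : Coinv) * (D.φ i m : Coinv)) • ((1 : Coinv) ⊗ₜ[A] D.e i) = (1 : Coinv) ⊗ₜ[A] m
  conv_rhs => rw [← D.total m, TensorProduct.tmul_sum]
  refine Finset.sum_congr rfl fun i _ => ?_
  rw [one_mul, smul_theta_tmul]
  exact (tmul_coe_smul A (1 : Coinv) (D.φ i m) (D.e i)).symm

/-- Projectives are dominated by C, so an additive functor preserves them as soon as it sends C to a
projective. The modules θ_s C and θ_t C are projective by a dual basis; the other constructors are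
formal. -/
theorem stable_projC : TwoRep.natural.Stable projC := by
  intro F X hX
  have key : ∀ (F : ModC ⥤ ModC) [F.Additive], projC (F.obj regC) → ∀ X, projC X → projC (F.obj X) := by
    intro F _ hF X hX
    refine projC_iff.2 ((projC_iff.1 hX).map F ?_)
    rintro _ rfl
    exact projC_iff.1 hF
  change projC (F.obj.obj X)
  obtain ⟨F, hF⟩ := F
  change projC (F.obj X)
  induction hF generalizing X with
  | id => exact hX
  | theta_s => exact key (theta invS) (projC_theta_regC coordsS.dualBasis) X hX
  | theta_t => exact key (theta invT) (projC_theta_regC coordsT.dualBasis) X hX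
  | comp _ _ hF hG => exact hF _ (hG X hX)
  | biprod b hb _ _ hF hG =>
    have tot := congrArg (fun τ => NatTrans.app τ X) (IsBilimit.binary_total hb)
    exact projC_iff.2 (Dominated.biprod (b.fst.app X) (b.inl.app X) (b.snd.app X) (b.inr.app X) tot
      (projC_iff.1 (hF X hX)) (projC_iff.1 (hG X hX)))
  | retract r _ hG =>
    exact projC_of_retract (r.map ((CategoryTheory.evaluation ModC ModC).obj X)) (hG X hX)

theorem projC_theta_quotObj {a b : ℂ} (h : Admissible a b) :
    projC (thetaS.obj (quotObj a b)) ∧ projC (thetaT.obj (quotObj a b)) := by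
  obtain ⟨π, _, hπ⟩ := exists_retractionS h
  obtain ⟨π', _, hπ'⟩ := exists_retractionT h
  exact ⟨projC_theta_of_retraction (X := quotObj a b) π hπ,
    projC_theta_of_retraction (X := quotObj a b) π' hπ'⟩

/-- θ_s M and θ_t M are projective because M is free over the invariants. Products follow by
`stable_projC`, and θ_{sts} M is a summand of θ_sθ_tθ_s M. -/
theorem IsBasicPos.projC_quotObj {F : ModC ⥤ ModC} (hF : IsBasicPos F) {a b : ℂ}
    (h : Admissible a b) : projC (F.obj (quotObj a b)) := by
  obtain ⟨hS, hT⟩ := projC_theta_quotObj h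
  rcases hF with rfl | rfl | rfl | rfl | rfl
  · exact hS
  · exact hT
  · exact stable_projC ⟨thetaS, .theta_s⟩ _ hT
  · exact stable_projC ⟨thetaT, .theta_t⟩ _ hS
  · exact projC_of_retract ((coordsS.retractBot coordsT.adjoin_eq).map
      ((CategoryTheory.evaluation ModC ModC).obj (quotObj a b)))
      (stable_projC ⟨thetaS, .theta_s⟩ _ (stable_projC ⟨thetaT, .theta_t⟩ _ hS))

/-- A linear form on M with value one at the generator splits C off θ_s M, θ_t M and θ_{sts} M. For
the two products one uses in addition that C is a summand of θ_s C and θ_t C. -/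
theorem IsBasicPos.retract_quotObj {F : ModC ⥤ ModC} (hF : IsBasicPos F) {a b : ℂ}
    (h : Admissible a b) : Nonempty (Retract regC (F.obj (quotObj a b))) := by
  obtain ⟨π, hπ, _⟩ := exists_retractionS h
  obtain ⟨π', hπ', _⟩ := exists_retractionT h
  obtain ⟨rS⟩ := exists_retract_theta le_rfl (X := quotObj a b) π hπ
  obtain ⟨rT⟩ := exists_retract_theta le_rfl (X := quotObj a b) π' hπ'
  obtain ⟨cS⟩ := exists_retract_theta le_rfl (X := regC) coordsS.g₀ coordsS.g₀_one
  obtain ⟨cT⟩ := exists_retract_theta le_rfl (X := regC) coordsT.g₀ coordsT.g₀_one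
  rcases hF with rfl | rfl | rfl | rfl | rfl
  · exact ⟨rS⟩
  · exact ⟨rT⟩
  · exact ⟨cS.trans (rT.map thetaS)⟩
  · exact ⟨cT.trans (rS.map thetaT)⟩
  · exact exists_retract_theta bot_le (X := quotObj a b) π hπ

/-- By domination only the values at C and at M matter, and at M only those of the six θ_w. -/
theorem stable_projAnd {a b : ℂ} (h : Admissible a b) : TwoRep.natural.Stable (projAnd a b) := by
  intro F X hX
  refine projAnd_iff.2 ((projAnd_iff.1 hX).map F.obj ?_)
  rintro _ (rfl | rfl)
  · exact (projC_iff.1 (stable_projC F regC (projC_iff.2 (Dominated.of rfl)))).mono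
      fun _ h => Or.inl h
  · refine Dominated.map (P := IsBasic) F.property.dominated
      ((CategoryTheory.evaluation ModC ModC).obj (quotObj a b)) fun G hG => ?_
    rcases hG with rfl | hG
    · exact Dominated.of (Or.inr rfl)
    · exact (projC_iff.1 (hG.projC_quotObj h)).mono fun _ h => Or.inl h

end Modules

end SoergelA2

end

noncomputable section

namespace SoergelA2

open TwoRep

/-! ### Finitarity, and the quotient by morphisms that factor through projectives -/

section Finitary

theorem isLocalRing_end_fullSubcategory {A : Type*} [Category A] [Preadditive A]
    {P : ObjectProperty A} (X : P.FullSubcategory) (h : IsLocalRing (End X.obj)) :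
    IsLocalRing (End X) := by
  let φ : End X.obj →+* End X :=
    { toFun := fun f => ObjectProperty.homMk f
      map_one' := rfl
      map_zero' := rfl
      map_mul' := fun _ _ => rfl
      map_add' := fun _ _ => rfl }
  have : Nontrivial (End X) :=
    ⟨⟨0, 1, fun e => zero_ne_one (α := End X.obj) (congrArg InducedCategory.Hom.hom e)⟩⟩
  refine ⟨fun {f g} e => ?_⟩
  have h1 : (f.hom : End X.obj) + (g.hom : End X.obj) = (1 : End X.obj) :=
    congrArg (fun k : X ⟶ X => k.hom) e
  exact (IsLocalRing.isUnit_or_isUnit_of_add_one h1).imp (fun h => h.map φ) fun h => h.map φ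

/-- Finitely many objects with local endomorphism rings dominate everything; decompositions and the
list of indecomposables come from them, and the remaining properties are inherited from C-mod. -/
theorem finitary_sub {P : ObjectProperty ModC} (hP : natural.Stable P) {n : ℕ} (f : Fin n → ModC)
    (hloc : ∀ i, IsLocalRing (End (f i)))
    (hPf : ∀ X, P X ↔ Dominated (fun Y => ∃ i, Y = f i) X) : (natural.sub P hP).Finitary := by
  have hr : ∀ X Y, Retract X Y → P Y → P X := fun X Y r h => (hPf X).2 (((hPf Y).1 h).retract r)
  have hid : IsIdempotentComplete P.FullSubcategory := isIdempotentComplete_fullSubcategory hr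
  let g (i : Fin n) : P.FullSubcategory := ⟨f i, (hPf _).2 (Dominated.of ⟨i, rfl⟩)⟩
  have hg : ∀ Y : P.FullSubcategory, (∃ i, Y = g i) → IsLocalRing (End Y) := by
    rintro _ ⟨i, rfl⟩
    exact isLocalRing_end_fullSubcategory _ (hloc i)
  have hdom : ∀ X : P.FullSubcategory, Dominated (fun Y => ∃ i, Y = g i) X := fun X =>
    (Dominated.fullSubcategory (X := X) (fun Y hY => (hPf Y).2 (Dominated.of hY))
      ((hPf _).1 X.property)).mono (by
        rintro ⟨Y, hY⟩ ⟨i, rfl⟩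
        exact ⟨i, rfl⟩)
  exact
    { finiteBiproducts := by
        obtain ⟨Z, hZ⟩ := HasZeroObject.zero (C := ModC)
        exact hasFiniteBiproducts_fullSubcategory (A := ModC) ⟨Z, hZ, (hPf Z).2 (Dominated.of_isZero hZ)⟩
          fun X Y b hb hX hY => (hPf _).2 (Dominated.bicone hb ((hPf X).1 hX) ((hPf Y).1 hY))
      idempotentSplit := hid
      krullSchmidt := fun X => by
        obtain ⟨m, F, b, hb, e, hF⟩ := exists_decomposition hg (hdom X)
        exact ⟨m, F, b, hb, e, fun i => hg _ (hF i)⟩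
      finiteIndec := ⟨n, g, fun X hX => by
        obtain ⟨_, ⟨i, rfl⟩, e⟩ := Indec.exists_iso hg (hdom X) hX
        exact ⟨i, e⟩⟩
      finiteHom := fun X Y => by
        let X' : P.FullSubcategory := X
        let Y' : P.FullSubcategory := Y
        have := finiteDimensional_hom X'.obj Y'.obj
        let e : (X'.obj ⟶ Y'.obj) →ₗ[ℂ] (X' ⟶ Y') :=
          { toFun := fun f => ObjectProperty.homMk f
            map_add' := fun _ _ => rfl
            map_smul' := fun _ _ => rfl }
        exact Module.Finite.of_surjective e fun f => ⟨f.hom, rfl⟩ }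

theorem finitary_repK (hK : natural.Stable projC) : (repK hK).Finitary :=
  finitary_sub hK (fun _ : Fin 1 => regC) (fun _ => isLocalRing_end_regC) fun _ =>
    projC_iff.trans ⟨fun h => h.mono fun _ h => ⟨0, h⟩, fun h => h.mono fun _ ⟨_, h⟩ => h⟩

theorem finitary_repM {a b : ℂ} (h : Admissible a b) (hM : natural.Stable (projAnd a b)) :
    (repM a b hM).Finitary :=
  finitary_sub hM ![regC, quotObj a b] (fun i => by
    fin_cases i
    exacts [isLocalRing_end_regC, isLocalRing_end_quotObj h]) fun X =>
    projAnd_iff.trans ⟨fun h => h.mono (by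
      rintro _ (rfl | rfl)
      exacts [⟨0, rfl⟩, ⟨1, rfl⟩]), fun h => h.mono (by
      rintro _ ⟨i, rfl⟩
      fin_cases i
      exacts [Or.inl rfl, Or.inr rfl])⟩

end Finitary

section ExactSequence

variable {a b : ℂ} (hK : natural.Stable projC) (hM : natural.Stable (projAnd a b))

/-- `C` as an object of `K`. -/
def objK : (repK hK).carrier := (⟨regC, projC_iff.2 (Dominated.of rfl)⟩ : projC.FullSubcategory)

/-- `C` as an object of `M_{a,b}`. -/
def objC : (repM a b hM).carrier :=
  (⟨regC, projAnd_iff.2 (Dominated.of (Or.inl rfl))⟩ : (projAnd a b).FullSubcategory)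

/-- `M_{a,b}` as an object of the `2`-representation `M_{a,b}`. -/
def objM : (repM a b hM).carrier :=
  (⟨quotObj a b, projAnd_iff.2 (Dominated.of (Or.inr rfl))⟩ : (projAnd a b).FullSubcategory)

/-- The forgetful functor from `M_{a,b}` to `C`-mod. -/
def forgetM : (repM a b hM).carrier ⥤ ModC := (projAnd a b).ι

instance : (forgetM hM).Additive := ⟨rfl⟩

instance : (forgetM hM).Linear ℂ := ⟨fun _ _ => rfl⟩

/-- A morphism of `C`-mod between objects of `M_{a,b}`. -/
def liftM {X Y : (repM a b hM).carrier} (f : (forgetM hM).obj X ⟶ (forgetM hM).obj Y) : X ⟶ Y :=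
  ObjectProperty.homMk f

instance : (forgetM hM).Faithful := inferInstanceAs (projAnd a b).ι.Faithful

/-- The ideal of morphisms of `M_{a,b}` which factor through a projective object. -/
def factorIdeal : StableIdeal (repM a b hM) where
  mem X Y :=
    { carrier := {f | ∃ Z : ModC, projC Z ∧ ∃ (p : (forgetM hM).obj X ⟶ Z)
        (q : Z ⟶ (forgetM hM).obj Y), p ≫ q = (forgetM hM).map f}
      zero_mem' := ⟨regC, projC_iff.2 (Dominated.of rfl), 0, 0, by rw [comp_zero, Functor.map_zero]⟩
      add_mem' := by
        rintro f g ⟨Z, hZ, p, q, e⟩ ⟨Z', hZ', p', q', e'⟩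
        refine ⟨Z ⊞ Z', projC_iff.2 (Dominated.bicone (BinaryBiproduct.isBilimit Z Z')
          (projC_iff.1 hZ) (projC_iff.1 hZ')), biprod.lift p p', biprod.desc q q', ?_⟩
        rw [biprod.lift_desc, e, e', Functor.map_add]
      smul_mem' := by
        rintro c f ⟨Z, hZ, p, q, e⟩
        refine ⟨Z, hZ, c • p, q, ?_⟩
        rw [Linear.smul_comp, e, CategoryTheory.Functor.Linear.map_smul] }
  comp_left := by
    rintro X Y W f g ⟨Z, hZ, p, q, e⟩
    refine ⟨Z, hZ, (forgetM hM).map f ≫ p, q, ?_⟩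
    rw [Category.assoc, e, Functor.map_comp]
  comp_right := by
    rintro X Y W f g ⟨Z, hZ, p, q, e⟩
    refine ⟨Z, hZ, p, q ≫ (forgetM hM).map g, ?_⟩
    rw [← Category.assoc, e, Functor.map_comp]
  act_mem := by
    rintro F X Y f ⟨Z, hZ, p, q, e⟩
    refine ⟨F.obj.obj Z, stable_projC F Z hZ, F.obj.map p, F.obj.map q, ?_⟩
    exact (F.obj.map_comp p q).symm.trans (congrArg F.obj.map e)

/-- The ideal generated by the identity morphisms of `K`. -/
abbrev kernelIdeal : StableIdeal (repM a b hM) :=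
  StableIdeal.generatedBy _ (ImageId (inclKM a b hK hM))

/-- Morphisms through projectives form a stable ideal containing the generating identities.
Conversely, a factorisation through Z passes through the identity of an object of K. -/
theorem mem_kernelIdeal_iff {X Y : (repM a b hM).carrier} (f : X ⟶ Y) :
    f ∈ (kernelIdeal hK hM).mem X Y ↔ ∃ Z : ModC, projC Z ∧ ∃ (p : (forgetM hM).obj X ⟶ Z)
      (q : Z ⟶ (forgetM hM).obj Y), p ≫ q = (forgetM hM).map f := by
  constructor
  · intro hf
    refine (Submodule.mem_iInf _).1 hf ⟨factorIdeal hM, ?_⟩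
    rintro _ _ _ ⟨Z⟩
    exact ⟨(show projC.FullSubcategory from Z).obj, (show projC.FullSubcategory from Z).property,
      𝟙 _, 𝟙 _, Category.comp_id _⟩
  · rintro ⟨Z, hZ, p, q, e⟩
    let Z₀ : (repK hK).carrier := (⟨Z, hZ⟩ : projC.FullSubcategory)
    let Z' : (repM a b hM).carrier := (inclKM a b hK hM).functor.obj Z₀
    have h0 : 𝟙 Z' ∈ (kernelIdeal hK hM).mem Z' Z' :=
      (Submodule.mem_iInf _).2 fun I => I.2 _ _ _ (ImageId.of (i := inclKM a b hK hM) Z₀)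
    let p' : X ⟶ Z' := liftM hM p
    let q' : Z' ⟶ Y := liftM hM q
    have h1 := (kernelIdeal hK hM).comp_left p' _ ((kernelIdeal hK hM).comp_right _ q' h0)
    have h2 : p' ≫ 𝟙 Z' ≫ q' = f := by
      refine (forgetM hM).map_injective ?_
      rw [Category.id_comp, Functor.map_comp]
      exact e
    exact h2 ▸ h1

theorem projection_map_eq_zero_iff {X Y : (repM a b hM).carrier} (f : X ⟶ Y) :
    (projMN a b hK hM).functor.map f = 0 ↔ f ∈ (kernelIdeal hK hM).mem X Y :=
  quotient_functor_map_eq_zero (kernelIdeal hK hM) f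

theorem projection_isZero_iff {X : (repM a b hM).carrier} :
    IsZero ((projMN a b hK hM).functor.obj X) ↔ projC ((forgetM hM).obj X) := by
  have h0 : IsZero ((projMN a b hK hM).functor.obj X) ↔
      𝟙 X ∈ (kernelIdeal hK hM).mem X X :=
    Iff.trans (IsZero.iff_id_eq_zero _) (projection_map_eq_zero_iff hK hM (𝟙 X))
  rw [h0, mem_kernelIdeal_iff]
  constructor
  · rintro ⟨Z, hZ, p, q, e⟩
    exact projC_of_retract ⟨p, q, e⟩ hZ
  · exact fun h => ⟨_, h, 𝟙 _, 𝟙 _, Category.comp_id _⟩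

theorem not_isZero_projection_objM (h : Admissible a b) :
    ¬ IsZero ((projMN a b hK hM).functor.obj (objM hM)) := fun h0 =>
  not_projC_quotObj h ((projection_isZero_iff hK hM).1 h0)

theorem isZero_projection_objC : IsZero ((projMN a b hK hM).functor.obj (objC hM)) :=
  (projection_isZero_iff hK hM).2 (projC_iff.2 (Dominated.of rfl))

/-- Multiplication by scalars on the object `M_{a,b}` of `N`. -/
def scalarN : Coinv →+* End ((projMN a b hK hM).functor.obj (objM hM)) where
  toFun c := (projMN a b hK hM).functor.map
    (liftM hM (X := objM hM) (Y := objM hM) (scalarEnd (quotObj a b) c))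
  map_one' := by
    refine Eq.trans (congrArg _ ?_) ((projMN a b hK hM).functor.map_id (objM hM))
    exact (forgetM hM).map_injective
      (FGModuleCat.hom_ext (LinearMap.ext fun x => one_smul Coinv x))
  map_zero' := by
    refine (projection_map_eq_zero_iff hK hM _).2 ?_
    have : liftM hM (X := objM hM) (Y := objM hM) (scalarEnd (quotObj a b) 0) = 0 :=
      (forgetM hM).map_injective
        (FGModuleCat.hom_ext (LinearMap.ext fun x => zero_smul Coinv x))
    rw [this]
    exact Submodule.zero_mem _
  map_add' c d := by
    refine Eq.trans (congrArg _ ?_) ((projMN a b hK hM).additive.map_add)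
    exact (forgetM hM).map_injective
      (FGModuleCat.hom_ext (LinearMap.ext fun x => add_smul c d x))
  map_mul' c d := by
    refine Eq.trans (congrArg _ ?_) ((projMN a b hK hM).functor.map_comp _ _)
    exact (forgetM hM).map_injective
      (FGModuleCat.hom_ext (LinearMap.ext fun x => mul_smul c d x))

/-- M_{a,b} is cyclic, so its endomorphisms are multiplications by elements of C, and the projection
to N is full. -/
theorem scalarN_surjective : Function.Surjective (scalarN hK hM) := by
  intro f
  obtain ⟨g, rfl⟩ := (CategoryTheory.Quotient.functor (kernelIdeal hK hM).rel).map_surjective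
    (X := objM hM) (Y := objM hM) f
  obtain ⟨c, hc⟩ := exists_smul_quotGen (((forgetM hM).map g).hom.hom (quotGen a b))
  refine ⟨c, congrArg (CategoryTheory.Quotient.functor (kernelIdeal hK hM).rel).map ?_⟩
  refine (forgetM hM).map_injective
    (FGModuleCat.hom_ext (LinearMap.ext fun x => ?_))
  obtain ⟨d, rfl⟩ := exists_smul_quotGen x
  refine Eq.trans ?_ ((((forgetM hM).map g).hom.hom.map_smul d (quotGen a b)).trans
    (congrArg (d • ·) hc.symm)).symm
  exact smul_comm c d (quotGen a b)

theorem isLocalRing_end_projection_objM (h : Admissible a b) :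
    IsLocalRing (End ((projMN a b hK hM).functor.obj (objM hM))) := by
  have : Nontrivial (End ((projMN a b hK hM).functor.obj (objM hM))) :=
    ⟨⟨1, 0, fun e => not_isZero_projection_objM hK hM h ((IsZero.iff_id_eq_zero _).2 e)⟩⟩
  exact scalarNil_coinv.isLocalRing (scalarN hK hM) (scalarN_surjective hK hM)

theorem dominated_repM (X : (repM a b hM).carrier) :
    Dominated (fun Y => Y = objC hM ∨ Y = objM hM) X :=
  (Dominated.fullSubcategory (A := ModC) (P := projAnd a b) (X := X)
    (fun Y hY => projAnd_iff.2 (Dominated.of hY)) (projAnd_iff.1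
      (show (projAnd a b).FullSubcategory from X).property)).mono (by
        rintro ⟨Y, hY⟩ (h | h)
        · obtain rfl : Y = regC := h
          exact Or.inl rfl
        · obtain rfl : Y = quotObj a b := h
          exact Or.inr rfl)

theorem dominated_repN (X : (repN a b hK hM).carrier) :
    Dominated (fun Y => Y = (projMN a b hK hM).functor.obj (objM hM)) X := by
  have := (projMN a b hK hM).additive
  obtain ⟨X₀, rfl⟩ : ∃ X₀, (projMN a b hK hM).functor.obj X₀ = X :=
    ⟨CategoryTheory.Quotient.as X, rfl⟩
  refine (dominated_repM hM X₀).map (projMN a b hK hM).functor ?_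
  rintro _ (rfl | rfl)
  · exact Dominated.of_isZero (isZero_projection_objC hK hM)
  · exact Dominated.of rfl

/-- C becomes zero in N, so the image of M_{a,b} alone dominates; idempotents split because they
lift along the quotient. -/
theorem finitary_repN (h : Admissible a b) : (repN a b hK hM).Finitary := by
  have hfin := finitary_repM h hM
  have := hfin.finiteBiproducts
  have := hfin.idempotentSplit
  have hid : IsIdempotentComplete (repN a b hK hM).carrier :=
    quotient_isIdempotentComplete (kernelIdeal hK hM) hfin.finiteHom
  have hloc : ∀ Y, Y = (projMN a b hK hM).functor.obj (objM hM) → IsLocalRing (End Y) := by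
    rintro _ rfl
    exact isLocalRing_end_projection_objM hK hM h
  exact
    { finiteBiproducts := quotient_hasFiniteBiproducts (kernelIdeal hK hM)
      idempotentSplit := hid
      krullSchmidt := fun X => by
        obtain ⟨m, F, b, hb, e, hF⟩ := exists_decomposition hloc (dominated_repN hK hM X)
        exact ⟨m, F, b, hb, e, fun i => hloc _ (hF i)⟩
      finiteIndec := ⟨1, fun _ => (projMN a b hK hM).functor.obj (objM hM), fun X hX => by
        obtain ⟨_, rfl, e⟩ := Indec.exists_iso hloc (dominated_repN hK hM X) hX
        exact ⟨0, e⟩⟩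
      finiteHom := quotient_finiteDimensional (kernelIdeal hK hM) hfin.finiteHom }

end ExactSequence

end SoergelA2

end

noncomputable section

namespace SoergelA2

open TwoRep

/-! ### The diagram of M_{a,b} and its decoration -/

section Diagram

universe v₁ u₁

theorem Ind.le_of_iso {M : TwoRep.{v₁, u₁}} {X Y : M.Ind} (e : X.1 ≅ Y.1) : X ≤ Y :=
  ⟨S.one, by rw [M.act_one]; exact ⟨e.symm.retract⟩⟩

theorem vertex_eq_iff {M : TwoRep.{v₁, u₁}} {X Y : M.Ind} :
    M.vertex X = M.vertex Y ↔ X ≤ Y ∧ Y ≤ X := Quotient.eq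

theorem isLocalRing_end_objK (hK : natural.Stable projC) : IsLocalRing (End (objK hK)) :=
  isLocalRing_end_fullSubcategory (P := projC) _ isLocalRing_end_regC

theorem dominated_repK {hK : natural.Stable projC} (X : (repK hK).carrier) :
    Dominated (· = objK hK) X := by
  refine (Dominated.fullSubcategory (A := ModC) (P := projC) (X := X) (Q := (· = regC))
    (fun Y hY => projC_iff.2 (Dominated.of hY)) (projC_iff.1
    (show projC.FullSubcategory from X).property)).mono ?_
  rintro ⟨Y, hY⟩ h
  obtain rfl : Y = regC := h
  rfl

theorem exists_iso_objK {hK : natural.Stable projC} {X : (repK hK).carrier} (hX : Indec X) :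
    Nonempty (X ≅ objK hK) := by
  have := (finitary_repK hK).idempotentSplit
  obtain ⟨_, rfl, e⟩ := Indec.exists_iso (by
    rintro _ rfl
    exact isLocalRing_end_objK hK) (dominated_repK X) hX
  exact e

variable {a b : ℂ} (h : Admissible a b) (hK : natural.Stable projC)
  (hM : natural.Stable (projAnd a b))

theorem isLocalRing_end_objC : IsLocalRing (End (objC hM)) :=
  isLocalRing_end_fullSubcategory (P := projAnd a b) _ isLocalRing_end_regC

include h in
theorem isLocalRing_end_objM : IsLocalRing (End (objM hM)) :=
  isLocalRing_end_fullSubcategory (P := projAnd a b) _ (isLocalRing_end_quotObj h)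

/-- The indecomposable object `C`. -/
def indC : (repM a b hM).Ind :=
  ⟨objC hM, @indec_of_isLocalRing _ _ _ _ (isLocalRing_end_objC hM)⟩

/-- The indecomposable object `M_{a,b}`. -/
def indM : (repM a b hM).Ind :=
  ⟨objM hM, @indec_of_isLocalRing _ _ _ _ (isLocalRing_end_objM h hM)⟩

include h in
theorem exists_iso_objC_or_objM {X : (repM a b hM).carrier} (hX : Indec X) :
    Nonempty (X ≅ objC hM) ∨ Nonempty (X ≅ objM hM) := by
  have := (finitary_repM h hM).idempotentSplit
  obtain ⟨_, rfl | rfl, e⟩ := Indec.exists_iso (by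
    rintro _ (rfl | rfl)
    exacts [isLocalRing_end_objC hM, isLocalRing_end_objM h hM]) (dominated_repM hM X) hX
  exacts [Or.inl e, Or.inr e]

theorem indM_le_indC : indM h hM ≤ indC hM := by
  obtain ⟨r⟩ := IsBasicPos.retract_quotObj (F := thetaS) (Or.inl rfl) h
  exact ⟨S.thS, ⟨liftM hM (X := objC hM) (Y := ((repM a b hM).act S.thS).obj (objM hM)) r.i,
    liftM hM r.r, (forgetM hM).map_injective r.retract⟩⟩

/-- The action preserves projectives, and M_{a,b} is not projective. -/
theorem not_indC_le_indM : ¬ indC hM ≤ indM h hM := by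
  rintro ⟨F, ⟨r⟩⟩
  exact not_projC_quotObj h (projC_of_retract (r.map (forgetM hM))
    (stable_projC F regC (projC_iff.2 (Dominated.of rfl))))

theorem vertex_eq_of_iso {X Y : (repM a b hM).Ind} (e : Nonempty (X.1 ≅ Y.1)) :
    (repM a b hM).vertex X = (repM a b hM).vertex Y :=
  e.elim fun e => vertex_eq_iff.2 ⟨Ind.le_of_iso e, Ind.le_of_iso e.symm⟩

theorem vertex_ne : (repM a b hM).vertex (indM h hM) ≠ (repM a b hM).vertex (indC hM) := fun e =>
  not_indC_le_indM h hM (vertex_eq_iff.1 e).2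

theorem vertex_eq_indM_iff {X : (repM a b hM).Ind} :
    (repM a b hM).vertex X = (repM a b hM).vertex (indM h hM) ↔ Nonempty (X.1 ≅ objM hM) := by
  refine ⟨fun e => ?_, vertex_eq_of_iso hM (Y := indM h hM)⟩
  rcases exists_iso_objC_or_objM h hM X.2 with h1 | h1
  · exact absurd (e.symm.trans (vertex_eq_of_iso hM (Y := indC hM) h1)) (vertex_ne h hM)
  · exact h1

include h in
theorem vertex_eq_indC_iff {X : (repM a b hM).Ind} :
    (repM a b hM).vertex X = (repM a b hM).vertex (indC hM) ↔ Nonempty (X.1 ≅ objC hM) := by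
  refine ⟨fun e => ?_, vertex_eq_of_iso hM (Y := indC hM)⟩
  rcases exists_iso_objC_or_objM h hM X.2 with h1 | h1
  · exact h1
  · exact absurd ((vertex_eq_of_iso hM (Y := indM h hM) h1).symm.trans e) (vertex_ne h hM)

theorem vertex_cases (v : (repM a b hM).Vertex) :
    v = (repM a b hM).vertex (indM h hM) ∨ v = (repM a b hM).vertex (indC hM) := by
  obtain ⟨X, rfl⟩ := Quotient.exists_rep v
  rcases exists_iso_objC_or_objM h hM X.2 with h1 | h1
  · exact Or.inr (vertex_eq_of_iso hM (Y := indC hM) h1)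
  · exact Or.inl (vertex_eq_of_iso hM (Y := indM h hM) h1)

theorem vertex_eq_indM_iff_projection {X : (repM a b hM).Ind} :
    (repM a b hM).vertex X = (repM a b hM).vertex (indM h hM) ↔
      ¬ IsZero ((projMN a b hK hM).functor.obj X.1) := by
  rw [vertex_eq_indM_iff, projection_isZero_iff]
  constructor
  · rintro ⟨e⟩ hP
    exact not_projC_quotObj h (projC_of_retract (e.symm.retract.map (forgetM hM)) hP)
  · intro hX
    rcases exists_iso_objC_or_objM h hM X.2 with ⟨⟨e⟩⟩ | h1
    · exact absurd (projC_of_retract (e.retract.map (forgetM hM))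
        (projC_iff.2 (Dominated.of rfl))) hX
    · exact h1

include h in
theorem vertex_eq_indC_iff_inclusion {X : (repM a b hM).Ind} :
    (repM a b hM).vertex X = (repM a b hM).vertex (indC hM) ↔
      ∃ Y : (repK hK).carrier, Nonempty (X.1 ≅ (inclKM a b hK hM).functor.obj Y) := by
  rw [vertex_eq_indC_iff h]
  constructor
  · rintro h1
    exact ⟨objK hK, h1⟩
  · rintro ⟨Y, ⟨e⟩⟩
    rcases exists_iso_objC_or_objM h hM X.2 with h1 | ⟨⟨e'⟩⟩
    · exact h1
    · exact absurd (projC_of_retract ((e'.symm.trans e).retract.map (forgetM hM))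
        (show projC.FullSubcategory from Y).property) (not_projC_quotObj h)

theorem vertex_covBy : (repM a b hM).vertex (indM h hM) ⋖ (repM a b hM).vertex (indC hM) := by
  refine ⟨lt_of_le_of_ne (indM_le_indC h hM) (vertex_ne h hM), fun c h1 h2 => ?_⟩
  rcases vertex_cases h hM c with rfl | rfl
  · exact lt_irrefl _ h1
  · exact lt_irrefl _ h2

include h in
theorem isShortExact : IsShortExact (inclKM a b hK hM) (projMN a b hK hM) where
  two_vertices := by
    have e : (Set.univ : Set (repM a b hM).Vertex) =
        {(repM a b hM).vertex (indM h hM), (repM a b hM).vertex (indC hM)} := by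
      ext v
      simpa using vertex_cases h hM v
    rw [← Nat.card_univ, e, Nat.card_coe_set_eq, Set.ncard_pair (vertex_ne h hM)]
  transitive := by
    have := isLocalRing_end_objK hK
    refine ⟨⟨⟨objK hK, indec_of_isLocalRing⟩⟩, fun X Y => ?_⟩
    obtain ⟨e⟩ := exists_iso_objK X.2
    obtain ⟨e'⟩ := exists_iso_objK Y.2
    exact Ind.le_of_iso (e ≪≫ e'.symm)
  i_full := ObjectProperty.full_ιOfLE (projC_le a b)
  i_faithful := ObjectProperty.faithful_ιOfLE (projC_le a b)
  p_full := inferInstanceAs (CategoryTheory.Quotient.functor _).Full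
  p_essSurj := inferInstanceAs (CategoryTheory.Quotient.functor _).EssSurj
  kernel f := projection_map_eq_zero_iff hK hM f

/-- An indecomposable 1-morphism is one of the six θ_w up to isomorphism. The five with w ≠ e
produce C from M_{a,b}; the identity does not. -/
theorem decoration_eq (hsts : IsSoergel thetaSTS) :
    (repM a b hM).decoration ((repM a b hM).vertex (indM h hM)) ((repM a b hM).vertex (indC hM)) =
      {F | Nonempty (F ≅ S.thS) ∨ Nonempty (F ≅ S.thT) ∨ Nonempty (F ≅ S.thST) ∨
        Nonempty (F ≅ S.thTS) ∨ Nonempty (F ≅ S.thSTS hsts)} := by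
  have key : ∀ F G : S, IsBasicPos G.obj → Nonempty (F ≅ G) →
      F ∈ (repM a b hM).decoration ((repM a b hM).vertex (indM h hM))
        ((repM a b hM).vertex (indC hM)) := by
    rintro F G hG ⟨e⟩
    have := IsBasic.isLocalRing (F := G) (Or.inr hG)
    refine ⟨Indec.of_iso e.symm indec_of_isLocalRing, indM h hM, indC hM, rfl, rfl, ?_⟩
    obtain ⟨r⟩ := hG.retract_quotObj h
    let r' : Retract regC (F.obj.obj (quotObj a b)) := r.trans
      (e.symm.retract.map (ObjectProperty.ι _ ⋙ (CategoryTheory.evaluation ModC ModC).obj (quotObj a b)))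
    exact ⟨⟨liftM hM (X := objC hM) (Y := ((repM a b hM).act F).obj (objM hM)) r'.i,
      liftM hM r'.r, (forgetM hM).map_injective r'.retract⟩⟩
  ext F
  constructor
  · rintro ⟨hF, X, Y, hX, hY, ⟨r⟩⟩
    obtain ⟨⟨G, hGS⟩, hG, e⟩ := S.exists_iso_basic hF
    change IsBasic G at hG
    rcases hG with rfl | rfl | rfl | rfl | rfl | rfl
    -- If F were the identity, C would be a summand of M_{a,b} and, the endomorphism ring of M_{a,b}
    -- being local, isomorphic to it.
    · obtain ⟨e⟩ := e
      obtain ⟨eX⟩ := (vertex_eq_indM_iff h hM).1 hX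
      obtain ⟨eY⟩ := (vertex_eq_indC_iff h hM).1 hY
      have r₁ : Retract regC (F.obj.obj ((forgetM hM).obj X.1)) :=
        (eY.symm.retract.trans r).map (forgetM hM)
      have r₂ : Retract regC (quotObj a b) := r₁.trans ((e.retract.map (ObjectProperty.ι _ ⋙
        (CategoryTheory.evaluation ModC ModC).obj _)).trans (eX.retract.map (forgetM hM)))
      obtain ⟨e'⟩ := iso_of_retract r₂ (@not_isZero_of_isLocalRing _ _ _ _ isLocalRing_end_regC)
        (isLocalRing_end_quotObj h)
      exact (not_iso_quotObj_regC h ⟨e'.symm⟩).elim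
    · exact Or.inl e
    · exact Or.inr (Or.inl e)
    · exact Or.inr (Or.inr (Or.inl e))
    · exact Or.inr (Or.inr (Or.inr (Or.inl e)))
    · exact Or.inr (Or.inr (Or.inr (Or.inr e)))
  · rintro (e | e | e | e | e)
    · exact key F _ (Or.inl rfl) e
    · exact key F _ (Or.inr (Or.inl rfl)) e
    · exact key F _ (Or.inr (Or.inr (Or.inl rfl))) e
    · exact key F _ (Or.inr (Or.inr (Or.inr (Or.inl rfl)))) e
    · exact key F _ (Or.inr (Or.inr (Or.inr (Or.inr rfl)))) e

end Diagram

end SoergelA2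

end

noncomputable section

namespace SoergelA2

open TwoRep

/-! ### Kernels and quotients of morphisms, evaluation, and recognition of cell 2-representations -/

section Morphisms

universe v₁ u₁ v₂ u₂

variable {M : TwoRep.{v₁, u₁}} {N : TwoRep.{v₂, u₂}}

attribute [instance] TwoRep.Hom.additive TwoRep.Hom.linear

/-- The ideal of morphisms annihilated by a `1`-morphism of `2`-representations. -/
def Hom.ker (Φ : Hom M N) : StableIdeal M where
  mem X Y :=
    { carrier := {f | Φ.functor.map f = 0}
      zero_mem' := Functor.map_zero _ _ _
      add_mem' := fun {f g} (hf : Φ.functor.map f = 0) (hg : Φ.functor.map g = 0) => by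
        change Φ.functor.map (f + g) = 0
        rw [Functor.map_add, hf, hg, add_zero]
      smul_mem' := fun c f (hf : Φ.functor.map f = 0) => by
        change Φ.functor.map (c • f) = 0
        rw [CategoryTheory.Functor.Linear.map_smul, hf, smul_zero] }
  comp_left f g (hg : Φ.functor.map g = 0) := by
    change Φ.functor.map (f ≫ g) = 0
    rw [Functor.map_comp, hg, comp_zero]
  comp_right f g (hf : Φ.functor.map f = 0) := by
    change Φ.functor.map (f ≫ g) = 0
    rw [Functor.map_comp, hf, zero_comp]
  act_mem F X Y f (hf : Φ.functor.map f = 0) := by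
    change Φ.functor.map ((M.act F).map f) = 0
    have nat := (Φ.comm F).hom.naturality f
    have h0 : (Φ.functor ⋙ N.act F).map f = 0 := by
      rw [Functor.comp_map, hf, Functor.map_zero]
    rw [h0, comp_zero] at nat
    exact (cancel_mono ((Φ.comm F).hom.app Y)).1 (nat.trans zero_comp.symm)

theorem Hom.mem_ker {Φ : Hom M N} {X Y : M.carrier} {f : X ⟶ Y} :
    f ∈ (Hom.ker Φ).mem X Y ↔ Φ.functor.map f = 0 := Iff.rfl

/-- The `1`-morphism induced on the quotient by an ideal in the kernel. -/
def Hom.descend (Φ : Hom M N) (I : StableIdeal M)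
    (hI : ∀ (X Y : M.carrier) (f : X ⟶ Y), f ∈ I.mem X Y → Φ.functor.map f = 0) :
    Hom (M.quotient I) N where
  functor := CategoryTheory.Quotient.lift I.rel Φ.functor fun X Y f g hfg =>
    sub_eq_zero.1 (Φ.functor.map_sub.symm.trans (hI X Y _ hfg))
  additive := ⟨by
    rintro ⟨X⟩ ⟨Y⟩ ⟨f⟩ ⟨g⟩
    exact Φ.functor.map_add⟩
  linear := ⟨by
    rintro ⟨X⟩ ⟨Y⟩ ⟨f⟩ c
    exact CategoryTheory.Functor.Linear.map_smul (F := Φ.functor) f c⟩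
  comm F := NatIso.ofComponents (fun X => (Φ.comm F).app X.as) (by
    rintro ⟨X⟩ ⟨Y⟩ ⟨f⟩
    exact (Φ.comm F).hom.naturality f)
  comm_naturality α X := Φ.comm_naturality α X.as
  comm_one X := Φ.comm_one X.as
  comm_comp F G X := Φ.comm_comp F G X.as

/-- Composition of a `1`-morphism with the projection onto a quotient. -/
def Hom.toQuotient (Φ : Hom M N) (I : StableIdeal N) : Hom M (N.quotient I) where
  functor := Φ.functor ⋙ CategoryTheory.Quotient.functor I.rel
  additive := ⟨(congrArg (CategoryTheory.Quotient.functor I.rel).map Φ.functor.map_add).trans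
    (CategoryTheory.Quotient.functor I.rel).map_add⟩
  linear := ⟨fun f c => (congrArg (CategoryTheory.Quotient.functor I.rel).map
    (CategoryTheory.Functor.Linear.map_smul (F := Φ.functor) f c)).trans
    (CategoryTheory.Functor.Linear.map_smul (F := CategoryTheory.Quotient.functor I.rel)
      (Φ.functor.map f) c)⟩
  comm F := NatIso.ofComponents
    (fun X => (CategoryTheory.Quotient.functor I.rel).mapIso ((Φ.comm F).app X)) fun {X Y} f =>
      congrArg (CategoryTheory.Quotient.functor I.rel).map ((Φ.comm F).hom.naturality f)
  comm_naturality α X :=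
    congrArg (CategoryTheory.Quotient.functor I.rel).map (Φ.comm_naturality α X)
  comm_one X := by
    refine HEq.trans (heq_functor_map I.rel (congrArg Φ.functor.obj (Functor.congr_obj M.act_one X))
      (Functor.congr_obj N.act_one (Φ.functor.obj X)) (Φ.comm_one X)) (heq_of_eq ?_)
    exact (CategoryTheory.Quotient.functor I.rel).map_id _
  comm_comp F G X :=
    heq_functor_map I.rel (congrArg Φ.functor.obj (Functor.congr_obj (M.act_comp F G) X))
      (Functor.congr_obj (N.act_comp F G) (Φ.functor.obj X)) (Φ.comm_comp F G X)

end Morphisms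

section Evaluation

/-- Evaluation of `1`-morphisms at a fixed module. -/
def evalHom (F : S) (X : ModC) {P : ObjectProperty ModC} (hP : natural.Stable P)
    (hX : ∀ G : S, leftLE F G → P (G.obj.obj X)) : Hom (leftIdeal F) (natural.sub P hP) where
  functor := P.lift (ObjectProperty.ι (leftLE F) ⋙ ObjectProperty.ι _ ⋙
    (CategoryTheory.evaluation ModC ModC).obj X) fun G => hX G.obj G.property
  additive := ⟨rfl⟩
  linear := ⟨fun _ _ => rfl⟩
  comm H := NatIso.ofComponents (fun G => Iso.refl _) fun {G G'} β => by
    refine (Category.comp_id _).trans (Eq.trans ?_ (Category.id_comp _).symm)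
    exact ObjectProperty.hom_ext _ (S.hcomp_left H β.hom X)
  comm_naturality {H H'} α G := by
    refine (Category.comp_id _).trans (Eq.trans ?_ (Category.id_comp _).symm)
    exact ObjectProperty.hom_ext _ (S.hcomp_right α G.obj X)
  comm_one G := HEq.rfl
  comm_comp H H' G := by
    let Y : P.FullSubcategory := ⟨H'.obj.obj (G.obj.obj.obj X), hP H' _ (hX G.obj G.property)⟩
    exact heq_of_eq ((Category.id_comp (((natural.sub P hP).act H).map (𝟙 Y))).trans
      (((natural.sub P hP).act H).map_id Y)).symm

end Evaluation

section Cells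

universe v₁ u₁

theorem leftLE_refl (F : S) : leftLE F F := ⟨S.one, ⟨Retract.refl F⟩⟩

/-- `F` as an object of the `2`-representation it generates. -/
def leftGen (F : S) : (leftIdeal F).carrier := (⟨F, leftLE_refl F⟩ : ObjectProperty.FullSubcategory (leftLE F))

/-- For G in the left cell, F is a summand of some H ∘ G, so a stable ideal containing the identity
of G contains that of F. -/
theorem isProperIdeal_iff {F : S} (hF : Indec F) (J : StableIdeal (leftIdeal F)) :
    IsProperIdeal F J ↔ 𝟙 (leftGen F) ∉ J.mem (leftGen F) (leftGen F) := by
  constructor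
  · exact fun h => h (leftGen F) ⟨hF, leftLE_refl F, leftLE_refl F⟩
  · rintro h G ⟨_, _, H, ⟨r⟩⟩ hG
    refine h ?_
    have h1 := J.act_mem H _ hG
    rw [CategoryTheory.Functor.map_id] at h1
    let i : leftGen F ⟶ ((leftIdeal F).act H).obj G := ObjectProperty.homMk r.i
    let k : ((leftIdeal F).act H).obj G ⟶ leftGen F := ObjectProperty.homMk r.r
    have h2 := J.comp_left i _ (J.comp_right _ k h1)
    rw [Category.id_comp] at h2
    have h3 : i ≫ k = 𝟙 (leftGen F) := ObjectProperty.hom_ext _ r.retract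
    exact h3 ▸ h2

/-- The kernel of Φ is proper because Φ(F) ≠ 0, and by `hJ` it contains every proper ideal. It is
therefore the maximal ideal, and Φ descends to a faithful functor on the cell 2-representation. -/
theorem equivalent_cellRep {F : S} (hF : Indec F) {N : TwoRep.{v₁, u₁}} (Φ : Hom (leftIdeal F) N)
    (h0 : ¬ IsZero (Φ.functor.obj (leftGen F)))
    (hJ : ∀ J : StableIdeal (leftIdeal F), 𝟙 (leftGen F) ∉ J.mem (leftGen F) (leftGen F) →
      ∀ (X Y : (leftIdeal F).carrier) (f : X ⟶ Y), f ∈ J.mem X Y → Φ.functor.map f = 0)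
    (full : ∀ (X Y : (leftIdeal F).carrier) (f : Φ.functor.obj X ⟶ Φ.functor.obj Y),
      ∃ g, Φ.functor.map g = f)
    (ess : ∀ Y : N.carrier, ∃ X, Nonempty (Φ.functor.obj X ≅ Y)) :
    Equivalent (cellRep F) N := by
  have hmax : ∀ (X Y : (leftIdeal F).carrier) (f : X ⟶ Y),
      f ∈ (maximalIdeal F).mem X Y ↔ Φ.functor.map f = 0 := by
    intro X Y f
    constructor
    · intro hf
      refine (Submodule.mem_iInf _).1 hf ⟨Hom.ker Φ, ?_⟩
      rintro X Y f ⟨J, hJ', hf⟩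
      exact hJ J ((isProperIdeal_iff hF J).1 hJ') X Y f hf
    · intro hf
      refine (Submodule.mem_iInf _).2 fun I => I.2 X Y f ⟨Hom.ker Φ, ?_, hf⟩
      refine (isProperIdeal_iff hF _).2 fun h1 => h0 ?_
      rw [Hom.mem_ker, CategoryTheory.Functor.map_id] at h1
      exact (IsZero.iff_id_eq_zero _).2 h1
  let Ψ := Hom.descend Φ (maximalIdeal F) fun X Y f => (hmax X Y f).1
  refine ⟨Ψ, ?_⟩
  have hfaithful : Ψ.functor.Faithful := ⟨by
    rintro ⟨X⟩ ⟨Y⟩ ⟨f⟩ ⟨g⟩ hfg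
    refine CategoryTheory.Quotient.sound _ ((hmax X Y (f - g)).2 ?_)
    rw [Functor.map_sub]
    exact sub_eq_zero.2 hfg⟩
  have hfull : Ψ.functor.Full := ⟨by
    rintro ⟨X⟩ ⟨Y⟩ f
    obtain ⟨g, hg⟩ := full X Y f
    exact ⟨(CategoryTheory.Quotient.functor _).map g, hg⟩⟩
  have hess : Ψ.functor.EssSurj := ⟨fun Y => by
    obtain ⟨X, e⟩ := ess Y
    exact ⟨⟨X⟩, e⟩⟩
  exact { faithful := hfaithful, full := hfull, essSurj := hess }

/-- If X is a summand of H ∘ F and Y of K ∘ F, then X ⊕ Y is a summand of (H ⊞ K) ∘ F. -/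
theorem hasFiniteBiproducts_leftIdeal (F : S) : HasFiniteBiproducts (leftIdeal F).carrier := by
  obtain ⟨Z, hZ⟩ := (hasZeroObject_of_hasFiniteBiproducts S).zero
  have : HasBinaryBiproducts S := hasBinaryBiproducts_of_finite_biproducts S
  refine hasFiniteBiproducts_fullSubcategory (A := S) (P := leftLE F)
    ⟨Z, hZ, S.one, ⟨hZ.retract F⟩⟩ ?_
  rintro X Y b hb ⟨H, ⟨r⟩⟩ ⟨K, ⟨s⟩⟩
  refine ⟨H ⊞ K, ⟨⟨b.fst ≫ r.i ≫ S.hcomp biprod.inl (𝟙 F) + b.snd ≫ s.i ≫ S.hcomp biprod.inr (𝟙 F),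
    S.hcomp biprod.fst (𝟙 F) ≫ r.r ≫ b.inl + S.hcomp biprod.snd (𝟙 F) ≫ s.r ≫ b.inr, ?_⟩⟩⟩
  have hc : ∀ {G G' G'' : S} (α : G ⟶ G') (β : G' ⟶ G''),
      S.hcomp α (𝟙 F) ≫ S.hcomp β (𝟙 F) = S.hcomp (α ≫ β) (𝟙 F) := fun α β =>
    S.hom_ext_app fun X => (congrArg₂ (· ≫ ·) (S.hcomp_right α F X) (S.hcomp_right β F X)).trans
      (S.hcomp_right (α ≫ β) F X).symm
  have hid : ∀ G : S, S.hcomp (𝟙 G) (𝟙 F) = 𝟙 (S.comp G F) := fun G =>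
    S.hom_ext_app fun X => S.hcomp_right (𝟙 G) F X
  have hzero : ∀ G G' : S, S.hcomp (0 : G ⟶ G') (𝟙 F) = 0 := fun G G' =>
    S.hom_ext_app fun X => S.hcomp_right 0 F X
  simp only [Preadditive.add_comp, Preadditive.comp_add, Category.assoc]
  have e1 : S.hcomp (biprod.inl : H ⟶ H ⊞ K) (𝟙 F) ≫ S.hcomp biprod.fst (𝟙 F) = 𝟙 _ := by
    rw [hc, biprod.inl_fst, hid]
  have e2 : S.hcomp (biprod.inr : K ⟶ H ⊞ K) (𝟙 F) ≫ S.hcomp biprod.snd (𝟙 F) = 𝟙 _ := by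
    rw [hc, biprod.inr_snd, hid]
  have e3 : S.hcomp (biprod.inl : H ⟶ H ⊞ K) (𝟙 F) ≫ S.hcomp biprod.snd (𝟙 F) = 0 := by
    rw [hc, biprod.inl_snd, hzero]
  have e4 : S.hcomp (biprod.inr : K ⟶ H ⊞ K) (𝟙 F) ≫ S.hcomp biprod.fst (𝟙 F) = 0 := by
    rw [hc, biprod.inr_fst, hzero]
  rw [reassoc_of% e1, reassoc_of% e2, reassoc_of% e3, reassoc_of% e4, r.retract_assoc,
    s.retract_assoc, zero_comp, zero_comp, comp_zero, comp_zero, comp_zero, comp_zero, add_zero, zero_add]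
  exact IsBilimit.binary_total hb

/-- Reduces essential surjectivity to indecomposable objects. -/
theorem exists_obj_iso_of_bicone {A : Type*} [Category A] [Preadditive A] [HasFiniteBiproducts A]
    {B : Type*} [Category B] [Preadditive B] (Φ : A ⥤ B) [Φ.Additive] {n : ℕ} {f : Fin n → B}
    {b : Bicone f} (hb : b.IsBilimit) (hf : ∀ i, ∃ X, Nonempty (Φ.obj X ≅ f i)) :
    ∃ X, Nonempty (Φ.obj X ≅ b.pt) := by
  choose X e using hf
  let c := biproduct.bicone X
  have hc : c.IsBilimit := biproduct.isBilimit X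
  have tot := congrArg Φ.map (IsBilimit.total hc)
  rw [Functor.map_sum, CategoryTheory.Functor.map_id] at tot
  have hc' : (Φ.mapBicone c).IsBilimit := isBilimitOfTotal (Φ.mapBicone c)
    ((Finset.sum_congr rfl fun i _ => (Φ.map_comp (c.π i) (c.ι i)).symm).trans tot)
  have : HasBiproduct (Φ.obj ∘ X) := HasBiproduct.mk ⟨_, hc'⟩
  have : HasBiproduct f := HasBiproduct.mk ⟨b, hb⟩
  exact ⟨c.pt, ⟨biproduct.uniqueUpToIso _ hc' ≪≫ biproduct.mapIso (fun i => (e i).some) ≪≫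
    (biproduct.uniqueUpToIso _ hb).symm⟩⟩

end Cells

end SoergelA2

end

noncomputable section

namespace SoergelA2

open TwoRep

/-- An additive functor annihilates a morphism between dominated objects if it does so for all
induced morphisms between dominating objects. -/
theorem Dominated.map_eq_zero {A B : Type*} [Category A] [Preadditive A] [Category B]
    [Preadditive B] {P Q : ObjectProperty A} {X Y : A} (Φ : A ⥤ B) [Φ.Additive]
    (hX : Dominated P X) (hY : Dominated Q Y) (f : X ⟶ Y)
    (h : ∀ G H, P G → Q H → ∀ (q : G ⟶ X) (p : Y ⟶ H), Φ.map (q ≫ f ≫ p) = 0) : Φ.map f = 0 := by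
  obtain ⟨ι, _, G, p, q, hG, e⟩ := hX
  obtain ⟨κ, _, H, p', q', hH, e'⟩ := hY
  have key : f = ∑ i, ∑ j, p i ≫ (q i ≫ f ≫ p' j) ≫ q' j := by
    calc f = (∑ i, p i ≫ q i) ≫ f ≫ ∑ j, p' j ≫ q' j := by
          rw [e, e', Category.id_comp, Category.comp_id]
      _ = _ := by
          simp only [Preadditive.sum_comp, Preadditive.comp_sum, Category.assoc]
          exact Finset.sum_comm
  rw [key]
  simp only [Functor.map_sum]
  refine Finset.sum_eq_zero fun i _ => Finset.sum_eq_zero fun j _ => ?_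
  rw [Φ.map_comp, Φ.map_comp, h _ _ (hG i) (hH j), zero_comp, comp_zero]

/-- An object of the `2`-representation generated by `F`. -/
def leftObj {F G : S} (hG : leftLE F G) : (leftIdeal F).carrier :=
  (⟨G, hG⟩ : ObjectProperty.FullSubcategory (leftLE F))

theorem dominated_leftIdeal {F : S} {Q : ObjectProperty S} (hQ : ∀ G, Q G → leftLE F G)
    (X : ObjectProperty.FullSubcategory (C := S) (leftLE F)) (hX : Dominated Q X.obj) :
    Dominated (A := (leftIdeal F).carrier) (fun Y => ∃ (G : S) (hG : leftLE F G),
      Q G ∧ Y = leftObj hG) X := by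
  have h1 : Dominated (fun Y : ObjectProperty.FullSubcategory (C := S) (leftLE F) => Q Y.obj) X :=
    Dominated.fullSubcategory hQ hX
  have h2 : Dominated (fun Y : ObjectProperty.FullSubcategory (C := S) (leftLE F) =>
      ∃ (G : S) (hG : leftLE F G), Q G ∧ Y = leftObj hG) X :=
    h1.mono fun Y hY => ⟨Y.obj, Y.property, hY, rfl⟩
  exact h2

/-! ### The cell 2-representation of θ_e -/

section IdentityCell

theorem indec_one : Indec S.one :=
  @indec_of_isLocalRing _ _ _ _ (IsBasic.isLocalRing (F := S.one) (Or.inl rfl))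

theorem leftLE_one (G : S) : leftLE S.one G := ⟨G, ⟨Retract.refl G⟩⟩

variable {a b : ℂ} (h : Admissible a b) (hK : natural.Stable projC)
  (hM : natural.Stable (projAnd a b))

include h in
/-- Multiplication by a non-unit on `M_{a,b}` factors through `C`. -/
theorem exists_factorization {c : Coinv} (hc : ¬ IsUnit c) :
    ∃ (p : quotObj a b ⟶ regC) (q : regC ⟶ quotObj a b), p ≫ q = scalarEnd (quotObj a b) c := by
  obtain ⟨z, p, q, rfl⟩ := exists_eq_scalar_add h c
  -- ℓ and ℓ' annihilate each other and are nonzero, so they are non-units; in a local ring the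
  -- scalar part of a non-unit must then vanish.
  have hz : z = 0 := by
    by_contra hz
    have h1 : algebraMap ℂ Coinv z ∈ nonunits Coinv := by
      have : algebraMap ℂ Coinv z = (algebraMap ℂ Coinv z + p * ell a b + q * ellDual a b) +
          (-p * ell a b + -q * ellDual a b) := by ring
      rw [this]
      exact IsLocalRing.nonunits_add hc (IsLocalRing.nonunits_add
        (mul_mem_nonunits_right (not_isUnit_ell h)) (mul_mem_nonunits_right (not_isUnit_ell h.symm)))
    exact h1 ((isUnit_iff_ne_zero.2 hz).map _)
  subst hz
  -- Multiplication by ℓ' is well defined from C/(ℓ) to C. As ℓ acts by zero on M, the action of c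
  -- is that of qℓ', which is `φ` followed by 1 ↦ q.
  let φ : quotMod a b →ₗ[Coinv] Coinv := Submodule.liftQ (genIdeal a b)
    (LinearMap.toSpanSingleton Coinv Coinv (ellDual a b)) (by
      rw [genIdeal, Ideal.span, Submodule.span_singleton_le_iff_mem]
      exact ell_mul_ellDual h)
  refine ⟨FGModuleCat.ofHom φ, orbitMap (q • quotGen a b),
    FGModuleCat.hom_ext (LinearMap.ext fun m => ?_)⟩
  obtain ⟨d, rfl⟩ := exists_smul_quotGen m
  have h1 : φ (d • quotGen a b) = d * ellDual a b :=
    (φ.map_smul d (quotGen a b)).trans (congrArg (d * ·) (one_mul (ellDual a b)))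
  refine (congrArg (· • (q • quotGen a b)) h1).trans ?_
  refine Eq.trans ?_ (scalarEnd_apply _ (d • quotGen a b)).symm
  have h2 : (p * ell a b) • (d • quotGen a b) = 0 := by
    rw [mul_smul, ell_smul_quotObj, smul_zero]
  rw [map_zero, zero_add, add_smul, h2, zero_add, smul_smul, smul_smul]
  congr 1
  ring

theorem dominated_leftIdeal_one (X : (leftIdeal S.one).carrier) :
    Dominated (fun Y : (leftIdeal S.one).carrier => Y = leftGen S.one ∨
      ∃ G : S, IsBasicPos G.obj ∧ Y = leftObj (leftLE_one G)) X :=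
  (dominated_leftIdeal (Q := fun G : S => IsBasic G.obj) (fun G _ => leftLE_one G) X
    (S.dominated _)).mono (by
      rintro _ ⟨⟨G, hG⟩, _, h, rfl⟩
      rcases h with h | h
      · obtain rfl : G = 𝟭 ModC := h
        exact Or.inl rfl
      · exact Or.inr ⟨⟨G, hG⟩, h, rfl⟩)

/-- Evaluation at `M_{a,b}`, with values in `N`. -/
def evalQuot : Hom (leftIdeal S.one) (repN a b hK hM) :=
  Hom.toQuotient (N := repM a b hM) (evalHom S.one (quotObj a b) hM fun G _ =>
    hM G _ (projAnd_iff.2 (Dominated.of (Or.inr rfl)))) (kernelIdeal hK hM)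

/-- Multiplication by a scalar as an endomorphism of the identity. -/
def scalarOne (c : Coinv) : leftGen S.one ⟶ leftGen S.one :=
  ObjectProperty.homMk (P := leftLE S.one) (ObjectProperty.homMk (P := IsSoergel)
    (show 𝟭 ModC ⟶ 𝟭 ModC from leftMul (𝟭 ModC) c))

/-- A natural endomorphism of the identity is determined by its value at 1 ∈ C. -/
theorem exists_eq_scalarOne (f : leftGen S.one ⟶ leftGen S.one) : ∃ c, f = scalarOne c := by
  let f' : 𝟭 ModC ⟶ 𝟭 ModC := InducedCategory.Hom.hom (InducedCategory.Hom.hom f)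
  refine ⟨(f'.app regC).hom.hom (1 : Coinv), ?_⟩
  refine ObjectProperty.hom_ext (leftLE S.one) (ObjectProperty.hom_ext IsSoergel
    (isGenerator_id.nat_ext ?_))
  exact (mul_one (M := Coinv) ((f'.app regC).hom.hom (1 : Coinv))).symm

include h in
theorem isZero_evalQuot {G : S} (hG : IsBasicPos G.obj) : IsZero ((evalQuot hK hM).functor.obj
    (leftObj (leftLE_one G))) :=
  (projection_isZero_iff hK hM (X := ((repM a b hM).act G).obj (objM hM))).2 (hG.projC_quotObj h)

-- Every θ_w with w ≠ e evaluates to a projective, hence to zero in N. Only endomorphisms of the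
-- identity remain, that is, elements of C; those in a proper ideal are non-units and act on M_{a,b}
-- through C.
include h in
theorem equivalent_cellRep_one : Equivalent (cellRep S.one) (repN a b hK hM) := by
  refine equivalent_cellRep indec_one (evalQuot hK hM) (not_isZero_projection_objM hK hM h)
    ?_ ?_ ?_
  · intro J hJ X Y f hf
    refine Dominated.map_eq_zero (evalQuot hK hM).functor (dominated_leftIdeal_one X)
      (dominated_leftIdeal_one Y) f ?_
    rintro G H (rfl | ⟨G, hG, rfl⟩) hH q p
    · rcases hH with rfl | ⟨H, hH, rfl⟩
      · have hm : q ≫ f ≫ p ∈ J.mem (leftGen S.one) (leftGen S.one) :=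
          J.comp_left q _ (J.comp_right f p hf)
        obtain ⟨c, hc⟩ := exists_eq_scalarOne (q ≫ f ≫ p)
        rw [hc] at hm ⊢
        refine (projection_map_eq_zero_iff hK hM _).2 ((mem_kernelIdeal_iff hK hM _).2
          ⟨regC, projC_iff.2 (Dominated.of rfl), exists_factorization h fun hu => hJ ?_⟩)
        obtain ⟨d, hd⟩ := hu.exists_right_inv
        have h1 : scalarOne d ≫ scalarOne c = 𝟙 (leftGen S.one) :=
          ObjectProperty.hom_ext (leftLE S.one) (ObjectProperty.hom_ext IsSoergel
            ((map_mul (leftMul (𝟭 ModC)) c d).symm.trans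
              ((congrArg (leftMul (𝟭 ModC)) hd).trans (map_one (leftMul (𝟭 ModC))))))
        exact h1 ▸ J.comp_left (scalarOne d) _ hm
      · exact (isZero_evalQuot h hK hM hH).eq_of_tgt _ _
    · exact (isZero_evalQuot h hK hM hG).eq_of_src _ _
  · intro X Y f
    refine Dominated.exists_map_eq (evalQuot hK hM).functor (dominated_leftIdeal_one X)
      (dominated_leftIdeal_one Y) ?_ f
    rintro G H (rfl | ⟨G, hG, rfl⟩) hH f
    · rcases hH with rfl | ⟨H, hH, rfl⟩
      · obtain ⟨c, hc⟩ := scalarN_surjective hK hM f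
        exact ⟨scalarOne c, hc⟩
      · exact ⟨0, (isZero_evalQuot h hK hM hH).eq_of_tgt _ _⟩
    · exact ⟨0, (isZero_evalQuot h hK hM hG).eq_of_src _ _⟩
  · intro Y
    have := hasFiniteBiproducts_leftIdeal S.one
    have := (finitary_repN hK hM h).idempotentSplit
    obtain ⟨n, f, b, ⟨hb⟩, ⟨e⟩, hf⟩ := exists_decomposition (by
      rintro _ rfl
      exact isLocalRing_end_projection_objM hK hM h) (dominated_repN hK hM Y)
    obtain ⟨X, ⟨e'⟩⟩ := exists_obj_iso_of_bicone (evalQuot hK hM).functor hb fun i =>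
      ⟨leftGen S.one, ⟨eqToIso (hf i).symm⟩⟩
    exact ⟨X, ⟨e' ≪≫ e⟩⟩

end IdentityCell

end SoergelA2

end

noncomputable section

namespace SoergelA2

open TwoRep

/-! ### The residue field and the cell 2-representation of θ_{sts} -/

section ResidueField

/-- The augmentation of `C`. -/
def augmentation : Coinv →ₐ[ℂ] ℂ := (TrivSqZeroExt.fstHom ℂ ℂ (ℂ × ℂ)).comp linearPart

/-- The residue field of `C`. -/
abbrev Residue : Type := Coinv ⧸ RingHom.ker augmentation

/-- The residue field as an object of `C`-mod. -/
def residueObj : ModC := FGModuleCat.of Coinv Residue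

/-- The generator of the residue field. -/
def residueGen : residueObj := (Ideal.Quotient.mk (RingHom.ker augmentation) 1 : Residue)

/-- A `ℂ`-linear form on a module, with values in the subalgebra of scalars. -/
def scalarForm {M : Type} [AddCommGroup M] [Module Coinv M] (f : M →+ ℂ)
    (hf : ∀ (z : ℂ) (m : M), f (algebraMap ℂ Coinv z • m) = z * f m) :
    M →ₗ[(⊥ : Subalgebra ℂ Coinv)] (⊥ : Subalgebra ℂ Coinv) where
  toFun m := algebraMap ℂ _ (f m)
  map_add' m m' := by rw [map_add, map_add]
  map_smul' := by
    rintro ⟨c, hc⟩ m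
    obtain ⟨z, rfl⟩ := Algebra.mem_bot.1 hc
    have h1 : f ((⟨algebraMap ℂ Coinv z, hc⟩ : (⊥ : Subalgebra ℂ Coinv)) • m) = z * f m := hf z m
    rw [h1, map_mul]
    rfl

theorem coe_scalarForm {M : Type} [AddCommGroup M] [Module Coinv M] (f : M →+ ℂ) (hf) (m : M) :
    (scalarForm f hf m : Coinv) = algebraMap ℂ Coinv (f m) := rfl

/-- The isomorphism of the residue field with `ℂ`. -/
def residueForm : Residue →ₗ[(⊥ : Subalgebra ℂ Coinv)] (⊥ : Subalgebra ℂ Coinv) :=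
  scalarForm (Ideal.Quotient.lift (RingHom.ker augmentation) augmentation.toRingHom
    fun _ h => h).toAddMonoidHom fun z m => by
      obtain ⟨c, rfl⟩ := Ideal.Quotient.mk_surjective m
      exact (map_mul augmentation (algebraMap ℂ Coinv z) c).trans
        (congrArg (· * augmentation c) (augmentation.commutes z))

theorem residueForm_smul (m : residueObj) : (residueForm m : Coinv) • residueGen = m := by
  obtain ⟨c, rfl⟩ := Ideal.Quotient.mk_surjective (I := RingHom.ker augmentation) m
  change Ideal.Quotient.mk (RingHom.ker augmentation) (algebraMap ℂ Coinv (augmentation c) * 1) = _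
  rw [Ideal.Quotient.eq, mul_one]
  change augmentation _ = 0
  rw [map_sub, augmentation.commutes]
  exact sub_self _

theorem residueGen_ne_zero : residueGen ≠ 0 := by
  intro h
  have h1 : (1 : Coinv) ∈ RingHom.ker augmentation := Ideal.Quotient.eq_zero_iff_mem.1 h
  have h2 : augmentation 1 = 0 := h1
  rw [map_one] at h2
  exact one_ne_zero h2

theorem projC_theta_residue : projC (thetaSTS.obj residueObj) :=
  projC_theta_of_retraction (A := ⊥) (X := residueObj) residueForm (x := residueGen) residueForm_smul

/-- The generator of `θ_{sts}` of the residue field. -/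
def residueTensor : thetaSTS.obj residueObj :=
  ((1 : Coinv) ⊗ₜ residueGen : Coinv ⊗[(⊥ : Subalgebra ℂ Coinv)] residueObj)

theorem residueTensor_ne_zero : residueTensor ≠ 0 := by
  intro h
  have h1 : mulMap ⊥ residueObj residueTensor = residueGen := one_smul Coinv residueGen
  rw [h] at h1
  exact residueGen_ne_zero (h1.symm.trans (map_zero (mulMap ⊥ residueObj)))

theorem exists_smul_residueTensor (y : thetaSTS.obj residueObj) :
    ∃ c : Coinv, c • residueTensor = y := by
  have key : ∀ y : Coinv ⊗[(⊥ : Subalgebra ℂ Coinv)] residueObj, ∃ c : Coinv,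
      c • ((1 : Coinv) ⊗ₜ[(⊥ : Subalgebra ℂ Coinv)] residueGen) = y := by
    intro y
    induction y using TensorProduct.induction_on with
    | zero => exact ⟨0, zero_smul Coinv ((1 : Coinv) ⊗ₜ[(⊥ : Subalgebra ℂ Coinv)] residueGen)⟩
    | add y z hy hz =>
      obtain ⟨c, rfl⟩ := hy
      obtain ⟨d, rfl⟩ := hz
      exact ⟨c + d, add_smul _ _ _⟩
    | tmul r m =>
      refine ⟨(residueForm m : Coinv) * r, ?_⟩
      rw [smul_theta_tmul, mul_one, ← tmul_coe_smul, residueForm_smul]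
  exact key y

theorem isLocalRing_end_theta_residue : IsLocalRing (End (thetaSTS.obj residueObj)) :=
  isLocalRing_end_of_cyclic residueTensor_ne_zero exists_smul_residueTensor

end ResidueField

section BigCell

variable (hsts : IsSoergel thetaSTS) (hK : natural.Stable projC)

theorem isLocalRing_end_thSTS : IsLocalRing (End (S.thSTS hsts)) :=
  IsBasic.isLocalRing (Or.inr (Or.inr (Or.inr (Or.inr (Or.inr rfl)))))

theorem indec_thSTS : Indec (S.thSTS hsts) :=
  @indec_of_isLocalRing _ _ _ _ (isLocalRing_end_thSTS hsts)

/-- θ_{sts} absorbs every θ_w composed on its left, so its left ideal is additively generated by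
θ_{sts} alone. -/
theorem IsBasic.comp_thetaSTS {F : ModC ⥤ ModC} (hF : IsBasic F) :
    Dominated (· = thetaSTS) (thetaSTS ⋙ F) := by
  have hS : Dominated (· = thetaSTS) (thetaSTS ⋙ thetaS) :=
    dominated_theta_comp_right bot_le coordsS.dualBasis
  have hT : Dominated (· = thetaSTS) (thetaSTS ⋙ thetaT) :=
    dominated_theta_comp_right bot_le coordsT.dualBasis
  have : thetaS.Additive := theta_additive _
  have : thetaT.Additive := theta_additive _
  rcases hF with rfl | rfl | rfl | rfl | rfl | rfl
  · exact Dominated.of rfl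
  · exact hS
  · exact hT
  · exact dominated_postcomp thetaS hT (by rintro _ rfl; exact hS)
  · exact dominated_postcomp thetaT hS (by rintro _ rfl; exact hT)
  · exact dominated_theta_theta (A := ⊥) botDualBasis

theorem dominated_leftIdeal_thSTS (X : (leftIdeal (S.thSTS hsts)).carrier) :
    Dominated (fun Y => Y = leftGen (S.thSTS hsts)) X := by
  let X' : ObjectProperty.FullSubcategory (C := S) (leftLE (S.thSTS hsts)) := X
  have h1 : Dominated (· = S.thSTS hsts) X'.obj := by
    obtain ⟨H, ⟨r⟩⟩ := X'.property
    refine Dominated.retract r ?_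
    refine (Dominated.fullSubcategory (A := ModC ⥤ ModC) (P := IsSoergel)
      (X := S.comp H (S.thSTS hsts)) (Q := (· = thetaSTS)) (by rintro _ rfl; exact hsts)
      (dominated_precomp thetaSTS H.property.dominated fun K hK => hK.comp_thetaSTS)).mono ?_
    rintro ⟨G, hG⟩ h
    obtain rfl : G = thetaSTS := h
    rfl
  refine (dominated_leftIdeal (Q := (· = S.thSTS hsts)) (by
    rintro _ rfl
    exact leftLE_refl _) X h1).mono ?_
  rintro _ ⟨_, _, rfl, rfl⟩
  rfl

/-- Evaluation at the residue field. -/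
def evalResidue : Hom (leftIdeal (S.thSTS hsts)) (repK hK) :=
  evalHom (S.thSTS hsts) residueObj hK (by
    rintro G ⟨H, ⟨r⟩⟩
    exact projC_of_retract (r.map (ObjectProperty.ι IsSoergel ⋙
      (CategoryTheory.evaluation ModC ModC).obj residueObj))
      (hK H _ projC_theta_residue))

/-- The forgetful functor from `K` to `C`-mod. -/
def forgetK : (repK hK).carrier ⥤ ModC := projC.ι

instance : (forgetK hK).Faithful := inferInstanceAs projC.ι.Faithful

/-- The functors underlying the objects of a left ideal. -/
def forgetLeft (F : S) : (leftIdeal F).carrier ⥤ (ModC ⥤ ModC) :=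
  ObjectProperty.ι (leftLE F) ⋙ ObjectProperty.ι IsSoergel

/-- The natural transformation underlying an endomorphism of `θ_{sts}`. -/
def natSTS (f : leftGen (S.thSTS hsts) ⟶ leftGen (S.thSTS hsts)) : thetaSTS ⟶ thetaSTS :=
  (forgetLeft (S.thSTS hsts)).map f

/-- An endomorphism of `θ_{sts}` from a natural transformation. -/
def homSTS (f : thetaSTS ⟶ thetaSTS) : leftGen (S.thSTS hsts) ⟶ leftGen (S.thSTS hsts) :=
  ObjectProperty.homMk (P := leftLE (S.thSTS hsts)) (ObjectProperty.homMk (P := IsSoergel) f)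

/-- Evaluation of an endomorphism of `θ_{sts}` at the generator. -/
def evalGen (f : thetaSTS ⟶ thetaSTS) : thetaSTS.obj residueObj :=
  (f.app residueObj).hom.hom residueTensor

/-- θ_{sts} of the residue field is cyclic, so a map out of it vanishes once it kills the generator.
-/
theorem evalResidue_eq_zero_iff (f : leftGen (S.thSTS hsts) ⟶ leftGen (S.thSTS hsts)) :
    (evalResidue hsts hK).functor.map f = 0 ↔ evalGen (natSTS hsts f) = 0 := by
  have h1 : (evalResidue hsts hK).functor.map f = 0 ↔ (natSTS hsts f).app residueObj = 0 :=
    ⟨fun h => congrArg (forgetK hK).map h, fun h => (forgetK hK).map_injective h⟩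
  rw [h1]
  constructor
  · exact fun h => congrArg (fun g => g.hom.hom residueTensor) h
  · intro h
    refine FGModuleCat.hom_ext (LinearMap.ext fun y => ?_)
    obtain ⟨c, rfl⟩ := exists_smul_residueTensor y
    exact (((natSTS hsts f).app residueObj).hom.hom.map_smul c residueTensor).trans
      ((congrArg (c • ·) h).trans (smul_zero c))

/-- The inclusion `θ_{sts} ⟶ θ_{sts} θ_{sts}`. -/
def unitSTS : thetaSTS ⟶ thetaSTS ⋙ thetaSTS :=
  natIndMap ⊥ (F := 𝟭 _) (G := thetaSTS) (fun X => insTmul ⊥ X 1)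
    (fun _ b x => insTmul_smul b.2 1 x) (fun _ _ _ _ => rfl)

/-- The projection `θ_{sts} θ_{sts} ⟶ θ_{sts}` given by a linear form. -/
def contractSTS (φ : Coinv →ₗ[(⊥ : Subalgebra ℂ Coinv)] (⊥ : Subalgebra ℂ Coinv)) :
    thetaSTS ⋙ thetaSTS ⟶ thetaSTS :=
  natIndMap ⊥ (F := thetaSTS) (G := 𝟭 _) (fun X => contract φ X)
    (fun _ b x => contract_smul φ b.2 x) (fun _ _ f x => contract_natural φ f.hom.hom x)

/-- The composite sends r ⊗ x to r ⊗ (φ ⊗ id)(f(1 ⊗ x)). At the residue field f(1 ⊗ x) = c ⊗ x, and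
φ(c) = 1 returns the generator. -/
theorem evalGen_contract {f : thetaSTS ⟶ thetaSTS} {c : Coinv} (hc : c • residueTensor = evalGen f)
    {φ : Coinv →ₗ[(⊥ : Subalgebra ℂ Coinv)] (⊥ : Subalgebra ℂ Coinv)} (hφ : (φ c : Coinv) = 1) :
    evalGen (unitSTS ≫ Functor.whiskerRight f thetaSTS ≫ contractSTS φ) = residueTensor := by
  have e1 : (unitSTS.app residueObj).hom.hom residueTensor =
      ((1 : Coinv) ⊗ₜ residueTensor : Coinv ⊗[(⊥ : Subalgebra ℂ Coinv)] (thetaSTS.obj residueObj)) :=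
    natIndMap_app ⊥ (F := 𝟭 _) (G := thetaSTS) (fun X => insTmul ⊥ X 1)
      (fun _ b x => insTmul_smul b.2 1 x) (fun _ _ _ _ => rfl) residueObj 1 residueGen
  have e2 : ∀ y : thetaSTS.obj residueObj, ((contractSTS φ).app residueObj).hom.hom
      ((1 : Coinv) ⊗ₜ y : Coinv ⊗[(⊥ : Subalgebra ℂ Coinv)] (thetaSTS.obj residueObj)) =
      ((1 : Coinv) ⊗ₜ contract φ residueObj y : Coinv ⊗[(⊥ : Subalgebra ℂ Coinv)] residueObj) :=
    fun y => natIndMap_app ⊥ (F := thetaSTS) (G := 𝟭 _) (fun X => contract φ X)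
      (fun _ b x => contract_smul φ b.2 x) (fun _ _ f x => contract_natural φ f.hom.hom x)
      residueObj 1 y
  have e3 : contract φ residueObj (evalGen f) = residueGen := by
    rw [← hc]
    have : c • residueTensor =
        (c ⊗ₜ residueGen : Coinv ⊗[(⊥ : Subalgebra ℂ Coinv)] residueObj) :=
      (smul_theta_tmul ⊥ c 1 residueGen).trans (by rw [mul_one])
    refine (congrArg (contract φ residueObj) this).trans ?_
    rw [contract_tmul, hφ, one_smul]
  refine (congrArg (fun y => ((contractSTS φ).app residueObj).hom.hom
    ((thetaSTS.map (f.app residueObj)).hom.hom y)) e1).trans ?_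
  refine (e2 (evalGen f)).trans ?_
  rw [e3]
  rfl

/-- A stable ideal which contains an endomorphism of `θ_{sts}` not vanishing at the residue field
contains an endomorphism which is the identity there. -/
theorem exists_evalGen_eq (J : StableIdeal (leftIdeal (S.thSTS hsts)))
    {f : leftGen (S.thSTS hsts) ⟶ leftGen (S.thSTS hsts)} (hf : f ∈ J.mem _ _)
    (h0 : evalGen (natSTS hsts f) ≠ 0) :
    ∃ g ∈ J.mem (leftGen (S.thSTS hsts)) (leftGen (S.thSTS hsts)),
      evalGen (natSTS hsts g) = residueTensor := by
  obtain ⟨c, hc⟩ := exists_smul_residueTensor (evalGen (natSTS hsts f))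
  have hc0 : c ≠ 0 := by
    rintro rfl
    exact h0 (hc.symm.trans (zero_smul Coinv residueTensor))
  -- The value of f at the generator is c times the generator with c ≠ 0, possibly a non-unit. A
  -- ℂ-linear form normalises it where division in C could not, and it enters through a map
  -- θ_{sts}θ_{sts} ⟶ θ_{sts}.
  obtain ⟨l, hl⟩ : ∃ l : Coinv →ₗ[ℂ] ℂ, l c = 1 := by
    obtain ⟨l, hl⟩ : ∃ l : Module.Dual ℂ Coinv, l c ≠ 0 := by
      by_contra! h
      exact hc0 ((Module.forall_dual_apply_eq_zero_iff ℂ c).1 h)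
    exact ⟨(l c)⁻¹ • l, inv_mul_cancel₀ hl⟩
  let φ := scalarForm l.toAddMonoidHom fun z m => by
    change l (algebraMap ℂ Coinv z * m) = _
    rw [← coinv_smul]
    exact l.map_smul z m
  have hφ : (φ c : Coinv) = 1 := by
    refine (coe_scalarForm _ _ _).trans ?_
    change algebraMap ℂ Coinv (l c) = 1
    rw [hl, map_one]
  let i : leftGen (S.thSTS hsts) ⟶
      ((leftIdeal (S.thSTS hsts)).act (S.thSTS hsts)).obj (leftGen (S.thSTS hsts)) :=
    ObjectProperty.homMk (P := leftLE (S.thSTS hsts)) (ObjectProperty.homMk (P := IsSoergel) unitSTS)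
  let k : ((leftIdeal (S.thSTS hsts)).act (S.thSTS hsts)).obj (leftGen (S.thSTS hsts)) ⟶
      leftGen (S.thSTS hsts) :=
    ObjectProperty.homMk (P := leftLE (S.thSTS hsts)) (ObjectProperty.homMk (P := IsSoergel) (contractSTS φ))
  refine ⟨i ≫ ((leftIdeal (S.thSTS hsts)).act (S.thSTS hsts)).map f ≫ k,
    J.comp_left i _ (J.comp_right _ k (J.act_mem _ f hf)), ?_⟩
  refine Eq.trans (congrArg evalGen (NatTrans.ext (funext fun X => ?_))) (evalGen_contract hc hφ)
  exact congrArg (fun t => unitSTS.app X ≫ t ≫ (contractSTS φ).app X)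
    (S.hcomp_left (S.thSTS hsts) (show S.thSTS hsts ⟶ S.thSTS hsts from
      ObjectProperty.homMk (P := IsSoergel) (natSTS hsts f)) X)

/-- Evaluation at the residue field sends θ_{sts} to an indecomposable projective. Fullness uses
left multiplications by C, which realise all endomorphisms of a cyclic module, and
`exists_evalGen_eq` shows that proper ideals are killed. -/
theorem equivalent_cellRep_thSTS : Equivalent (cellRep (S.thSTS hsts)) (repK hK) := by
  have hloc : IsLocalRing (End ((evalResidue hsts hK).functor.obj (leftGen (S.thSTS hsts)))) :=
    isLocalRing_end_fullSubcategory (P := projC) _ isLocalRing_end_theta_residue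
  have hloc' : IsLocalRing (End (leftGen (S.thSTS hsts))) :=
    isLocalRing_end_fullSubcategory (P := leftLE (S.thSTS hsts)) _ (isLocalRing_end_thSTS hsts)
  refine equivalent_cellRep (indec_thSTS hsts) (evalResidue hsts hK)
    (not_isZero_of_isLocalRing) ?_ ?_ ?_
  · intro J hJ X Y f hf
    refine Dominated.map_eq_zero (evalResidue hsts hK).functor (dominated_leftIdeal_thSTS hsts X)
      (dominated_leftIdeal_thSTS hsts Y) f ?_
    rintro _ _ rfl rfl q p
    by_contra h0
    obtain ⟨g, hg, hgx⟩ := exists_evalGen_eq hsts J (J.comp_left q _ (J.comp_right f p hf))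
      (fun h => h0 ((evalResidue_eq_zero_iff hsts hK _).2 h))
    let g' : End (leftGen (S.thSTS hsts)) := g
    -- Either g is invertible, and then J contains the identity, or 1 − g is. The latter is
    -- impossible because 1 − g kills the generator.
    rcases IsLocalRing.isUnit_or_isUnit_of_add_one (add_sub_cancel g' 1) with hu | hu
    · obtain ⟨u, hu⟩ := hu.exists_right_inv
      have h1 : (show leftGen (S.thSTS hsts) ⟶ leftGen (S.thSTS hsts) from u) ≫ g =
        𝟙 (leftGen (S.thSTS hsts)) := hu
      exact hJ (h1 ▸ J.comp_left _ g hg)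
    · obtain ⟨u, hu⟩ := hu.exists_left_inv
      have h1 : (𝟙 (leftGen (S.thSTS hsts)) - g) ≫
          (show leftGen (S.thSTS hsts) ⟶ leftGen (S.thSTS hsts) from u) =
        𝟙 (leftGen (S.thSTS hsts)) := hu
      have h2 : evalGen (natSTS hsts (𝟙 (leftGen (S.thSTS hsts)) - g)) = 0 :=
        (congrArg (residueTensor - ·) hgx).trans (sub_self _)
      have h3 := congrArg (fun k => evalGen (natSTS hsts k)) h1
      refine residueTensor_ne_zero (h3.symm.trans ?_)
      exact (congrArg ((natSTS hsts u).app residueObj).hom.hom h2).trans (map_zero _)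
  · intro X Y f
    refine Dominated.exists_map_eq (evalResidue hsts hK).functor (dominated_leftIdeal_thSTS hsts X)
      (dominated_leftIdeal_thSTS hsts Y) ?_ f
    rintro _ _ rfl rfl f
    let f' : thetaSTS.obj residueObj ⟶ thetaSTS.obj residueObj := (forgetK hK).map f
    obtain ⟨c, hc⟩ := exists_smul_residueTensor (f'.hom.hom residueTensor)
    refine ⟨homSTS hsts (leftMul thetaSTS c), (forgetK hK).map_injective
      (FGModuleCat.hom_ext (LinearMap.ext fun y => ?_))⟩
    obtain ⟨d, rfl⟩ := exists_smul_residueTensor y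
    refine Eq.trans ?_ ((f'.hom.hom.map_smul d residueTensor).trans
      (congrArg (d • ·) hc.symm)).symm
    exact smul_comm c d residueTensor
  · intro Y
    have := hasFiniteBiproducts_leftIdeal (S.thSTS hsts)
    have := (finitary_repK hK).idempotentSplit
    obtain ⟨e₀⟩ := exists_iso_objK (hK := hK)
      (X := (evalResidue hsts hK).functor.obj (leftGen (S.thSTS hsts))) indec_of_isLocalRing
    obtain ⟨n, f, b, ⟨hb⟩, ⟨e⟩, hf⟩ := exists_decomposition (by
      rintro _ rfl
      exact isLocalRing_end_objK hK) (dominated_repK Y)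
    obtain ⟨X, ⟨e'⟩⟩ := exists_obj_iso_of_bicone (evalResidue hsts hK).functor hb fun i =>
      ⟨leftGen (S.thSTS hsts), ⟨e₀ ≪≫ eqToIso (hf i).symm⟩⟩
    exact ⟨X, ⟨e' ≪≫ e⟩⟩

end BigCell

end SoergelA2

end

noncomputable section

namespace SoergelA2

open TwoRep

theorem isLocalRing_end_of_fullyFaithful {A B : Type*} [Category A] [Category B] [Preadditive A]
    [Preadditive B] (F : A ⥤ B) [F.Additive] [F.Full] [F.Faithful] {X : A}
    (h : IsLocalRing (End X)) : IsLocalRing (End (F.obj X)) := by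
  let φ : End X →* End (F.obj X) := F.mapEnd X
  have : Nontrivial (End (F.obj X)) :=
    ⟨⟨0, 1, fun e => zero_ne_one (α := End X) (F.map_injective
      (X := X) (Y := X) ((F.map_zero X X).trans (e.trans (F.map_id X).symm)))⟩⟩
  refine ⟨fun {f g} e => ?_⟩
  obtain ⟨f, rfl⟩ := F.map_surjective f
  obtain ⟨g, rfl⟩ := F.map_surjective g
  have e1 : f + g = 𝟙 X := F.map_injective (F.map_add.trans (e.trans (F.map_id X).symm))
  exact (IsLocalRing.isUnit_or_isUnit_of_add_one (R := End X) e1).imp (fun h => h.map φ)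
    fun h => h.map φ

theorem TwoRep.equivalent_sub_of_eq (M : TwoRep) {P Q : ObjectProperty M.carrier} (h : P = Q)
    (hP : M.Stable P) (hQ : M.Stable Q) : Equivalent (M.sub P hP) (M.sub Q hQ) := by
  subst h
  refine ⟨M.inclusion le_rfl hP hQ, ?_⟩
  exact
    { faithful := inferInstanceAs (ObjectProperty.ιOfLE (le_refl P)).Faithful
      full := inferInstanceAs (ObjectProperty.ιOfLE (le_refl P)).Full
      essSurj := ⟨fun X => ⟨X, ⟨Iso.refl X⟩⟩⟩ }

/-! ### Dependence on the parameters -/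

section Parameters

variable {a b a' b' : ℂ}

/-- Equal ideals give equal quotient objects, not merely isomorphic ones, so the two subcategories
coincide. -/
theorem projAnd_eq (e : genIdeal a b = genIdeal a' b') : projAnd a b = projAnd a' b' := by
  have key : ∀ I J : Ideal Coinv, I = J →
      FGModuleCat.of Coinv (Coinv ⧸ I) = FGModuleCat.of Coinv (Coinv ⧸ J) := by
    rintro I _ rfl
    rfl
  have e1 : quotObj a b = quotObj a' b' := key _ _ e
  rw [projAnd, projAnd, e1]

variable {hM : natural.Stable (projAnd a b)} {hM' : natural.Stable (projAnd a' b')}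

theorem forall_smul_eq_zero_of_iso {X Y : ModC} (e : X ≅ Y) {c : Coinv} (h : ∀ x : X, c • x = 0)
    (y : Y) : c • y = 0 := by
  have h1 : e.hom.hom.hom (e.inv.hom.hom y) = y :=
    congrArg (fun f : Y ⟶ Y => f.hom.hom y) e.inv_hom_id
  rw [← h1, ← map_smul, h, map_zero]

/-- A faithful morphism of `2`-representations preserves annihilators, since `C` acts by
`2`-endomorphisms of the identity. -/
theorem forall_smul_eq_zero_iff (Φ : Hom (repM a b hM) (repM a' b' hM')) [Φ.functor.Faithful]
    (X : (repM a b hM).carrier) (c : Coinv) :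
    (∀ x : (forgetM hM).obj X, c • x = 0) ↔
      ∀ x : (forgetM hM').obj (Φ.functor.obj X), c • x = 0 := by
  have := Φ.additive
  let α : S.one ⟶ S.one := ObjectProperty.homMk (P := IsSoergel) (leftMul (𝟭 ModC) c)
  have key : ∀ {a b : ℂ} (hM : natural.Stable (projAnd a b)) (X : (repM a b hM).carrier),
      ((repM a b hM).act₂ α).app X = 0 ↔ ∀ x : (forgetM hM).obj X, c • x = 0 := by
    intro a b hM X
    constructor
    · intro h x
      exact congrArg (fun f : (forgetM hM).obj X ⟶ (forgetM hM).obj X => f.hom.hom x)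
        (congrArg (forgetM hM).map h)
    · intro h
      exact (forgetM hM).map_injective (FGModuleCat.hom_ext (LinearMap.ext fun x => h x))
  rw [← key hM X, ← key hM' (Φ.functor.obj X)]
  have h1 := Φ.comm_naturality α X
  constructor
  · intro h
    rw [h, Functor.map_zero, zero_comp] at h1
    exact (cancel_epi _).1 (h1.symm.trans comp_zero.symm)
  · intro h
    rw [h, comp_zero] at h1
    exact Φ.functor.map_injective
      (((cancel_mono _).1 (h1.trans zero_comp.symm)).trans (Functor.map_zero _ _ _).symm)

/-- The image of M_{a,b} has local endomorphism ring, so it is C or M_{a',b'}. The first is excluded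
because ℓ annihilates the image; in the second case the annihilators agree, and they are the two
ideals. -/
theorem genIdeal_eq_of_equivalent (h : Admissible a b) (h' : Admissible a' b')
    (e : Equivalent (repM a b hM) (repM a' b' hM')) : genIdeal a b = genIdeal a' b' := by
  obtain ⟨Φ, hΦ⟩ := e
  have := Φ.additive
  have hloc := isLocalRing_end_of_fullyFaithful Φ.functor (isLocalRing_end_objM h hM)
  have key := forall_smul_eq_zero_iff Φ (objM hM)
  rcases exists_iso_objC_or_objM h' hM' (@indec_of_isLocalRing _ _ _ _ hloc) with ⟨⟨i⟩⟩ | ⟨⟨i⟩⟩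
  · exfalso
    have h1 : ell a b * 1 = 0 := forall_smul_eq_zero_of_iso ((forgetM hM').mapIso i)
      ((key (ell a b)).1 ell_smul_quotObj) (1 : Coinv)
    exact ell_ne_zero h ((mul_one _).symm.trans h1)
  · exact genIdeal_eq_of_annihilator fun c => (key c).trans
      ⟨forall_smul_eq_zero_of_iso ((forgetM hM').mapIso i),
        forall_smul_eq_zero_of_iso ((forgetM hM').mapIso i.symm)⟩

/-- An equivalence or a module isomorphism preserves annihilators, hence the ideal, hence (a, b) up
to a scalar. Conversely, proportional parameters generate the same ideal. -/
theorem tfae_equivalent_repM (h : Admissible a b) (h' : Admissible a' b') :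
    List.TFAE [Equivalent (repM a b hM) (repM a' b' hM'),
      Nonempty (quotMod a b ≃ₗ[Coinv] quotMod a' b'),
      ∃ c : ℂ, c ≠ 0 ∧ a = c * a' ∧ b = c * b'] := by
  tfae_have 1 → 3 := fun e => exists_smul_of_genIdeal_eq h (genIdeal_eq_of_equivalent h h' e)
  tfae_have 3 → 1 := by
    rintro ⟨c, hc, rfl, rfl⟩
    exact natural.equivalent_sub_of_eq (projAnd_eq (genIdeal_smul hc)) hM hM'
  tfae_have 2 → 3 := by
    rintro ⟨e⟩
    refine exists_smul_of_genIdeal_eq h (genIdeal_eq_of_annihilator fun c => ⟨fun hc m => ?_,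
      fun hc m => ?_⟩)
    · rw [← e.apply_symm_apply m, ← map_smul, hc, map_zero]
    · rw [← e.symm_apply_apply m, ← map_smul, hc, map_zero]
  tfae_have 3 → 2 := by
    rintro ⟨c, hc, rfl, rfl⟩
    exact ⟨Submodule.quotEquivOfEq _ _ (genIdeal_smul hc)⟩
  tfae_finish

end Parameters

end SoergelA2

end

theorem theorem64 :
    ∃ (hsts : IsSoergel thetaSTS)
      (hK : TwoRep.natural.Stable projC)
      (hM : ∀ a b : ℂ, Admissible a b →
        TwoRep.natural.Stable (projAnd a b)),
      (∀ (a b : ℂ) (h : Admissible a b),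
        ((repK hK).Finitary ∧ (repM a b (hM a b h)).Finitary ∧
          (repN a b hK (hM a b h)).Finitary) ∧
        (TwoRep.IsShortExact (inclKM a b hK (hM a b h))
            (projMN a b hK (hM a b h)) ∧
          TwoRep.Equivalent (TwoRep.cellRep (S.thSTS hsts)) (repK hK) ∧
          TwoRep.Equivalent (TwoRep.cellRep S.one) (repN a b hK (hM a b h))) ∧
        ∃ ρ τ : (repM a b (hM a b h)).Vertex,
          (∀ v, v = ρ ∨ v = τ) ∧
          (∀ X : (repM a b (hM a b h)).Ind,
            (repM a b (hM a b h)).vertex X = ρ ↔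
              ¬ CategoryTheory.Limits.IsZero
                ((projMN a b hK (hM a b h)).functor.obj X.1)) ∧
          (∀ X : (repM a b (hM a b h)).Ind,
            (repM a b (hM a b h)).vertex X = τ ↔
              ∃ Y : (repK hK).carrier,
                Nonempty (X.1 ≅ (inclKM a b hK (hM a b h)).functor.obj Y)) ∧
          ρ ⋖ τ ∧
          (repM a b (hM a b h)).decoration ρ τ =
            {F | Nonempty (F ≅ S.thS) ∨ Nonempty (F ≅ S.thT) ∨
              Nonempty (F ≅ S.thST) ∨ Nonempty (F ≅ S.thTS) ∨
              Nonempty (F ≅ S.thSTS hsts)}) ∧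
      (∀ (a b a' b' : ℂ) (h : Admissible a b) (h' : Admissible a' b'),
        List.TFAE [
          TwoRep.Equivalent (repM a b (hM a b h))
            (repM a' b' (hM a' b' h')),
          Nonempty (quotMod a b ≃ₗ[Coinv] quotMod a' b'),
          ∃ c : ℂ, c ≠ 0 ∧ a = c * a' ∧ b = c * b']) :=
  ⟨thetaSTS_isSoergel, stable_projC, fun _ _ h => stable_projAnd h,
    fun a b h => ⟨⟨finitary_repK _, finitary_repM h _, finitary_repN _ _ h⟩,
      ⟨isShortExact h _ _, equivalent_cellRep_thSTS _ _, equivalent_cellRep_one h _ _⟩,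
      (repM a b (stable_projAnd h)).vertex (indM h _),
      (repM a b (stable_projAnd h)).vertex (indC _),
      vertex_cases h _, fun _ => vertex_eq_indM_iff_projection h _ _,
      fun _ => vertex_eq_indC_iff_inclusion h _ _, vertex_covBy h _, decoration_eq h _ _⟩,
    fun _ _ _ _ h h' => tfae_equivalent_repM h h'⟩
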